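/- **Theorem 2.2 (weak–strong uniqueness for the Maxwell–Landau–Lifshitz equations).** Consider on $\mathbb{R}^3$ the Maxwell–Landau–Lifshitz (MLL) system, in Gilbert form, $$\partial_t m+m\wedge\partial_t m=2\sum_{i=1}^3\partial_i(m\wedge\partial_i m)+2\,m\wedge H,\qquad \partial_t H+\operatorname{curl}E=-\partial_t m,$$ $$\partial_t E-\operatorname{curl}H=0,\qquad \operatorname{div}E=\operatorname{div}(H+m)=0 .$$ Let $m_0,E_0,H_0:\mathbb{R}^3\to\mathbb{R}^3$ be $C^\infty$ with $|m_0|=1$, $\nabla m_0\in L^2$, $E_0,H_0\in L^2$ and $\operatorname{div}E_0=\operatorname{div}(H_0+m_0)=0$. (a) Let $(m_2,E_2,H_2):(0,\infty)\times\mathbb{R}^3\to\mathbb{R}^9$ be a global weak solution with initial value $(m_0,E_0,H_0)$ satisfying the energy inequality. That is: $m_2$ is measurable with $|m_2|=1$ a.e. and has weak derivatives such that, for all $S>0$, $\nabla m_2\in L^\infty((0,S);L^2(\mathbb{R}^3))$ and $\partial_t m_2\in L^2((0,S)\times\mathbb{R}^3)$; $E_2,H_2\in L^\infty((0,S);L^2(\mathbb{R}^3))$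 for all $S>0$; $m_2$ has trace $m_0$ at $t=0$; for all $\Psi\in C_c^\infty([0,\infty)\times\mathbb{R}^3;\mathbb{R}^3)$, $$\int_0^\infty\!\!\int(\partial_t m_2+m_2\wedge\partial_t m_2)\cdot\Psi=-2\sum_i\int_0^\infty\!\!\int(m_2\wedge\partial_i m_2)\cdot\partial_i\Psi+2\int_0^\infty\!\!\int(m_2\wedge H_2)\cdot\Psi,$$ $$-\int_0^\infty\!\!\int(H_2+m_2)\cdot\partial_t\Psi+\int_0^\infty\!\!\int E_2\cdot\operatorname{curl}\Psi=\int(H_0+m_0)\cdot\Psi(0,\cdot),$$ $$-\int_0^\infty\!\!\int E_2\cdot\partial_t\Psi-\int_0^\infty\!\!\int H_2\cdot\operatorname{curl}\Psi=\int E_0\cdot\Psi(0,\cdot);$$ $\operatorname{div}E_2=\operatorname{div}(H_2+m_2)=0$ in the sense of distributions; and, for almost every $S>0$, $$\int\big(|E_2|^2+|H_2|^2+|\nabla m_2|^2\big)(S,x)\,dx+\int_0^S\!\!\int|\partial_t m_2|^2\,dx\,dt\le\int\big(|E_0|^2+|H_0|^2+|\nabla m_0|^2\big)\,dx .$$ (b)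 Let $T>0$ and let $(m_1,E_1,H_1)$ be a smooth solution of the MLL system up to time $T$ with the same initial value: $m_1,E_1,H_1$ are $C^\infty$ on $(0,T)\times\mathbb{R}^3$, their derivatives of every order (order $0$ included) are bounded on $(0,T')\times\mathbb{R}^3$ for every $T'<T$, the equations hold pointwise on $(0,T)\times\mathbb{R}^3$, and $(m_1,E_1,H_1)(t,x)\to(m_0,E_0,H_0)(x)$ as $t\to0^+$ for every $x$. Then $(m_2,E_2,H_2)=(m_1,E_1,H_1)$ almost everywhere on $(0,T)\times\mathbb{R}^3$. -/

import Mathlib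

namespace MLL

open MeasureTheory Filter Topology Set
open scoped ContDiff ENNReal NNReal Matrix

noncomputable section

/-- Physical space `ℝ³` with the Euclidean norm. -/
abbrev R3 : Type := EuclideanSpace ℝ (Fin 3)

/-- Time-space points `(t, x)`. -/
abbrev ST : Type := ℝ × R3

/-- The cross product `a ∧ b` on `ℝ³`. -/
def cross (a b : R3) : R3 := WithLp.toLp 2 (a.ofLp ⨯₃ b.ofLp)

/-- The `i`-th vector of the canonical basis. -/
def e (i : Fin 3) : R3 := EuclideanSpace.single i 1

/-- Classical partial derivative `∂ᵢ u` of a function of `x ∈ ℝ³`. -/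
def pd (i : Fin 3) (u : R3 → R3) (x : R3) : R3 := fderiv ℝ u x (e i)

/-- Classical time derivative of a function of `(t, x)`. -/
def dt {F : Type} [NormedAddCommGroup F] [NormedSpace ℝ F] (u : ST → F) (p : ST) : F :=
  fderiv ℝ u p (1, 0)

/-- Classical space derivative `∂ᵢ u` of a function of `(t, x)`. -/
def dx {F : Type} [NormedAddCommGroup F] [NormedSpace ℝ F] (i : Fin 3) (u : ST → F) (p : ST) : F :=
  fderiv ℝ u p (0, e i)

/-- The curl in the space variables. -/
def curl (u : ST → R3) (p : ST) : R3 :=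
  !₂[dx 1 u p 2 - dx 2 u p 1, dx 2 u p 0 - dx 0 u p 2, dx 0 u p 1 - dx 1 u p 0]

/-- The divergence in the space variables. -/
def div (u : ST → R3) (p : ST) : ℝ := ∑ i, dx i u p i

/-- The open slab `(0, T) × ℝ³`. -/
def slab (T : ℝ) : Set ST := Ioo 0 T ×ˢ univ

/-- The half space `(0, ∞) × ℝ³`. -/
def future : Set ST := Ioi 0 ×ˢ univ

/-- Smooth initial data of finite energy, with `|m₀| = 1` and `div E₀ = div (H₀ + m₀) = 0`. -/
structure IsSmoothData (m₀ E₀ H₀ : R3 → R3) : Prop where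
  smooth_m : ContDiff ℝ ∞ m₀
  smooth_E : ContDiff ℝ ∞ E₀
  smooth_H : ContDiff ℝ ∞ H₀
  norm_m : ∀ᵐ x, ‖m₀ x‖ = 1
  grad_m : ∀ i, MemLp (pd i m₀) 2 volume
  memLp_E : MemLp E₀ 2 volume
  memLp_H : MemLp H₀ 2 volume
  div_E : ∀ x, ∑ i, pd i E₀ x i = 0
  div_Hm : ∀ x, ∑ i, pd i (fun y => H₀ y + m₀ y) x i = 0

/-- Test functions: restrictions to `[0, ∞) × ℝ³` are exactly the elements of
`C_c^∞([0, ∞) × ℝ³)`, so they need not vanish at `t = 0`. -/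
def IsTest {F : Type} [NormedAddCommGroup F] [NormedSpace ℝ F] (Ψ : ST → F) : Prop :=
  ContDiff ℝ ∞ Ψ ∧ HasCompactSupport Ψ

/-- `u ∈ L^∞((0, T); L²(ℝ³))` for every finite `T > 0`. -/
def LocLinftyL2 (u : ST → R3) : Prop :=
  AEStronglyMeasurable u (volume.restrict future) ∧
    ∀ T : ℝ, 0 < T → ∃ C : ℝ≥0, ∀ᵐ t ∂(volume.restrict (Ioo 0 T)),
      ∫⁻ x : R3, ‖u (t, x)‖ₑ ^ 2 ≤ C

/-- `g` is the weak derivative `∂ᵢ u` on `(0, ∞) × ℝ³`. -/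
def IsWeakDx (i : Fin 3) (u g : ST → R3) : Prop :=
  ∀ Ψ : ST → R3, IsTest Ψ →
    ∫ p in future, inner ℝ (u p) (dx i Ψ p) = - ∫ p in future, inner ℝ (g p) (Ψ p)

/-- `g` is the weak time derivative of `u` on `(0, ∞) × ℝ³`, and `u` has trace `u₀` at `t = 0`
(Green's formula in time, the boundary term being given by the trace). -/
def IsWeakDtWithTrace (u g : ST → R3) (u₀ : R3 → R3) : Prop :=
  ∀ Ψ : ST → R3, IsTest Ψ →
    ∫ p in future, inner ℝ (u p) (dt Ψ p) =
      - (∫ x : R3, inner ℝ (u₀ x) (Ψ (0, x))) - ∫ p in future, inner ℝ (g p) (Ψ p)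

/-- `(m, E, H)` is a global weak solution of the Maxwell-Landau-Lifshitz equations with initial
value `(m₀, E₀, H₀)`, in the energy class and satisfying the energy inequality; `mt` and `G i` are
the weak derivatives `∂ₜ m` and `∂ᵢ m`. -/
structure IsWeakSolutionWith (m₀ E₀ H₀ : R3 → R3) (m E H : ST → R3)
    (mt : ST → R3) (G : Fin 3 → ST → R3) : Prop where
  meas_m : AEStronglyMeasurable m (volume.restrict future)
  norm_m : ∀ᵐ p ∂(volume.restrict future), ‖m p‖ = 1
  weak_dt : IsWeakDtWithTrace m mt m₀
  weak_dx : ∀ i, IsWeakDx i m (G i)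
  grad_m : ∀ i, LocLinftyL2 (G i)
  memLp_mt : ∀ T : ℝ, 0 < T → MemLp mt 2 (volume.restrict (slab T))
  class_E : LocLinftyL2 E
  class_H : LocLinftyL2 H
  /-- `∂ₜ m + m ∧ ∂ₜ m = 2 ∑ᵢ ∂ᵢ (m ∧ ∂ᵢ m) + 2 m ∧ H` -/
  gilbert : ∀ Ψ : ST → R3, IsTest Ψ →
    ∫ p in future, inner ℝ (mt p + cross (m p) (mt p)) (Ψ p) =
      - 2 * (∑ i, ∫ p in future, inner ℝ (cross (m p) (G i p)) (dx i Ψ p))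
        + 2 * ∫ p in future, inner ℝ (cross (m p) (H p)) (Ψ p)
  /-- `∂ₜ (H + m) + curl E = 0`, with initial value `H₀ + m₀` -/
  faraday : ∀ Ψ : ST → R3, IsTest Ψ →
    - (∫ p in future, inner ℝ (H p + m p) (dt Ψ p)) + ∫ p in future, inner ℝ (E p) (curl Ψ p) =
      ∫ x : R3, inner ℝ (H₀ x + m₀ x) (Ψ (0, x))
  /-- `∂ₜ E - curl H = 0`, with initial value `E₀` -/
  ampere : ∀ Ψ : ST → R3, IsTest Ψ →
    - (∫ p in future, inner ℝ (E p) (dt Ψ p)) - ∫ p in future, inner ℝ (H p) (curl Ψ p) =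
      ∫ x : R3, inner ℝ (E₀ x) (Ψ (0, x))
  div_E : ∀ φ : ST → ℝ, IsTest φ → ∫ p in future, ∑ i, E p i * dx i φ p = 0
  div_Hm : ∀ φ : ST → ℝ, IsTest φ → ∫ p in future, ∑ i, (H p + m p) i * dx i φ p = 0
  energy : ∀ᵐ T ∂(volume.restrict (Ioi (0 : ℝ))),
    (∫⁻ x : R3, (‖E (T, x)‖ₑ ^ 2 + ‖H (T, x)‖ₑ ^ 2 + ∑ i, ‖G i (T, x)‖ₑ ^ 2))
        + ∫⁻ t in Ioo 0 T, ∫⁻ x : R3, ‖mt (t, x)‖ₑ ^ 2 ≤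
      ∫⁻ x : R3, (‖E₀ x‖ₑ ^ 2 + ‖H₀ x‖ₑ ^ 2 + ∑ i, ‖pd i m₀ x‖ₑ ^ 2)

/-- Global weak solutions with the energy inequality. -/
def IsWeakSolution (m₀ E₀ H₀ : R3 → R3) (m E H : ST → R3) : Prop :=
  ∃ (mt : ST → R3) (G : Fin 3 → ST → R3), IsWeakSolutionWith m₀ E₀ H₀ m E H mt G

/-- `u` is smooth on `(0, T) × ℝ³`, all its derivatives being bounded on `(0, T') × ℝ³` for every
`T' < T` (hence `u` extends smoothly to `[0, T) × ℝ³`), and `u` has initial value `u₀`. -/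
structure IsSmoothUpTo (T : ℝ) (u : ST → R3) (u₀ : R3 → R3) : Prop where
  smooth : ContDiffOn ℝ ∞ u (slab T)
  bounded : ∀ T' < T, ∀ n : ℕ, ∃ C : ℝ, ∀ p ∈ slab T', ‖iteratedFDeriv ℝ n u p‖ ≤ C
  initial : ∀ x, Tendsto (fun t : ℝ => u (t, x)) (𝓝[>] 0) (𝓝 (u₀ x))

/-- `(m, E, H)` is a smooth solution of the Maxwell-Landau-Lifshitz equations up to time `T`, with
initial value `(m₀, E₀, H₀)`. -/
structure IsSmoothSolution (T : ℝ) (m₀ E₀ H₀ : R3 → R3) (m E H : ST → R3) : Prop where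
  smooth_m : IsSmoothUpTo T m m₀
  smooth_E : IsSmoothUpTo T E E₀
  smooth_H : IsSmoothUpTo T H H₀
  gilbert : ∀ p ∈ slab T,
    dt m p + cross (m p) (dt m p) =
      (2 : ℝ) • (∑ i, dx i (fun q => cross (m q) (dx i m q)) p) + (2 : ℝ) • cross (m p) (H p)
  faraday : ∀ p ∈ slab T, dt H p + curl E p = - dt m p
  ampere : ∀ p ∈ slab T, dt E p - curl H p = 0
  div_E : ∀ p ∈ slab T, div E p = 0
  div_Hm : ∀ p ∈ slab T, div (fun q => H q + m q) p = 0

end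

end MLL

namespace MLL

open MeasureTheory Filter Topology Set
open scoped ContDiff ENNReal NNReal Matrix

noncomputable section

/-! The proof is a relative energy argument. Write `v₁ = ∂ₜ m₁`, `v₂ = ∂ₜ m₂`. The quantity
controlled is the energy of the difference, `|E₁ - E₂|² + |H₁ - H₂|² + |∇(m₁ - m₂)|²`, together with
the dissipation `|v₁ - v₂|²`. Expanding the squares leaves three pieces: the energy of the smooth
solution, the energy of the weak one, and minus twice a bilinear cross term. The first two are
bounded by the initial energy (`IsSmoothSolution.energy_le`, `IsWeakSolutionWith.energy_le`). The
cross term equals the initial energy up to a remainder (`cross_identity`), so the initial energies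
cancel.

The cross identity comes from testing the weak equations with quantities built from the smooth
solution: Ampère with `E₁`, Faraday with `H₁`, the relation `∂ₜ∂ᵢ m₂ = ∂ᵢ∂ₜ m₂` with `∂ᵢ m₁`, and
Gilbert with `w = -m₁ ∧ v₁`. Since `|m₁| = 1` and `m₁ · v₁ = 0`, one has `v₁ = m₁ ∧ w`, and the
effective field is `Δm₁ + H₁ = (v₁ + w)/2 + c m₁`. With these two formulas, and `m₂ · v₂ = 0`, every
leftover term becomes a product of two differences with bounded coefficients
(`exchange_terms_gradient`, `exchange_terms_field`, `cross_terms`).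

Grönwall's lemma is replaced by a weight `ζ(t)` that vanishes from time `S` on and satisfies `-ζ' ≥
lam ζ`: the energy carries the factor `-ζ'` and the dissipation the factor `ζ`. A large `lam`
absorbs the remainder. The zeroth order difference `m₁ - m₂` does not appear in the energy; the two
magnetizations share their initial value, so it is the time integral of `v₁ - v₂`, and its weighted
`L²` norm is at most `S / lam` times that of `v₁ - v₂` (`memLp_sub`).

Three technical points take most of the length. The smooth solution is not assumed to have finite
energy at positive times, which is obtained from a weight in space whose gradient is small compared
with itself. The smooth solution is known only for `t > 0`, so test functions built from it are
first translated in time. Finally `m₂ · v₂ = 0` requires absolute continuity of `m₂` on almost every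
line `x = const` (`ae_eq_integral`, `inner_m_mt`). -/

/-! ### Cross product algebra and pointwise consequences of the Gilbert equation. -/

lemma inner_eq (a b : R3) : inner ℝ a b = a 0 * b 0 + a 1 * b 1 + a 2 * b 2 := by
  simp [PiLp.inner_apply, Fin.sum_univ_three]; ring

lemma norm_sq_eq (a : R3) : ‖a‖ ^ 2 = a 0 ^ 2 + a 1 ^ 2 + a 2 ^ 2 := by
  rw [← real_inner_self_eq_norm_sq, inner_eq]; ring

@[simp] lemma cross_zero' (a b : R3) : cross a b 0 = a 1 * b 2 - a 2 * b 1 := by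
  simp [cross, cross_apply]
@[simp] lemma cross_one' (a b : R3) : cross a b 1 = a 2 * b 0 - a 0 * b 2 := by
  simp [cross, cross_apply]
@[simp] lemma cross_two' (a b : R3) : cross a b 2 = a 0 * b 1 - a 1 * b 0 := by
  simp [cross, cross_apply]

lemma ext3 {a b : R3} (h0 : a 0 = b 0) (h1 : a 1 = b 1) (h2 : a 2 = b 2) : a = b := by
  ext i; fin_cases i <;> assumption

/-- The cross product as a continuous bilinear map. -/
def crossL : R3 →L[ℝ] R3 →L[ℝ] R3 :=
  LinearMap.toContinuousBilinearMap (LinearMap.mk₂ ℝ cross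
    (fun a b c => ext3 (by simp; ring) (by simp; ring) (by simp; ring))
    (fun a b c => ext3 (by simp; ring) (by simp; ring) (by simp; ring))
    (fun a b c => ext3 (by simp; ring) (by simp; ring) (by simp; ring))
    (fun a b c => ext3 (by simp; ring) (by simp; ring) (by simp; ring)))

lemma crossL_apply (a b : R3) : crossL a b = cross a b := rfl

lemma norm_cross_le (a b : R3) : ‖cross a b‖ ≤ ‖a‖ * ‖b‖ := by
  refine (sq_le_sq₀ (by positivity) (by positivity)).1 ?_
  rw [mul_pow, norm_sq_eq, norm_sq_eq, norm_sq_eq]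
  simp only [cross_zero', cross_one', cross_two']
  nlinarith [sq_nonneg (a 0 * b 0 + a 1 * b 1 + a 2 * b 2)]

lemma inner_cross_self (a b : R3) : inner ℝ a (cross a b) = 0 := by
  simp only [inner_eq, cross_zero', cross_one', cross_two']; ring

lemma cross_self' (a : R3) : cross a a = 0 := by
  apply ext3 <;> simp <;> ring

lemma cross_neg' (a b : R3) : cross a (-b) = -cross a b := by
  apply ext3 <;> simp <;> ring

/-- `a ∧ (a ∧ v) = -v` if `a` is a unit vector orthogonal to `v`. -/
lemma cross_cross_of_unit {a v : R3} (ha : ‖a‖ = 1) (hv : inner ℝ a v = 0) :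
    cross a (cross a v) = -v := by
  have h1 : a 0 ^ 2 + a 1 ^ 2 + a 2 ^ 2 = 1 := by rw [← norm_sq_eq, ha]; norm_num
  rw [inner_eq] at hv
  apply ext3 <;> simp
  · linear_combination a 0 * hv - v 0 * h1
  · linear_combination a 1 * hv - v 1 * h1
  · linear_combination a 2 * hv - v 2 * h1

/-- Pairing the Gilbert relation with `2h - v` makes the triple products cancel by antisymmetry,
without any normalization of `m`. For the effective field `h` this identifies the power `2 v · h`
with the dissipation. -/
lemma inner_field_of_gilbert {m v h : R3} (hg : v + cross m v = (2 : ℝ) • cross m h) :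
    2 * inner ℝ v h = ‖v‖ ^ 2 := by
  have h0 := congrArg (fun a : R3 => a 0) hg
  have h1 := congrArg (fun a : R3 => a 1) hg
  have h2 := congrArg (fun a : R3 => a 2) hg
  simp at h0 h1 h2
  rw [norm_sq_eq, inner_eq]
  linear_combination (2 * h 0 - v 0) * h0 + (2 * h 1 - v 1) * h1 + (2 * h 2 - v 2) * h2

/-- Applying `m ∧` to the Gilbert relation and expanding the double products determines `h` up to
its component along `m`. -/
lemma field_of_gilbert {m v h : R3} (hm : ‖m‖ = 1) (hv : inner ℝ m v = 0)
    (hg : v + cross m v = (2 : ℝ) • cross m h) :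
    h = (1 / 2 : ℝ) • (v - cross m v) + (inner ℝ m h) • m := by
  have hn : m 0 ^ 2 + m 1 ^ 2 + m 2 ^ 2 = 1 := by rw [← norm_sq_eq, hm]; norm_num
  have h0 := congrArg (fun a : R3 => a 0) hg
  have h1 := congrArg (fun a : R3 => a 1) hg
  have h2 := congrArg (fun a : R3 => a 2) hg
  simp at h0 h1 h2
  rw [inner_eq] at hv ⊢
  apply ext3 <;> simp
  · linear_combination (1/2) * (m 1 * h2 - m 2 * h1) - (1/2) * m 0 * hv + (v 0 / 2 - h 0) * hn
  · linear_combination (1/2) * (m 2 * h0 - m 0 * h2) - (1/2) * m 1 * hv + (v 1 / 2 - h 1) * hn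
  · linear_combination (1/2) * (m 0 * h1 - m 1 * h0) - (1/2) * m 2 * hv + (v 2 / 2 - h 2) * hn

/-- Here `g`, `G` stand for `∂ᵢ m₁`, `∂ᵢ m₂`, while `L = ∂ᵢ∂ᵢ m₁`, `w` is the spin field of `m₁` and
`wi = ∂ᵢ w`. The first term on the right is a product of two differences; the second, still linear
in `m₁ - m₂`, is compensated in `exchange_terms_field`. -/
lemma exchange_terms_gradient (m₁ m₂ g G L w wi : R3) :
    - inner ℝ G (cross g w + cross m₁ wi) - inner ℝ (cross m₂ G) wi
      + inner ℝ m₂ (cross L w + cross g wi) + inner ℝ G (cross g w)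
      - inner ℝ m₁ (cross L w + cross g wi)
      = - inner ℝ (G - g) (cross (m₁ - m₂) wi) - inner ℝ (m₁ - m₂) (cross L w) := by
  simp [inner_eq]; ring

/-- The second derivatives `L` are eliminated through the effective field formula, and `m₂ · v₂ = 0`
completes the coefficient of `c` to a product of differences. What remains besides `v₁ · v₂` is
quadratic in differences. -/
lemma exchange_terms_field {m₁ m₂ v₁ v₂ w L H₁ H₂ : R3} {c : ℝ} (hw : v₁ = cross m₁ w)
    (hh : L + H₁ = (1 / 2 : ℝ) • (v₁ + w) + c • m₁) (hv : inner ℝ m₂ v₂ = 0) :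
    inner ℝ H₂ v₁ + inner ℝ H₁ v₂ + inner ℝ v₂ L - (1 / 2) * inner ℝ (v₂ + cross m₂ v₂) w
      + inner ℝ (cross m₂ H₂) w - inner ℝ (m₁ - m₂) (cross L w)
      = inner ℝ v₁ v₂ - ((1 / 2) * inner ℝ (v₂ - v₁) (cross (m₁ - m₂) w)
        + c * inner ℝ (m₁ - m₂) (v₁ - v₂) - inner ℝ (H₂ - H₁) (cross (m₁ - m₂) w)) := by
  obtain rfl : L = (1 / 2 : ℝ) • (v₁ + w) + c • m₁ - H₁ := eq_sub_of_add_eq hh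
  subst hw
  simp only [inner_eq] at hv
  simp [inner_eq]
  linear_combination c * hv

/-! ### Calculus of smooth functions with derivatives bounded on slabs. -/

section

variable {F G K : Type} [NormedAddCommGroup F] [NormedSpace ℝ F] [NormedAddCommGroup G]
  [NormedSpace ℝ G] [NormedAddCommGroup K] [NormedSpace ℝ K]

lemma isOpen_slab (T : ℝ) : IsOpen (slab T) := isOpen_Ioo.prod isOpen_univ

lemma isOpen_future : IsOpen future := isOpen_Ioi.prod isOpen_univ

lemma mem_slab {T : ℝ} {p : ST} : p ∈ slab T ↔ 0 < p.1 ∧ p.1 < T := by simp [slab]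

lemma mem_future {p : ST} : p ∈ future ↔ 0 < p.1 := by simp [future]

lemma slab_mono {S T : ℝ} (h : S ≤ T) : slab S ⊆ slab T := fun _ hp =>
  mem_slab.2 ⟨(mem_slab.1 hp).1, (mem_slab.1 hp).2.trans_le h⟩

lemma slab_subset_future (T : ℝ) : slab T ⊆ future := fun _ hp => mem_future.2 (mem_slab.1 hp).1

/-- Smooth on `(0, T) × ℝ³`, with all derivatives bounded on `(0, S) × ℝ³` for every `S < T`. -/
structure BddSmooth (T : ℝ) (u : ST → F) : Prop where
  smooth : ContDiffOn ℝ ∞ u (slab T)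
  bounded : ∀ S < T, ∀ n : ℕ, ∃ C : ℝ, ∀ p ∈ slab S, ‖iteratedFDeriv ℝ n u p‖ ≤ C

lemma IsSmoothUpTo.bddSmooth {T : ℝ} {u : ST → R3} {u₀ : R3 → R3} (h : IsSmoothUpTo T u u₀) :
    BddSmooth T u := ⟨h.smooth, h.bounded⟩

namespace BddSmooth

variable {T : ℝ} {u : ST → F}

lemma contDiffAt (h : BddSmooth T u) {p : ST} (hp : p ∈ slab T) : ContDiffAt ℝ ∞ u p :=
  (h.smooth p hp).contDiffAt ((isOpen_slab T).mem_nhds hp)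

lemma differentiableAt (h : BddSmooth T u) {p : ST} (hp : p ∈ slab T) : DifferentiableAt ℝ u p :=
  (h.contDiffAt hp).differentiableAt (by simp)

lemma continuousOn (h : BddSmooth T u) : ContinuousOn u (slab T) := h.smooth.continuousOn

lemma exists_bound (h : BddSmooth T u) {S : ℝ} (hS : S < T) :
    ∃ C : ℝ, 0 ≤ C ∧ ∀ p ∈ slab S, ‖u p‖ ≤ C := by
  obtain ⟨C, hC⟩ := h.bounded S hS 0
  exact ⟨max C 0, le_max_right _ _, fun p hp => by
    have := hC p hp; rw [norm_iteratedFDeriv_zero] at this; exact this.trans (le_max_left _ _)⟩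

lemma exists_bound_fderiv (h : BddSmooth T u) {S : ℝ} (hS : S < T) :
    ∃ C : ℝ, 0 ≤ C ∧ ∀ p ∈ slab S, ‖fderiv ℝ u p‖ ≤ C := by
  obtain ⟨C, hC⟩ := h.bounded S hS 1
  exact ⟨max C 0, le_max_right _ _, fun p hp => by
    have := hC p hp; rw [norm_iteratedFDeriv_one] at this; exact this.trans (le_max_left _ _)⟩

lemma fderiv' (h : BddSmooth T u) : BddSmooth T (fderiv ℝ u) := by
  refine ⟨h.smooth.fderiv_of_isOpen (isOpen_slab T) (by simp), fun S hS n => ?_⟩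
  obtain ⟨C, hC⟩ := h.bounded S hS (n + 1)
  exact ⟨C, fun p hp => by rw [norm_iteratedFDeriv_fderiv]; exact hC p hp⟩

lemma clm (h : BddSmooth T u) (L : F →L[ℝ] G) : BddSmooth T (fun p => L (u p)) := by
  refine ⟨L.contDiff.comp_contDiffOn h.smooth, fun S hS n => ?_⟩
  obtain ⟨C, hC⟩ := h.bounded S hS n
  refine ⟨‖L‖ * C, fun p hp => ?_⟩
  have hp' := slab_mono hS.le hp
  refine (L.norm_iteratedFDeriv_comp_left (h.contDiffAt hp') (n := n)
    (by exact_mod_cast le_top)).trans ?_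
  gcongr
  exact hC p hp

lemma bilin {v : ST → G} (h : BddSmooth T u) (hv : BddSmooth T v) (B : F →L[ℝ] G →L[ℝ] K) :
    BddSmooth T (fun p => B (u p) (v p)) := by
  refine ⟨B.isBoundedBilinearMap.contDiff.comp_contDiffOn (h.smooth.prodMk hv.smooth),
    fun S hS n => ?_⟩
  choose C hC using h.bounded S hS
  choose D hD using hv.bounded S hS
  refine ⟨‖B‖ * ∑ i ∈ Finset.range (n + 1), (n.choose i : ℝ) * C i * D (n - i), fun p hp => ?_⟩
  have hp' := slab_mono hS.le hp
  have ho := isOpen_slab T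
  have := B.norm_iteratedFDerivWithin_le_of_bilinear h.smooth hv.smooth ho.uniqueDiffOn hp'
    (n := n) (by exact_mod_cast le_top)
  simp only [iteratedFDerivWithin_of_isOpen _ ho hp'] at this
  refine this.trans ?_
  have h0 : ∀ i, 0 ≤ C i := fun i => (norm_nonneg _).trans (hC i p hp)
  gcongr with i hi
  · exact mul_nonneg (by positivity) (h0 i)
  · exact hC i p hp
  · exact hD _ p hp

lemma add {v : ST → F} (h : BddSmooth T u) (hv : BddSmooth T v) :
    BddSmooth T (fun p => u p + v p) := by
  refine ⟨h.smooth.add hv.smooth, fun S hS n => ?_⟩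
  obtain ⟨C, hC⟩ := h.bounded S hS n
  obtain ⟨D, hD⟩ := hv.bounded S hS n
  refine ⟨C + D, fun p hp => ?_⟩
  have hp' := slab_mono hS.le hp
  rw [fun_iteratedFDeriv_add_apply ((h.contDiffAt hp').of_le (by exact_mod_cast le_top))
    ((hv.contDiffAt hp').of_le (by exact_mod_cast le_top))]
  exact (norm_add_le _ _).trans (add_le_add (hC p hp) (hD p hp))

lemma neg (h : BddSmooth T u) : BddSmooth T (fun p => - u p) :=
  h.clm (-ContinuousLinearMap.id ℝ F)

lemma dt (h : BddSmooth T u) : BddSmooth T (dt u) :=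
  h.fderiv'.clm (ContinuousLinearMap.apply ℝ F ((1, 0) : ST))

lemma dx (h : BddSmooth T u) (i : Fin 3) : BddSmooth T (dx i u) :=
  h.fderiv'.clm (ContinuousLinearMap.apply ℝ F ((0, e i) : ST))

lemma cross {u v : ST → R3} (h : BddSmooth T u) (hv : BddSmooth T v) :
    BddSmooth T (fun p => cross (u p) (v p)) := h.bilin hv crossL

lemma inner {u v : ST → R3} (h : BddSmooth T u) (hv : BddSmooth T v) :
    BddSmooth T (fun p => inner ℝ (u p) (v p)) := h.bilin hv (innerSL ℝ)

end BddSmooth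

section Calculus

variable {u : ST → F} {v : ST → G} {p : ST}

lemma dt_bilin (B : F →L[ℝ] G →L[ℝ] K) (hu : DifferentiableAt ℝ u p)
    (hv : DifferentiableAt ℝ v p) :
    dt (fun q => B (u q) (v q)) p = B (dt u p) (v p) + B (u p) (dt v p) := by
  have := (B.hasFDerivAt_of_bilinear hu.hasFDerivAt hv.hasFDerivAt).fderiv
  simp [dt, this, add_comm]

lemma dx_bilin (i : Fin 3) (B : F →L[ℝ] G →L[ℝ] K) (hu : DifferentiableAt ℝ u p)
    (hv : DifferentiableAt ℝ v p) :
    dx i (fun q => B (u q) (v q)) p = B (dx i u p) (v p) + B (u p) (dx i v p) := by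
  have := (B.hasFDerivAt_of_bilinear hu.hasFDerivAt hv.hasFDerivAt).fderiv
  simp [dx, this, add_comm]

lemma dx_inner (i : Fin 3) {u v : ST → R3} (hu : DifferentiableAt ℝ u p)
    (hv : DifferentiableAt ℝ v p) :
    dx i (fun q => inner ℝ (u q) (v q)) p = inner ℝ (dx i u p) (v p) + inner ℝ (u p) (dx i v p) :=
  dx_bilin i (innerSL ℝ) hu hv

lemma dx_cross (i : Fin 3) {u v : ST → R3} (hu : DifferentiableAt ℝ u p)
    (hv : DifferentiableAt ℝ v p) :
    dx i (fun q => cross (u q) (v q)) p = cross (dx i u p) (v p) + cross (u p) (dx i v p) :=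
  dx_bilin i crossL hu hv

lemma dt_dx_comm (i : Fin 3) (hu : ContDiffAt ℝ ∞ u p) : dt (dx i u) p = dx i (dt u) p := by
  have hd : DifferentiableAt ℝ (fderiv ℝ u) p :=
    (hu.fderiv_right (m := 1)
      (by rw [one_add_one_eq_two]; exact ENat.LEInfty.out)).differentiableAt (by simp)
  have hs := (hu.isSymmSndFDerivAt (by simpa using ENat.LEInfty.out)).eq (1, 0) (0, e i)
  have h1 : ∀ a b : ST, fderiv ℝ (fun q => fderiv ℝ u q a) p b = fderiv ℝ (fderiv ℝ u) p b a := by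
    intro a b
    rw [fderiv_clm_apply hd (by fun_prop)]; simp
  exact (h1 _ _).trans (hs.trans (h1 _ _).symm)

end Calculus


end

/-! ### Test functions on the open half space and extension of weak identities to them. -/

section

variable {F G K : Type} [NormedAddCommGroup F] [NormedSpace ℝ F] [NormedAddCommGroup G]
  [NormedSpace ℝ G] [NormedAddCommGroup K] [NormedSpace ℝ K]

/-- Smooth functions on the open half space, bounded together with their first derivatives, and of
bounded support. -/
structure IsHalfTest (Ψ : ST → F) : Prop where
  smooth : ContDiffOn ℝ ∞ Ψ future
  bounded : ∃ C : ℝ, ∀ p ∈ future, ‖Ψ p‖ ≤ C ∧ ‖fderiv ℝ Ψ p‖ ≤ C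
  support : ∃ R : ℝ, ∀ p ∈ future, R ≤ ‖p‖ → Ψ p = 0

/-- Continuous functions on the open half space, bounded and of bounded support. -/
structure IsHalfCont (Φ : ST → F) : Prop where
  cont : ContinuousOn Φ future
  bounded : ∃ C : ℝ, ∀ p ∈ future, ‖Φ p‖ ≤ C
  support : ∃ R : ℝ, ∀ p ∈ future, R ≤ ‖p‖ → Φ p = 0

/-- Integrable on the bounded parts of the half space. -/
def LocIntegrable (f : ST → F) : Prop :=
  ∀ R : ℝ, IntegrableOn f (future ∩ Metric.ball 0 R) volume

lemma IsHalfCont.clm {Φ : ST → F} (h : IsHalfCont Φ) (L : F →L[ℝ] G) :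
    IsHalfCont (fun p => L (Φ p)) := by
  obtain ⟨C, hC⟩ := h.bounded
  obtain ⟨R, hR⟩ := h.support
  refine ⟨L.continuous.comp_continuousOn h.cont, ⟨‖L‖ * C, fun p hp => ?_⟩, R, fun p hp hn => ?_⟩
  · exact (L.le_opNorm _).trans (by gcongr; exact hC p hp)
  · simp [hR p hp hn]

lemma IsHalfTest.halfCont {Ψ : ST → F} (h : IsHalfTest Ψ) : IsHalfCont Ψ := by
  obtain ⟨C, hC⟩ := h.bounded
  exact ⟨h.smooth.continuousOn, ⟨C, fun p hp => (hC p hp).1⟩, h.support⟩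

lemma IsHalfTest.halfCont_fderiv {Ψ : ST → F} (h : IsHalfTest Ψ) : IsHalfCont (fderiv ℝ Ψ) := by
  obtain ⟨C, hC⟩ := h.bounded
  obtain ⟨R, hR⟩ := h.support
  refine ⟨(h.smooth.fderiv_of_isOpen isOpen_future (m := 0) (by simp)).continuousOn,
    ⟨C, fun p hp => (hC p hp).2⟩, R + 1, fun p hp hn => ?_⟩
  have : Ψ =ᶠ[𝓝 p] fun _ => 0 := by
    filter_upwards [isOpen_future.mem_nhds hp,
      (isOpen_lt continuous_const continuous_norm).mem_nhds (show R < ‖p‖ by linarith)] with q h1 h2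
    exact hR q h1 (le_of_lt h2)
  rw [this.fderiv_eq]; simp

lemma IsHalfTest.halfCont_dt {Ψ : ST → F} (h : IsHalfTest Ψ) : IsHalfCont (dt Ψ) :=
  h.halfCont_fderiv.clm (ContinuousLinearMap.apply ℝ F ((1, 0) : ST))

lemma IsHalfTest.halfCont_dx {Ψ : ST → F} (h : IsHalfTest Ψ) (i : Fin 3) :
    IsHalfCont (dx i Ψ) :=
  h.halfCont_fderiv.clm (ContinuousLinearMap.apply ℝ F ((0, e i) : ST))

/-- The curl as a linear function of the derivative. -/
def curlL : (ST →L[ℝ] R3) →L[ℝ] R3 :=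
  LinearMap.toContinuousLinearMap
    { toFun := fun D => !₂[D (0, e 1) 2 - D (0, e 2) 1, D (0, e 2) 0 - D (0, e 0) 2,
        D (0, e 0) 1 - D (0, e 1) 0]
      map_add' := fun A B => by apply ext3 <;> simp <;> ring
      map_smul' := fun c A => by apply ext3 <;> simp <;> ring }

lemma curl_eq (u : ST → R3) (p : ST) : curl u p = curlL (fderiv ℝ u p) := rfl

lemma IsHalfTest.halfCont_curl {Ψ : ST → R3} (h : IsHalfTest Ψ) : IsHalfCont (curl Ψ) :=
  h.halfCont_fderiv.clm curlL

/-- Translation in time by `ε`, with a cutoff in `t < 0`. -/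
def shift (ε : ℝ) (Ψ : ST → F) (p : ST) : F :=
  Real.smoothTransition (4 / ε * p.1 + 2) • Ψ (p + (ε, 0))

lemma shift_eq {ε : ℝ} (hε : 0 < ε) (Ψ : ST → F) {p : ST} (hp : 0 ≤ p.1) :
    shift ε Ψ p = Ψ (p + (ε, 0)) := by
  rw [shift, Real.smoothTransition.one_of_one_le, one_smul]
  have : 0 ≤ 4 / ε * p.1 := by positivity
  linarith

lemma fderiv_shift {ε : ℝ} (hε : 0 < ε) (Ψ : ST → F) {p : ST} (hp : p ∈ future) :
    fderiv ℝ (shift ε Ψ) p = fderiv ℝ Ψ (p + (ε, 0)) := by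
  have : shift ε Ψ =ᶠ[𝓝 p] fun q => Ψ (q + (ε, 0)) := by
    filter_upwards [isOpen_future.mem_nhds hp] with q hq
    exact shift_eq hε Ψ (mem_future.1 hq).le
  rw [this.fderiv_eq, fderiv_comp_add_right]

/-- Forward translates of a function supported in a ball thus all vanish outside that same ball,
which gives one dominating function for all of them. -/
lemma norm_le_norm_shift {ε : ℝ} (hε : 0 < ε) {p : ST} (hp : 0 ≤ p.1) : ‖p‖ ≤ ‖p + (ε, 0)‖ := by
  simp only [Prod.norm_def, Prod.fst_add, Prod.snd_add, add_zero, Real.norm_eq_abs]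
  gcongr
  linarith

/-- The translate is smooth for `t > -ε`, and the cutoff is `1` for `t ≥ -ε/4` and `0` for `t ≤
-ε/2`. The product is therefore smooth on the whole space without extending `Ψ` across `t = 0`. -/
lemma isTest_shift {ε : ℝ} (hε : 0 < ε) {Ψ : ST → F} (h : IsHalfTest Ψ) :
    IsTest (shift ε Ψ) := by
  constructor
  · rw [contDiff_iff_contDiffAt]
    intro p
    by_cases hp : -ε < p.1
    · have hp' : p + (ε, 0) ∈ future := mem_future.2 (by simp; linarith)
      refine ContDiffAt.smul (f := fun q : ST => Real.smoothTransition (4 / ε * q.1 + 2))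
        (g := fun q : ST => Ψ (q + (ε, 0))) ?_ ?_
      · exact (Real.smoothTransition.contDiff.comp (by fun_prop : ContDiff ℝ ∞
          (fun q : ST => 4 / ε * q.1 + 2))).contDiffAt
      · exact ((h.smooth _ hp').contDiffAt (isOpen_future.mem_nhds hp')).comp p (by fun_prop)
    · have : shift ε Ψ =ᶠ[𝓝 p] fun _ => 0 := by
        filter_upwards [(isOpen_lt continuous_fst continuous_const).mem_nhds
          (show p.1 < -ε / 2 by linarith)] with q hq
        rw [shift, Real.smoothTransition.zero_of_nonpos, zero_smul]
        have hq : q.1 < -ε / 2 := hq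
        have := mul_le_mul_of_nonneg_left hq.le (show 0 ≤ 4 / ε by positivity)
        have h2 : 4 / ε * (-ε / 2) = -2 := by field_simp; norm_num
        linarith
      exact contDiffAt_const.congr_of_eventuallyEq this
  · obtain ⟨R, hR⟩ := h.support
    refine HasCompactSupport.of_support_subset_isCompact
      (isCompact_closedBall (0 : ST) (|R| + ε)) fun p hp => ?_
    rw [mem_closedBall_zero_iff]
    by_contra! hn
    apply hp
    by_cases hp0 : -ε < p.1
    · have hp' : p + (ε, 0) ∈ future := mem_future.2 (by simp; linarith)
      rw [shift, hR _ hp', smul_zero]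
      have h1 : ‖p‖ ≤ ‖p + (ε, 0)‖ + ‖((ε, 0) : ST)‖ := by
        have := norm_sub_le (p + (ε, 0)) ((ε, 0) : ST)
        rwa [add_sub_cancel_right] at this
      have h2 : ‖((ε, 0) : ST)‖ = ε := by simp [Prod.norm_def, abs_of_pos hε, hε.le]
      linarith [le_abs_self R]
    · rw [shift, Real.smoothTransition.zero_of_nonpos, zero_smul]
      have := mul_le_mul_of_nonneg_left (not_lt.1 hp0) (show 0 ≤ 4 / ε by positivity)
      have h2 : 4 / ε * (-ε) = -4 := by field_simp
      linarith

/-- The translation acts on the continuous factor, so dominated convergence applies even though `f`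
is merely locally integrable. -/
lemma IsHalfCont.tendsto_integral_shift {Φ : ST → R3} (h : IsHalfCont Φ) {f : ST → R3}
    (hf : LocIntegrable f) {ε : ℕ → ℝ} (hε : ∀ n, 0 < ε n) (hε0 : Tendsto ε atTop (𝓝 0)) :
    Tendsto (fun n => ∫ p in future, inner ℝ (f p) (Φ (p + (ε n, 0)))) atTop
      (𝓝 (∫ p in future, inner ℝ (f p) (Φ p))) := by
  obtain ⟨C, hC⟩ := h.bounded
  obtain ⟨R, hR⟩ := h.support
  have hmem : ∀ n, ∀ p ∈ future, p + (ε n, 0) ∈ future := fun n p hp =>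
    mem_future.2 (by simpa using add_pos (mem_future.1 hp) (hε n))
  have hred : ∀ Φ' : ST → R3, (∀ p ∈ future, R ≤ ‖p‖ → Φ' p = 0) →
      ∫ p in future, inner ℝ (f p) (Φ' p)
        = ∫ p in future ∩ Metric.ball 0 R, inner ℝ (f p) (Φ' p) := by
    intro Φ' h0
    apply setIntegral_eq_of_subset_of_forall_sdiff_eq_zero isOpen_future.measurableSet
      inter_subset_left
    intro p hp
    rw [h0 p hp.1, inner_zero_right]
    by_contra! hlt
    exact hp.2 ⟨hp.1, by simpa using hlt⟩
  have hs : MeasurableSet (future ∩ Metric.ball (0 : ST) R) :=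
    isOpen_future.measurableSet.inter measurableSet_ball
  rw [hred Φ hR]
  simp_rw [fun n => hred (fun p => Φ (p + (ε n, 0))) (fun p hp hn =>
    hR _ (hmem n p hp) (hn.trans (norm_le_norm_shift (hε n) (mem_future.1 hp).le)))]
  refine tendsto_integral_of_dominated_convergence (fun p => ‖f p‖ * C) (fun n => ?_)
    ((hf R).norm.mul_const C) (fun n => ?_) ?_
  · refine (hf R).aestronglyMeasurable.inner ?_
    refine ContinuousOn.aestronglyMeasurable ?_ hs
    exact h.cont.comp (by fun_prop) (fun p hp => hmem n p hp.1)
  · filter_upwards [ae_restrict_mem hs] with p hp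
    exact (norm_inner_le_norm _ _).trans (by gcongr; exact hC _ (hmem n p hp.1))
  · filter_upwards [ae_restrict_mem hs] with p hp
    refine Tendsto.inner tendsto_const_nhds ?_
    have h1 : Tendsto (fun n => p + (ε n, (0 : R3))) atTop (𝓝 (p + (0, 0))) :=
      tendsto_const_nhds.add (hε0.prodMk_nhds tendsto_const_nhds)
    rw [show p + ((0 : ℝ), (0 : R3)) = p by ext <;> simp] at h1
    exact ((h.cont.continuousAt (isOpen_future.mem_nhds hp.1)).tendsto).comp h1

lemma IsHalfCont.tendsto_integral_initial {Φ : ST → R3} (h : IsHalfCont Φ) {f Φ₀ : R3 → R3}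
    (hf : Continuous f) (h0 : ∀ x, Tendsto (fun t : ℝ => Φ (t, x)) (𝓝[>] 0) (𝓝 (Φ₀ x))) :
    Tendsto (fun t : ℝ => ∫ x, inner ℝ (f x) (Φ (t, x))) (𝓝[>] 0)
      (𝓝 (∫ x, inner ℝ (f x) (Φ₀ x))) := by
  obtain ⟨C, hC⟩ := h.bounded
  obtain ⟨R, hR⟩ := h.support
  have hi : Integrable ((Metric.ball (0 : R3) R).indicator fun x => ‖f x‖ * C) := by
    rw [integrable_indicator_iff measurableSet_ball]
    exact ((hf.norm.mul continuous_const).continuousOn.integrableOn_compact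
      (isCompact_closedBall (0 : R3) R)).mono_set Metric.ball_subset_closedBall
  refine tendsto_integral_filter_of_dominated_convergence _ ?_ ?_ hi ?_
  · filter_upwards [self_mem_nhdsWithin] with t (ht : 0 < t)
    refine (hf.inner ?_).aestronglyMeasurable
    rw [continuous_iff_continuousAt]
    intro x
    exact (h.cont.continuousAt (isOpen_future.mem_nhds (mem_future.2 ht))).comp
      (by fun_prop : ContinuousAt (fun x : R3 => (t, x)) x)
  · filter_upwards [self_mem_nhdsWithin] with t (ht : 0 < t)
    refine ae_of_all _ fun x => ?_
    by_cases hx : x ∈ Metric.ball (0 : R3) R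
    · rw [indicator_of_mem hx]
      exact (norm_inner_le_norm _ _).trans (by gcongr; exact hC _ (mem_future.2 ht))
    · rw [hR _ (mem_future.2 ht), inner_zero_right, norm_zero]
      · exact indicator_nonneg (fun y _ => mul_nonneg (norm_nonneg _)
          ((norm_nonneg _).trans (hC (t, x) (mem_future.2 ht)))) _
      · exact (not_lt.1 (by simpa using hx)).trans (norm_snd_le ((t, x) : ST))
  · exact ae_of_all _ fun x => Tendsto.inner tendsto_const_nhds (h0 x)


end

lemma volume_restrict_slab (S : ℝ) : (volume : Measure ST).restrict (slab S)
    = ((volume : Measure ℝ).restrict (Ioo 0 S)).prod (volume : Measure R3) := by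
  rw [slab, Measure.volume_eq_prod, ← Measure.prod_restrict, Measure.restrict_univ]

lemma future_inter_ball_subset (R : ℝ) : future ∩ Metric.ball (0 : ST) R ⊆ slab R := by
  rintro p ⟨hp, hb⟩
  refine mem_slab.2 ⟨mem_future.1 hp, (le_abs_self _).trans_lt ?_⟩
  exact (norm_fst_le p).trans_lt (by simpa using hb)

lemma locIntegrable_of_memLp {f : ST → R3}
    (hf : ∀ S : ℝ, 0 < S → MemLp f 2 (volume.restrict (slab S))) : LocIntegrable f := by
  intro R
  rcases le_or_gt R 0 with hR | hR
  · simp [Metric.ball_eq_empty.2 hR]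
  have : IsFiniteMeasure (volume.restrict (future ∩ Metric.ball (0 : ST) R)) :=
    ⟨by rw [Measure.restrict_apply_univ]
        exact (measure_mono inter_subset_right).trans_lt measure_ball_lt_top⟩
  exact ((hf R hR).mono_measure (Measure.restrict_mono (future_inter_ball_subset R) le_rfl)).integrable
    (by norm_num)

lemma lintegral_slab (S : ℝ) {f : ST → ℝ≥0∞} (hf : AEMeasurable f (volume.restrict (slab S))) :
    ∫⁻ p in slab S, f p = ∫⁻ t in Ioo 0 S, ∫⁻ x : R3, f (t, x) := by
  rw [volume_restrict_slab] at hf ⊢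
  exact lintegral_prod _ hf

lemma LocLinftyL2.memLp {u : ST → R3} (h : LocLinftyL2 u) (S : ℝ) :
    MemLp u 2 (volume.restrict (slab S)) := by
  rcases le_or_gt S 0 with hS | hS
  · simp [slab, Ioo_eq_empty (not_lt.2 hS)]
  have hm : AEStronglyMeasurable u (volume.restrict (slab S)) :=
    h.1.mono_measure (Measure.restrict_mono (slab_subset_future S) le_rfl)
  refine ⟨hm, ?_⟩
  rw [eLpNorm_lt_top_iff_lintegral_rpow_enorm_lt_top (by norm_num) (by norm_num)]
  simp only [ENNReal.toReal_ofNat, ENNReal.rpow_ofNat]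
  rw [lintegral_slab S (hm.enorm.pow_const 2)]
  obtain ⟨C, hC⟩ := h.2 S hS
  calc ∫⁻ t in Ioo 0 S, ∫⁻ x : R3, ‖u (t, x)‖ₑ ^ 2 ≤ ∫⁻ t in Ioo 0 S, (C : ℝ≥0∞) :=
        lintegral_mono_ae hC
    _ < ⊤ := by
        rw [setLIntegral_const, Real.volume_Ioo]
        exact ENNReal.mul_lt_top ENNReal.coe_lt_top ENNReal.ofReal_lt_top

lemma IsHalfCont.integrable_inner {Φ : ST → R3} (h : IsHalfCont Φ) {f : ST → R3}
    (hf : LocIntegrable f) : IntegrableOn (fun p => inner ℝ (f p) (Φ p)) future := by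
  obtain ⟨C, hC⟩ := h.bounded
  obtain ⟨R, hR⟩ := h.support
  have hs : MeasurableSet (future ∩ Metric.ball (0 : ST) R) :=
    isOpen_future.measurableSet.inter measurableSet_ball
  have h1 : IntegrableOn (fun p => inner ℝ (f p) (Φ p)) (future ∩ Metric.ball 0 R) := by
    refine ((hf R).norm.mul_const C).mono' ((hf R).aestronglyMeasurable.inner
      ((h.cont.mono inter_subset_left).aestronglyMeasurable hs)) ?_
    filter_upwards [ae_restrict_mem hs] with p hp
    exact (norm_inner_le_norm _ _).trans (by gcongr; exact hC _ hp.1)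
  refine h1.of_forall_sdiff_eq_zero isOpen_future.measurableSet fun p hp => ?_
  rw [hR p hp.1, inner_zero_right]
  by_contra! hlt
  exact hp.2 ⟨hp.1, by simpa using hlt⟩

lemma IsTest.halfTest {F : Type} [NormedAddCommGroup F] [NormedSpace ℝ F] {Ψ : ST → F}
    (h : IsTest Ψ) : IsHalfTest Ψ := by
  obtain ⟨C, hC⟩ := h.2.exists_bound_of_continuous h.1.continuous
  obtain ⟨D, hD⟩ := (h.2.fderiv ℝ).exists_bound_of_continuous (h.1.continuous_fderiv (by simp))
  obtain ⟨R, hR⟩ := h.2.isCompact.isBounded.subset_ball (0 : ST)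
  refine ⟨h.1.contDiffOn, ⟨max C D, fun p _ =>
    ⟨(hC p).trans (le_max_left _ _), (hD p).trans (le_max_right _ _)⟩⟩, R, fun p _ hn => ?_⟩
  by_contra h0
  have := hR (subset_tsupport _ h0)
  rw [mem_ball_zero_iff] at this
  linarith

lemma IsTest.dt {F : Type} [NormedAddCommGroup F] [NormedSpace ℝ F] {Ψ : ST → F}
    (h : IsTest Ψ) : IsTest (dt Ψ) :=
  ⟨(h.1.fderiv_right (m := ∞) (by simp)).clm_apply contDiff_const,
    (h.2.fderiv ℝ).comp_left (g := fun L : ST →L[ℝ] F => L (1, 0)) (by simp)⟩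

lemma IsTest.dx {F : Type} [NormedAddCommGroup F] [NormedSpace ℝ F] {Ψ : ST → F}
    (h : IsTest Ψ) (i : Fin 3) : IsTest (dx i Ψ) :=
  ⟨(h.1.fderiv_right (m := ∞) (by simp)).clm_apply contDiff_const,
    (h.2.fderiv ℝ).comp_left (g := fun L : ST →L[ℝ] F => L (0, e i)) (by simp)⟩

/-- An identity between integrals that holds for test functions extends to half tests. -/
lemma IsHalfTest.identity {Ψ : ST → R3} (h : IsHalfTest Ψ)
    {a b c : ST → R3} {g : Fin 3 → ST → R3} {u₀ : R3 → R3} {A : ℝ}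
    (h0 : Tendsto (fun t : ℝ => ∫ x, inner ℝ (u₀ x) (Ψ (t, x))) (𝓝[>] 0) (𝓝 A))
    (ha : LocIntegrable a) (hb : LocIntegrable b) (hc : LocIntegrable c)
    (hg : ∀ i, LocIntegrable (g i))
    (H : ∀ Φ : ST → R3, IsTest Φ →
      (∫ p in future, inner ℝ (a p) (dt Φ p)) + (∫ p in future, inner ℝ (b p) (curl Φ p))
        + (∫ p in future, inner ℝ (c p) (Φ p)) + ∑ i, ∫ p in future, inner ℝ (g i p) (dx i Φ p)
        = ∫ x, inner ℝ (u₀ x) (Φ (0, x))) :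
    ∫ p in future, (inner ℝ (a p) (dt Ψ p) + inner ℝ (b p) (curl Ψ p) + inner ℝ (c p) (Ψ p)
      + ∑ i, inner ℝ (g i p) (dx i Ψ p)) = A := by
  let ε : ℕ → ℝ := fun n => 1 / ((n : ℝ) + 1)
  have hε : ∀ n, 0 < ε n := fun n => by positivity
  have hε0 : Tendsto ε atTop (𝓝 0) := tendsto_one_div_add_atTop_nhds_zero_nat
  -- The identity for the translated and cut off function; on the half space the cutoff is `1`, so
  -- only the translation is visible, and the initial slice is the slice of `Ψ` at time `ε n`.
  have H1 : ∀ n, (∫ p in future, inner ℝ (a p) (dt Ψ (p + (ε n, 0))))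
      + (∫ p in future, inner ℝ (b p) (curl Ψ (p + (ε n, 0))))
      + (∫ p in future, inner ℝ (c p) (Ψ (p + (ε n, 0))))
      + ∑ i, ∫ p in future, inner ℝ (g i p) (dx i Ψ (p + (ε n, 0)))
      = ∫ x, inner ℝ (u₀ x) (Ψ (ε n, x)) := by
    intro n
    have hf : ∀ p ∈ future, fderiv ℝ (shift (ε n) Ψ) p = fderiv ℝ Ψ (p + (ε n, 0)) :=
      fun p hp => fderiv_shift (hε n) Ψ hp
    have hm := isOpen_future.measurableSet
    rw [← setIntegral_congr_fun hm (g := fun p => inner ℝ (a p) (dt Ψ (p + (ε n, 0))))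
        (f := fun p => inner ℝ (a p) (dt (shift (ε n) Ψ) p))
        (fun p hp => by simp only [dt, hf p hp]),
      ← setIntegral_congr_fun hm (g := fun p => inner ℝ (b p) (curl Ψ (p + (ε n, 0))))
        (f := fun p => inner ℝ (b p) (curl (shift (ε n) Ψ) p))
        (fun p hp => by simp only [curl_eq, hf p hp]),
      ← setIntegral_congr_fun hm (g := fun p => inner ℝ (c p) (Ψ (p + (ε n, 0))))
        (f := fun p => inner ℝ (c p) (shift (ε n) Ψ p))
        (fun p hp => by simp only [shift_eq (hε n) Ψ (mem_future.1 hp).le]),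
      ← Finset.sum_congr rfl (fun i _ => setIntegral_congr_fun hm
        (g := fun p => inner ℝ (g i p) (dx i Ψ (p + (ε n, 0))))
        (f := fun p => inner ℝ (g i p) (dx i (shift (ε n) Ψ) p))
        (fun p hp => by simp only [dx, hf p hp])),
      H _ (isTest_shift (hε n) h)]
    congr 1
    ext x
    rw [shift_eq (hε n) Ψ (by simp)]
    simp
  have hlim := (((h.halfCont_dt.tendsto_integral_shift ha hε hε0).add
    (h.halfCont_curl.tendsto_integral_shift hb hε hε0)).add
    (h.halfCont.tendsto_integral_shift hc hε hε0)).add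
    (tendsto_finsetSum Finset.univ fun i _ =>
      (h.halfCont_dx i).tendsto_integral_shift (hg i) hε hε0)
  simp_rw [H1] at hlim
  have hlim' := h0.comp (tendsto_nhdsWithin_iff.2 ⟨hε0, Eventually.of_forall hε⟩)
  rw [integral_add, integral_add, integral_add, integral_finsetSum]
  · exact tendsto_nhds_unique hlim hlim'
  · exact fun i _ => (h.halfCont_dx i).integrable_inner (hg i)
  · exact h.halfCont_dt.integrable_inner ha
  · exact h.halfCont_curl.integrable_inner hb
  · exact (h.halfCont_dt.integrable_inner ha).add (h.halfCont_curl.integrable_inner hb)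
  · exact h.halfCont.integrable_inner hc
  · exact ((h.halfCont_dt.integrable_inner ha).add (h.halfCont_curl.integrable_inner hb)).add
      (h.halfCont.integrable_inner hc)
  · exact integrable_finsetSum _ fun i _ => (h.halfCont_dx i).integrable_inner (hg i)

/-! ### Weights in time. -/

/-- Decreasing weights in time that vanish after time `S` and decay at rate `lam` at least. -/
structure IsTimeWeight (S lam : ℝ) (ζ : ℝ → ℝ) : Prop where
  smooth : ContDiff ℝ ∞ ζ
  zero : ∀ t, S ≤ t → ζ t = 0
  pos : ∀ t, t < S → 0 < ζ t
  decay : ∀ t, 0 < t → t < S → lam * ζ t ≤ - deriv ζ t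

/-- The weight is `exp (-lam S² / (S - t))` for `t < S`, extended by zero. Its logarithmic
derivative is `-lam S² / (S - t)²`, which is at most `-lam` because `S - t ≤ S` for `t ≥ 0`. -/
lemma exists_isTimeWeight {S lam : ℝ} (hS : 0 < S) (hl : 0 < lam) :
    ∃ ζ : ℝ → ℝ, IsTimeWeight S lam ζ := by
  refine ⟨fun t => expNegInvGlue ((S - t) / (lam * S ^ 2)), ?_, ?_, ?_, ?_⟩
  · exact expNegInvGlue.contDiff.comp (by fun_prop)
  · intro t ht
    apply expNegInvGlue.zero_of_nonpos
    exact div_nonpos_of_nonpos_of_nonneg (by linarith) (by positivity)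
  · intro t ht
    apply expNegInvGlue.pos_of_pos
    have : 0 < S - t := by linarith
    positivity
  · intro t ht0 ht
    have hst : 0 < S - t := by linarith
    have heq : ∀ s, s < S → expNegInvGlue ((S - s) / (lam * S ^ 2))
        = Real.exp (-(lam * S ^ 2 / (S - s))) := by
      intro s hs
      have h1 : 0 < S - s := by linarith
      have h2 : ¬ (S - s) / (lam * S ^ 2) ≤ 0 := by push Not; positivity
      rw [expNegInvGlue, if_neg h2, inv_div]
    have hev : (fun s => expNegInvGlue ((S - s) / (lam * S ^ 2))) =ᶠ[𝓝 t]
        fun s => Real.exp (-(lam * S ^ 2 / (S - s))) := by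
      filter_upwards [Iio_mem_nhds ht] with s hs using heq s hs
    have hd : HasDerivAt (fun s => Real.exp (-(lam * S ^ 2 / (S - s))))
        (Real.exp (-(lam * S ^ 2 / (S - t))) * -(lam * S ^ 2 / (S - t) ^ 2)) t := by
      have h1 : HasDerivAt (fun s : ℝ => S - s) (-1) t := by
        simpa using (hasDerivAt_id t).const_sub S
      have h2 := ((h1.fun_inv hst.ne').const_mul (lam * S ^ 2)).fun_neg.exp
      simpa only [neg_neg, mul_one_div, ← div_eq_mul_inv] using h2
    rw [hev.deriv_eq, hd.deriv]
    simp only [heq t ht, mul_neg, neg_neg]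
    rw [mul_comm]
    gcongr
    rw [le_div_iff₀ (by positivity)]
    gcongr
    linarith

namespace IsTimeWeight

variable {S lam : ℝ} {ζ : ℝ → ℝ}

lemma nonneg (h : IsTimeWeight S lam ζ) (t : ℝ) : 0 ≤ ζ t := by
  rcases lt_or_ge t S with ht | ht
  · exact (h.pos t ht).le
  · exact (h.zero t ht).ge

lemma hasDerivAt (h : IsTimeWeight S lam ζ) (t : ℝ) : HasDerivAt ζ (deriv ζ t) t :=
  (h.smooth.differentiable (by simp) t).hasDerivAt

lemma continuous_deriv (h : IsTimeWeight S lam ζ) : Continuous (deriv ζ) :=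
  h.smooth.continuous_deriv (by simp)

lemma neg_deriv_nonneg (h : IsTimeWeight S lam ζ) (hl : 0 ≤ lam) {t : ℝ} (h0 : 0 < t)
    (ht : t < S) : 0 ≤ - deriv ζ t :=
  (mul_nonneg hl (h.nonneg t)).trans (h.decay t h0 ht)

lemma exists_bound (h : IsTimeWeight S lam ζ) :
    ∃ C : ℝ, 0 ≤ C ∧ ∀ t, 0 ≤ t → t ≤ S → |ζ t| ≤ C ∧ |deriv ζ t| ≤ C := by
  obtain ⟨C, hC⟩ := (isCompact_Icc (a := 0) (b := S)).exists_bound_of_continuousOn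
    h.smooth.continuous.continuousOn
  obtain ⟨D, hD⟩ := (isCompact_Icc (a := 0) (b := S)).exists_bound_of_continuousOn
    h.continuous_deriv.continuousOn
  exact ⟨max 0 (max C D), le_max_left _ _, fun t h0 ht =>
    ⟨(hC t ⟨h0, ht⟩).trans (by simp), (hD t ⟨h0, ht⟩).trans (by simp)⟩⟩

lemma integral_neg_deriv (h : IsTimeWeight S lam ζ) (s : ℝ) :
    ∫ t in s..S, - deriv ζ t = ζ s := by
  rw [intervalIntegral.integral_neg, intervalIntegral.integral_eq_sub_of_hasDerivAt
    (fun t _ => h.hasDerivAt t) (h.continuous_deriv.intervalIntegrable _ _), h.zero S le_rfl]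
  ring

end IsTimeWeight

/-! ### Fields localized in time and space as test functions. -/

/-- Partial derivatives of a scalar function on `ℝ³`. -/
def sd (i : Fin 3) (θ : R3 → ℝ) (x : R3) : ℝ := fderiv ℝ θ x (e i)

/-- The gradient of a scalar function on `ℝ³`. -/
def grad (θ : R3 → ℝ) (x : R3) : R3 := !₂[sd 0 θ x, sd 1 θ x, sd 2 θ x]

section Product

variable {F : Type} [NormedAddCommGroup F] [NormedSpace ℝ F]
variable {S T lam : ℝ} {ζ : ℝ → ℝ} {θ : R3 → ℝ} {V : ST → F}

/-- The product of a function with a weight in time and a weight in space. -/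
def loc (ζ : ℝ → ℝ) (θ : R3 → ℝ) (V : ST → F) (p : ST) : F := (ζ p.1 * θ p.2) • V p

lemma bddSmooth_weight (hζ : ContDiff ℝ ∞ ζ) (hθ : ContDiff ℝ ∞ θ) (hc : HasCompactSupport θ)
    (T : ℝ) : BddSmooth T (fun p : ST => ζ p.1 * θ p.2) := by
  have hs : ContDiff ℝ ∞ (fun p : ST => ζ p.1 * θ p.2) :=
    (hζ.comp contDiff_fst).mul (hθ.comp contDiff_snd)
  refine ⟨hs.contDiffOn, fun T' _ n => ?_⟩
  obtain ⟨C, hC⟩ := (isCompact_Icc (a := 0) (b := T')).prod hc.isCompact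
    |>.exists_bound_of_continuousOn
      (hs.continuous_iteratedFDeriv (m := n) (by exact_mod_cast le_top)).continuousOn
  refine ⟨max C 0, fun p hp => ?_⟩
  by_cases hx : p.2 ∈ tsupport θ
  · exact (hC p ⟨⟨(mem_slab.1 hp).1.le, (mem_slab.1 hp).2.le⟩, hx⟩).trans (le_max_left _ _)
  · have : (fun q : ST => ζ q.1 * θ q.2) =ᶠ[𝓝 p] fun _ => 0 := by
      have h1 := notMem_tsupport_iff_eventuallyEq.1 hx
      filter_upwards [continuous_snd.continuousAt.eventually h1] with q hq
      simp [hq]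
    rw [this.iteratedFDeriv ℝ n |>.eq_of_nhds]
    rcases n with _ | n <;> simp

lemma BddSmooth.loc (hV : BddSmooth T V) (hζ : ContDiff ℝ ∞ ζ) (hθ : ContDiff ℝ ∞ θ)
    (hc : HasCompactSupport θ) : BddSmooth T (loc ζ θ V) :=
  (bddSmooth_weight hζ hθ hc T).bilin hV (ContinuousLinearMap.lsmul ℝ ℝ)

/-- Nothing is known of `V` from time `T` on, but `ζ` vanishes from `S < T` on, so the product is
smooth on the whole half space. -/
lemma isHalfTest_loc (hST : S < T) (hV : BddSmooth T V) (hζ : IsTimeWeight S lam ζ)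
    (hθ : ContDiff ℝ ∞ θ) (hc : HasCompactSupport θ) : IsHalfTest (loc ζ θ V) := by
  have hb := hV.loc hζ.smooth hθ hc
  have hz : ∀ p : ST, S ≤ p.1 → MLL.loc ζ θ V p = 0 := fun p hp => by
    simp [MLL.loc, hζ.zero _ hp]
  have hz' : ∀ p : ST, S < p.1 → MLL.loc ζ θ V =ᶠ[𝓝 p] fun _ => 0 := fun p hp => by
    filter_upwards [(isOpen_lt continuous_const continuous_fst).mem_nhds hp] with q hq
    exact hz q (le_of_lt hq)
  -- An intermediate time is needed since the product is known to vanish near a point only for times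
  -- strictly beyond `S`, whereas the bounds hold on slabs strictly shorter than `T`.
  obtain ⟨T', hT', hT''⟩ := exists_between hST
  refine ⟨fun p hp => ?_, ?_, ?_⟩
  · rcases lt_or_ge p.1 T with h | h
    · exact (hb.contDiffAt (mem_slab.2 ⟨mem_future.1 hp, h⟩)).contDiffWithinAt
    · exact (contDiffAt_const.congr_of_eventuallyEq (hz' p (hST.trans_le h))).contDiffWithinAt
  · obtain ⟨C, hC0, hC⟩ := hb.exists_bound hT''
    obtain ⟨D, hD0, hD⟩ := hb.exists_bound_fderiv hT''
    refine ⟨max C D, fun p hp => ?_⟩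
    rcases lt_or_ge p.1 T' with h | h
    · have hp' := mem_slab.2 ⟨mem_future.1 hp, h⟩
      exact ⟨(hC p hp').trans (le_max_left _ _), (hD p hp').trans (le_max_right _ _)⟩
    · rw [hz p (hT'.le.trans h), (hz' p (hT'.trans_le h)).fderiv_eq]
      simp [hC0]
  · obtain ⟨R, hR⟩ := hc.isCompact.isBounded.subset_ball (0 : R3)
    refine ⟨max R S, fun p hp hn => ?_⟩
    rcases lt_or_ge p.1 S with h | h
    · have : θ p.2 = 0 := by
        by_contra h0
        have h1 := hR (subset_tsupport _ h0)
        rw [mem_ball_zero_iff] at h1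
        have h2 : ‖p‖ < max R S := by
          rw [Prod.norm_def, Real.norm_eq_abs, abs_of_pos (mem_future.1 hp)]
          exact max_lt (h.trans_le (le_max_right _ _)) (h1.trans_le (le_max_left _ _))
        linarith
      simp [MLL.loc, this]
    · exact hz p h

lemma hasFDerivAt_weight (hζ : ContDiff ℝ ∞ ζ) (hθ : ContDiff ℝ ∞ θ) (p : ST) :
    HasFDerivAt (fun p : ST => ζ p.1 * θ p.2)
      (ζ p.1 • (fderiv ℝ θ p.2).comp (ContinuousLinearMap.snd ℝ ℝ R3)
        + θ p.2 • (deriv ζ p.1 • ContinuousLinearMap.fst ℝ ℝ R3)) p := by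
  have h1 : HasFDerivAt (fun p : ST => ζ p.1) (deriv ζ p.1 • ContinuousLinearMap.fst ℝ ℝ R3) p :=
    (hζ.differentiable (by simp) p.1).hasDerivAt.comp_hasFDerivAt p hasFDerivAt_fst
  have h2 : HasFDerivAt (fun p : ST => θ p.2)
      ((fderiv ℝ θ p.2).comp (ContinuousLinearMap.snd ℝ ℝ R3)) p :=
    (hθ.differentiable (by simp) p.2).hasFDerivAt.comp p hasFDerivAt_snd
  exact h1.mul h2

lemma dt_loc (hζ : ContDiff ℝ ∞ ζ) (hθ : ContDiff ℝ ∞ θ) {p : ST} (hV : DifferentiableAt ℝ V p) :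
    dt (loc ζ θ V) p = (deriv ζ p.1 * θ p.2) • V p + (ζ p.1 * θ p.2) • dt V p := by
  have h := hasFDerivAt_weight hζ hθ p
  have h2 := dt_bilin (ContinuousLinearMap.lsmul ℝ ℝ) h.differentiableAt hV
  refine h2.trans ?_
  simp [dt, h.fderiv, mul_comm]

lemma dx_loc (hζ : ContDiff ℝ ∞ ζ) (hθ : ContDiff ℝ ∞ θ) {p : ST} (hV : DifferentiableAt ℝ V p)
    (i : Fin 3) :
    dx i (loc ζ θ V) p = (ζ p.1 * sd i θ p.2) • V p + (ζ p.1 * θ p.2) • dx i V p := by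
  have h := hasFDerivAt_weight hζ hθ p
  have h2 := dx_bilin i (ContinuousLinearMap.lsmul ℝ ℝ) h.differentiableAt hV
  refine h2.trans ?_
  simp [dx, h.fderiv, sd]

lemma curl_loc {V : ST → R3} (hζ : ContDiff ℝ ∞ ζ) (hθ : ContDiff ℝ ∞ θ) {p : ST}
    (hV : DifferentiableAt ℝ V p) :
    curl (loc ζ θ V) p = (ζ p.1 * θ p.2) • curl V p + ζ p.1 • cross (grad θ p.2) (V p) := by
  simp only [curl, dx_loc hζ hθ hV]
  apply ext3 <;> simp [grad] <;> ring

lemma setIntegral_future_eq_slab {f : ST → ℝ} (hf : ∀ p : ST, S < p.1 → f p = 0) :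
    ∫ p in future, f p = ∫ p in slab S, f p := by
  have h0 : (volume : Measure ST) {p : ST | p.1 = S} = 0 := by
    have : {p : ST | p.1 = S} = {S} ×ˢ univ := by ext p; simp
    rw [this, Measure.volume_eq_prod, Measure.prod_prod]; simp
  refine setIntegral_eq_of_subset_of_ae_sdiff_eq_zero
    isOpen_future.measurableSet.nullMeasurableSet (slab_subset_future S) ?_
  have : ∀ᵐ p ∂(volume : Measure ST), p.1 ≠ S := by
    rw [ae_iff]; simpa using h0
  filter_upwards [this] with p hp hm
  apply hf
  by_contra! hle
  exact hm.2 (mem_slab.2 ⟨mem_future.1 hm.1, lt_of_le_of_ne hle hp⟩)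

lemma fderiv_loc_eq_zero (hζ : IsTimeWeight S lam ζ) {p : ST} (hp : S < p.1) :
    fderiv ℝ (loc ζ θ V) p = 0 := by
  have : loc ζ θ V =ᶠ[𝓝 p] fun _ => 0 := by
    filter_upwards [(isOpen_lt continuous_const continuous_fst).mem_nhds hp] with q hq
    simp [loc, hζ.zero _ (le_of_lt hq)]
  rw [this.fderiv_eq]; simp

end Product

section LocIdentity

variable {S T lam : ℝ} {ζ : ℝ → ℝ} {θ : R3 → ℝ} {V : ST → R3}

/-- The pairing of the first order expression with coefficients `a`, `b`, `c`, `g` with `Ψ`. -/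
def pairing (a b c : ST → R3) (g : Fin 3 → ST → R3) (Ψ : ST → R3) (p : ST) : ℝ :=
  inner ℝ (a p) (dt Ψ p) + inner ℝ (b p) (curl Ψ p) + inner ℝ (c p) (Ψ p)
    + ∑ i, inner ℝ (g i p) (dx i Ψ p)

lemma IsHalfTest.integrable_pairing {Ψ : ST → R3} (h : IsHalfTest Ψ) {a b c : ST → R3}
    {g : Fin 3 → ST → R3} (ha : LocIntegrable a) (hb : LocIntegrable b) (hc : LocIntegrable c)
    (hg : ∀ i, LocIntegrable (g i)) : IntegrableOn (pairing a b c g Ψ) future :=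
  (((h.halfCont_dt.integrable_inner ha).add (h.halfCont_curl.integrable_inner hb)).add
      (h.halfCont.integrable_inner hc)).add
    (integrable_finsetSum _ fun i _ => (h.halfCont_dx i).integrable_inner (hg i))

lemma loc_identity (hST : S < T) (hV : BddSmooth T V) (hζ : IsTimeWeight S lam ζ)
    (hθ : ContDiff ℝ ∞ θ) (hcs : HasCompactSupport θ)
    {a b c : ST → R3} {g : Fin 3 → ST → R3} {u₀ : R3 → R3} {A : ℝ}
    (h0 : Tendsto (fun t : ℝ => ∫ x, inner ℝ (u₀ x) (loc ζ θ V (t, x))) (𝓝[>] 0) (𝓝 A))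
    (ha : LocIntegrable a) (hb : LocIntegrable b) (hc : LocIntegrable c)
    (hg : ∀ i, LocIntegrable (g i))
    (H : ∀ Φ : ST → R3, IsTest Φ →
      (∫ p in future, inner ℝ (a p) (dt Φ p)) + (∫ p in future, inner ℝ (b p) (curl Φ p))
        + (∫ p in future, inner ℝ (c p) (Φ p)) + ∑ i, ∫ p in future, inner ℝ (g i p) (dx i Φ p)
        = ∫ x, inner ℝ (u₀ x) (Φ (0, x))) :
    IntegrableOn (pairing a b c g (loc ζ θ V)) (slab S) ∧
      ∫ p in slab S, pairing a b c g (loc ζ θ V) p = A := by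
  have hh := isHalfTest_loc hST hV hζ hθ hcs
  refine ⟨(hh.integrable_pairing ha hb hc hg).mono_set (slab_subset_future S), ?_⟩
  rw [← setIntegral_future_eq_slab]
  · exact hh.identity h0 ha hb hc hg H
  · intro p hp
    have hf := fderiv_loc_eq_zero (θ := θ) (V := V) hζ hp
    have h0 : loc ζ θ V p = 0 := by simp [loc, hζ.zero _ hp.le]
    simp [pairing, dt, dx, curl_eq, hf, h0]

lemma tendsto_loc_initial (hST : S < T) (hV : BddSmooth T V) (hζ : IsTimeWeight S lam ζ)
    (hθ : ContDiff ℝ ∞ θ) (hcs : HasCompactSupport θ) {u₀ V₀ : R3 → R3} (hu : Continuous u₀)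
    (h0 : ∀ x, Tendsto (fun t : ℝ => V (t, x)) (𝓝[>] 0) (𝓝 (V₀ x))) :
    Tendsto (fun t : ℝ => ∫ x, inner ℝ (u₀ x) (loc ζ θ V (t, x))) (𝓝[>] 0)
      (𝓝 (ζ 0 * ∫ x, θ x * inner ℝ (u₀ x) (V₀ x))) := by
  have h1 : ∀ x, Tendsto (fun t : ℝ => loc ζ θ V (t, x)) (𝓝[>] 0) (𝓝 ((ζ 0 * θ x) • V₀ x)) := by
    intro x
    refine Tendsto.smul (Tendsto.mul_const _ ?_) (h0 x)
    exact (hζ.smooth.continuous.tendsto 0).mono_left nhdsWithin_le_nhds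
  have := (isHalfTest_loc hST hV hζ hθ hcs).halfCont.tendsto_integral_initial hu h1
  have heq : (fun x => inner ℝ (u₀ x) ((ζ 0 * θ x) • V₀ x))
      = fun x => ζ 0 * (θ x * inner ℝ (u₀ x) (V₀ x)) := by
    ext x; rw [real_inner_smul_right, mul_assoc]
  rwa [heq, integral_const_mul] at this

end LocIdentity

/-! ### The weak equations tested with localized smooth fields. -/

lemma hasCompactSupport_slice {Ψ : ST → R3} (h : HasCompactSupport Ψ) (t : ℝ) :
    HasCompactSupport fun x : R3 => Ψ (t, x) :=
  HasCompactSupport.of_support_subset_isCompact (h.isCompact.image continuous_snd)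
    fun x hx => ⟨(t, x), subset_tsupport _ hx, rfl⟩

lemma locIntegrable_zero : LocIntegrable (fun _ : ST => (0 : R3)) := fun _ => integrableOn_zero

lemma LocIntegrable.neg {f : ST → R3} (h : LocIntegrable f) : LocIntegrable (fun p => - f p) :=
  fun R => (h R).neg

lemma locIntegrable_ite {f : ST → R3} (h : LocIntegrable f) (i j : Fin 3) :
    LocIntegrable (fun p => if j = i then f p else 0) := by
  by_cases hij : j = i
  · simpa [hij] using h
  · simpa [hij] using locIntegrable_zero

lemma aestronglyMeasurable_cross {μ : Measure ST} {f g : ST → R3} (hf : AEStronglyMeasurable f μ)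
    (hg : AEStronglyMeasurable g μ) : AEStronglyMeasurable (fun p => cross (f p) (g p)) μ :=
  crossL.aestronglyMeasurable_comp₂ hf hg

namespace IsWeakSolutionWith

variable {m₀ E₀ H₀ : R3 → R3} {m E H mt : ST → R3} {G : Fin 3 → ST → R3}

lemma norm_m_slab (W : IsWeakSolutionWith m₀ E₀ H₀ m E H mt G) (S : ℝ) :
    ∀ᵐ p ∂(volume.restrict (slab S)), ‖m p‖ = 1 :=
  ae_restrict_of_ae_restrict_of_subset (slab_subset_future S) W.norm_m

lemma meas_m_slab (W : IsWeakSolutionWith m₀ E₀ H₀ m E H mt G) (S : ℝ) :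
    AEStronglyMeasurable m (volume.restrict (slab S)) :=
  W.meas_m.mono_measure (Measure.restrict_mono (slab_subset_future S) le_rfl)

lemma memLp_cross (W : IsWeakSolutionWith m₀ E₀ H₀ m E H mt G) {f : ST → R3} {S : ℝ}
    (hf : MemLp f 2 (volume.restrict (slab S))) :
    MemLp (fun p => cross (m p) (f p)) 2 (volume.restrict (slab S)) := by
  refine hf.of_le (aestronglyMeasurable_cross (W.meas_m_slab S) hf.1) ?_
  filter_upwards [W.norm_m_slab S] with p hp
  simpa [hp] using norm_cross_le (m p) (f p)

lemma locIntegrable_m (W : IsWeakSolutionWith m₀ E₀ H₀ m E H mt G) : LocIntegrable m := by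
  intro R
  have : IsFiniteMeasure (volume.restrict (future ∩ Metric.ball (0 : ST) R)) :=
    ⟨by rw [Measure.restrict_apply_univ]
        exact (measure_mono inter_subset_right).trans_lt measure_ball_lt_top⟩
  refine Integrable.of_bound
    (W.meas_m.mono_measure (Measure.restrict_mono inter_subset_left le_rfl)) 1 ?_
  filter_upwards [ae_restrict_of_ae_restrict_of_subset inter_subset_left W.norm_m] with p hp
  exact hp.le

lemma locIntegrable_E (W : IsWeakSolutionWith m₀ E₀ H₀ m E H mt G) : LocIntegrable E :=
  locIntegrable_of_memLp fun S _ => W.class_E.memLp S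

lemma locIntegrable_H (W : IsWeakSolutionWith m₀ E₀ H₀ m E H mt G) : LocIntegrable H :=
  locIntegrable_of_memLp fun S _ => W.class_H.memLp S

lemma locIntegrable_G (W : IsWeakSolutionWith m₀ E₀ H₀ m E H mt G) (i : Fin 3) :
    LocIntegrable (G i) :=
  locIntegrable_of_memLp fun S _ => (W.grad_m i).memLp S

lemma locIntegrable_mt (W : IsWeakSolutionWith m₀ E₀ H₀ m E H mt G) : LocIntegrable mt :=
  locIntegrable_of_memLp W.memLp_mt

/-- `∂ₜ H + ∂ₜ m + curl E = 0` with initial value `H₀`. -/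
lemma faraday_field (W : IsWeakSolutionWith m₀ E₀ H₀ m E H mt G)
    (hm₀ : Continuous m₀) (hH₀ : Continuous H₀) {Ψ : ST → R3} (h : IsTest Ψ) :
    - (∫ p in future, inner ℝ (H p) (dt Ψ p)) + (∫ p in future, inner ℝ (E p) (curl Ψ p))
      + ∫ p in future, inner ℝ (mt p) (Ψ p) = ∫ x, inner ℝ (H₀ x) (Ψ (0, x)) := by
  have h1 := W.faraday Ψ h
  have h2 := W.weak_dt Ψ h
  have hi : ∀ u : R3 → R3, Continuous u → Integrable fun x => inner ℝ (u x) (Ψ (0, x)) := by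
    intro u hu
    refine (hu.inner (h.1.continuous.comp (by fun_prop))).integrable_of_hasCompactSupport ?_
    have : HasCompactSupport fun x : R3 => Ψ (0, x) :=
      hasCompactSupport_slice h.2 0
    exact this.mono (fun x hx h0 => hx (by simp [h0]))
  simp_rw [inner_add_left] at h1
  rw [integral_add (h.halfTest.halfCont_dt.integrable_inner W.locIntegrable_H)
    (h.halfTest.halfCont_dt.integrable_inner W.locIntegrable_m),
    integral_add (hi _ hH₀) (hi _ hm₀)] at h1
  linarith

/-- `∂ₜ ∂ᵢ m = ∂ᵢ ∂ₜ m` with initial value `∂ᵢ m₀`. -/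
lemma weak_dt_dx (W : IsWeakSolutionWith m₀ E₀ H₀ m E H mt G) (hm₀ : ContDiff ℝ ∞ m₀)
    (i : Fin 3) {Ψ : ST → R3} (h : IsTest Ψ) :
    - (∫ p in future, inner ℝ (G i p) (dt Ψ p)) + (∫ p in future, inner ℝ (mt p) (dx i Ψ p))
      = ∫ x, inner ℝ (pd i m₀ x) (Ψ (0, x)) := by
  -- The weak derivative formulas in `x` and `t` are applied to `∂ₜ Ψ` and `∂ᵢ Ψ`; the mixed
  -- derivatives of `Ψ` agree, and the trace term is integrated by parts in space.
  have h1 := W.weak_dx i _ h.dt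
  have h2 := W.weak_dt _ (h.dx i)
  have hcomm : dt (dx i Ψ) = dx i (dt Ψ) := funext fun p => dt_dx_comm i h.1.contDiffAt
  rw [hcomm, h1] at h2
  have hs : ContDiff ℝ ∞ fun x : R3 => Ψ (0, x) := h.1.comp (by fun_prop)
  have hc : HasCompactSupport fun x : R3 => Ψ (0, x) :=
    hasCompactSupport_slice h.2 0
  have hd : ∀ x, dx i Ψ (0, x) = fderiv ℝ (fun x : R3 => Ψ (0, x)) x (e i) := by
    intro x
    have := ((h.1.differentiable (by simp) (0, x)).hasFDerivAt.comp x
      (hasFDerivAt_prodMk_right (0 : ℝ) x)).fderiv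
    change fderiv ℝ (fun x : R3 => Ψ (0, x)) x = _ at this
    rw [this]; simp [dx]
  have hint : ∀ u v : R3 → R3, Continuous u → Continuous v → HasCompactSupport v →
      Integrable fun x => inner ℝ (u x) (v x) := fun u v hu hv hcv =>
    (hu.inner hv).integrable_of_hasCompactSupport (hcv.mono fun x hx h0 => hx (by simp [h0]))
  have hm1 : Continuous (pd i m₀) := (hm₀.continuous_fderiv (by simp)).clm_apply continuous_const
  have hs1 : Continuous fun x => fderiv ℝ (fun x : R3 => Ψ (0, x)) x (e i) :=
    (hs.continuous_fderiv (by simp)).clm_apply continuous_const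
  have hc1 : HasCompactSupport fun x => fderiv ℝ (fun x : R3 => Ψ (0, x)) x (e i) :=
    (hc.fderiv ℝ).comp_left (g := fun L : R3 →L[ℝ] R3 => L (e i)) (by simp)
  have h3 := integral_bilinear_fderiv_right_eq_neg_left_of_integrable (μ := volume) (f := m₀)
    (g := fun x : R3 => Ψ (0, x)) (v := e i) (B := innerSL ℝ)
    (hint _ _ hm1 hs.continuous hc) (hint _ _ hm₀.continuous hs1 hc1)
    (hint _ _ hm₀.continuous hs.continuous hc)
    (fun x _ => hm₀.differentiable (by simp) x) (fun x _ => hs.differentiable (by simp) x)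
  change (∫ x, inner ℝ (m₀ x) (fderiv ℝ (fun x : R3 => Ψ (0, x)) x (e i)))
    = -∫ x, inner ℝ (pd i m₀ x) (Ψ (0, x)) at h3
  simp_rw [hd] at h2
  rw [h3] at h2
  change _ = - -(∫ x, inner ℝ (pd i m₀ x) (Ψ (0, x))) - _ at h2
  linarith

section Localized

variable {S T lam : ℝ} {ζ : ℝ → ℝ} {θ : R3 → ℝ} {V : ST → R3} {V₀ : R3 → R3}

lemma ampere_loc (W : IsWeakSolutionWith m₀ E₀ H₀ m E H mt G) (hE₀ : Continuous E₀)
    (hST : S < T) (hV : BddSmooth T V) (hζ : IsTimeWeight S lam ζ)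
    (hθ : ContDiff ℝ ∞ θ) (hcs : HasCompactSupport θ)
    (h0 : ∀ x, Tendsto (fun t : ℝ => V (t, x)) (𝓝[>] 0) (𝓝 (V₀ x))) :
    IntegrableOn (pairing (fun p => - E p) (fun p => - H p) (fun _ => 0) (fun _ _ => 0)
      (loc ζ θ V)) (slab S) ∧
    ∫ p in slab S, pairing (fun p => - E p) (fun p => - H p) (fun _ => 0) (fun _ _ => 0)
      (loc ζ θ V) p = ζ 0 * ∫ x, θ x * inner ℝ (E₀ x) (V₀ x) := by
  refine loc_identity hST hV hζ hθ hcs (tendsto_loc_initial hST hV hζ hθ hcs hE₀ h0)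
    W.locIntegrable_E.neg W.locIntegrable_H.neg locIntegrable_zero (fun _ => locIntegrable_zero)
    fun Φ hΦ => ?_
  have := W.ampere Φ hΦ
  simp only [inner_neg_left, integral_neg, inner_zero_left, integral_zero, Finset.sum_const_zero,
    add_zero]
  linarith

lemma faraday_loc (W : IsWeakSolutionWith m₀ E₀ H₀ m E H mt G) (hm₀ : Continuous m₀)
    (hH₀ : Continuous H₀) (hST : S < T) (hV : BddSmooth T V) (hζ : IsTimeWeight S lam ζ)
    (hθ : ContDiff ℝ ∞ θ) (hcs : HasCompactSupport θ)
    (h0 : ∀ x, Tendsto (fun t : ℝ => V (t, x)) (𝓝[>] 0) (𝓝 (V₀ x))) :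
    IntegrableOn (pairing (fun p => - H p) E mt (fun _ _ => 0) (loc ζ θ V)) (slab S) ∧
    ∫ p in slab S, pairing (fun p => - H p) E mt (fun _ _ => 0) (loc ζ θ V) p
      = ζ 0 * ∫ x, θ x * inner ℝ (H₀ x) (V₀ x) := by
  refine loc_identity hST hV hζ hθ hcs (tendsto_loc_initial hST hV hζ hθ hcs hH₀ h0)
    W.locIntegrable_H.neg W.locIntegrable_E W.locIntegrable_mt (fun _ => locIntegrable_zero)
    fun Φ hΦ => ?_
  have := W.faraday_field hm₀ hH₀ hΦ
  simp only [inner_neg_left, integral_neg, inner_zero_left, integral_zero, Finset.sum_const_zero,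
    add_zero]
  linarith

lemma sum_integral_ite (i : Fin 3) (f : ST → R3) (Φ : ST → R3) :
    ∑ j, ∫ p in future, inner ℝ (if j = i then f p else 0) (dx j Φ p)
      = ∫ p in future, inner ℝ (f p) (dx i Φ p) := by
  rw [Finset.sum_eq_single i] <;> simp +contextual

lemma dt_dx_loc (W : IsWeakSolutionWith m₀ E₀ H₀ m E H mt G) (hm₀ : ContDiff ℝ ∞ m₀)
    (i : Fin 3) (hST : S < T) (hV : BddSmooth T V) (hζ : IsTimeWeight S lam ζ)
    (hθ : ContDiff ℝ ∞ θ) (hcs : HasCompactSupport θ)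
    (h0 : ∀ x, Tendsto (fun t : ℝ => V (t, x)) (𝓝[>] 0) (𝓝 (V₀ x))) :
    IntegrableOn (pairing (fun p => - G i p) (fun _ => 0) (fun _ => 0)
      (fun j p => if j = i then mt p else 0) (loc ζ θ V)) (slab S) ∧
    ∫ p in slab S, pairing (fun p => - G i p) (fun _ => 0) (fun _ => 0)
      (fun j p => if j = i then mt p else 0) (loc ζ θ V) p
      = ζ 0 * ∫ x, θ x * inner ℝ (pd i m₀ x) (V₀ x) := by
  have hc : Continuous (pd i m₀) := (hm₀.continuous_fderiv (by simp)).clm_apply continuous_const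
  refine loc_identity hST hV hζ hθ hcs (tendsto_loc_initial hST hV hζ hθ hcs hc h0)
    (W.locIntegrable_G i).neg locIntegrable_zero locIntegrable_zero
    (fun j => locIntegrable_ite W.locIntegrable_mt i j) fun Φ hΦ => ?_
  have := W.weak_dt_dx hm₀ i hΦ
  rw [sum_integral_ite]
  simp only [inner_neg_left, integral_neg, inner_zero_left, integral_zero, add_zero]
  linarith

lemma dx_loc' (W : IsWeakSolutionWith m₀ E₀ H₀ m E H mt G)
    (i : Fin 3) (hST : S < T) (hV : BddSmooth T V) (hζ : IsTimeWeight S lam ζ)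
    (hθ : ContDiff ℝ ∞ θ) (hcs : HasCompactSupport θ) :
    IntegrableOn (pairing (fun _ => 0) (fun _ => 0) (G i)
      (fun j p => if j = i then m p else 0) (loc ζ θ V)) (slab S) ∧
    ∫ p in slab S, pairing (fun _ => 0) (fun _ => 0) (G i)
      (fun j p => if j = i then m p else 0) (loc ζ θ V) p = 0 := by
  refine loc_identity hST hV hζ hθ hcs (u₀ := fun _ => 0) (by simp)
    locIntegrable_zero locIntegrable_zero (W.locIntegrable_G i)
    (fun j => locIntegrable_ite W.locIntegrable_m i j) fun Φ hΦ => ?_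
  have := W.weak_dx i Φ hΦ
  rw [sum_integral_ite]
  simp only [inner_zero_left, integral_zero, zero_add]
  linarith

lemma gilbert_loc (W : IsWeakSolutionWith m₀ E₀ H₀ m E H mt G)
    (hST : S < T) (hV : BddSmooth T V) (hζ : IsTimeWeight S lam ζ)
    (hθ : ContDiff ℝ ∞ θ) (hcs : HasCompactSupport θ) :
    IntegrableOn (pairing (fun _ => 0) (fun _ => 0)
      (fun p => mt p + cross (m p) (mt p) - (2 : ℝ) • cross (m p) (H p))
      (fun i p => (2 : ℝ) • cross (m p) (G i p)) (loc ζ θ V)) (slab S) ∧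
    ∫ p in slab S, pairing (fun _ => 0) (fun _ => 0)
      (fun p => mt p + cross (m p) (mt p) - (2 : ℝ) • cross (m p) (H p))
      (fun i p => (2 : ℝ) • cross (m p) (G i p)) (loc ζ θ V) p = 0 := by
  have h1 : LocIntegrable (fun p => mt p + cross (m p) (mt p)) :=
    locIntegrable_of_memLp fun S hS => (W.memLp_mt S hS).add (W.memLp_cross (W.memLp_mt S hS))
  have h2 : LocIntegrable (fun p => cross (m p) (H p)) :=
    locIntegrable_of_memLp fun S hS => W.memLp_cross (W.class_H.memLp S)
  have h3 : ∀ i, LocIntegrable (fun p => cross (m p) (G i p)) := fun i =>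
    locIntegrable_of_memLp fun S hS => W.memLp_cross ((W.grad_m i).memLp S)
  refine loc_identity hST hV hζ hθ hcs (u₀ := fun _ => 0) (by simp)
    locIntegrable_zero locIntegrable_zero (fun R => (h1 R).sub ((h2 R).smul (2 : ℝ)))
    (fun j R => (h3 j R).smul (2 : ℝ)) fun Φ hΦ => ?_
  have := W.gilbert Φ hΦ
  simp only [inner_zero_left, integral_zero, zero_add, inner_sub_left, real_inner_smul_left,
    integral_const_mul]
  rw [integral_sub (hΦ.halfTest.halfCont.integrable_inner h1)
    ((hΦ.halfTest.halfCont.integrable_inner h2).const_mul 2), integral_const_mul,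
    ← Finset.mul_sum]
  linarith

end Localized

end IsWeakSolutionWith

/-! ### Initial values of derivatives and integration by parts for the smooth solution. -/

section Slices

variable {F : Type} [NormedAddCommGroup F] [NormedSpace ℝ F] {u : ST → F}

lemma hasDerivAt_time {t : ℝ} {x : R3} (h : DifferentiableAt ℝ u (t, x)) :
    HasDerivAt (fun s => u (s, x)) (dt u (t, x)) t := by
  have h1 : HasDerivAt (fun s : ℝ => (s, x)) ((1, 0) : ST) t :=
    (hasDerivAt_id t).prodMk (hasDerivAt_const t x)
  exact h.hasFDerivAt.comp_hasDerivAt t h1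

lemma hasFDerivAt_space {t : ℝ} {x : R3} (h : DifferentiableAt ℝ u (t, x)) :
    HasFDerivAt (fun y => u (t, y))
      ((fderiv ℝ u (t, x)).comp (ContinuousLinearMap.inr ℝ ℝ R3)) x :=
  h.hasFDerivAt.comp x (hasFDerivAt_prodMk_right t x)

lemma dx_eq_fderiv_space {t : ℝ} {x : R3} (h : DifferentiableAt ℝ u (t, x)) (i : Fin 3) :
    dx i u (t, x) = fderiv ℝ (fun y => u (t, y)) x (e i) := by
  rw [(hasFDerivAt_space h).fderiv]; simp [dx]

lemma hasDerivAt_line {t s : ℝ} {x : R3} {i : Fin 3}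
    (h : DifferentiableAt ℝ u (t, x + s • e i)) :
    HasDerivAt (fun r : ℝ => u (t, x + r • e i)) (dx i u (t, x + s • e i)) s := by
  have h1 : HasDerivAt (fun r : ℝ => (t, x + r • e i)) ((0, e i) : ST) s := by
    refine (hasDerivAt_const s t).prodMk ?_
    simpa using ((hasDerivAt_id s).smul_const (e i)).const_add x
  exact h.hasFDerivAt.comp_hasDerivAt s h1

end Slices

lemma norm_e (i : Fin 3) : ‖e i‖ = 1 := by simp [e]

/-- The constant is a bound for `∂ᵢ∂ᵢ u` on the slab, hence uniform down to `t = 0`; two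
applications of the mean value inequality along a line give the estimate. -/
lemma exists_taylor_bound {F : Type} [NormedAddCommGroup F] [NormedSpace ℝ F] {T : ℝ}
    {u : ST → F} (h : BddSmooth T u) {S : ℝ} (hS : S < T) (i : Fin 3) :
    ∃ C : ℝ, 0 ≤ C ∧ ∀ t x, 0 < t → t < S → ∀ s : ℝ, 0 ≤ s →
      ‖u (t, x + s • e i) - u (t, x) - s • dx i u (t, x)‖ ≤ C * s * s := by
  obtain ⟨C, hC0, hC⟩ := ((h.dx i).dx i).exists_bound hS
  refine ⟨C, hC0, fun t x h0 ht s hs => ?_⟩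
  have hm : ∀ y : R3, (t, y) ∈ slab T := fun y => mem_slab.2 ⟨h0, ht.trans hS⟩
  have hm' : ∀ y : R3, (t, y) ∈ slab S := fun y => mem_slab.2 ⟨h0, ht⟩
  have h1 : ∀ r ∈ Icc 0 s, ‖dx i u (t, x + r • e i) - dx i u (t, x)‖ ≤ C * r := by
    intro r hr
    have := norm_image_sub_le_of_norm_deriv_le_segment' (a := 0) (b := s) (C := C)
      (f := fun r : ℝ => dx i u (t, x + r • e i))
      (fun r _ => (hasDerivAt_line ((h.dx i).differentiableAt (hm _))).hasDerivWithinAt)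
      (fun r _ => hC _ (hm' _)) r hr
    simpa using this
  have h2 := norm_image_sub_le_of_norm_deriv_le_segment' (a := 0) (b := s) (C := C * s)
      (f := fun r : ℝ => u (t, x + r • e i) - r • dx i u (t, x))
      (f' := fun r : ℝ => dx i u (t, x + r • e i) - dx i u (t, x))
      (fun r _ => ?_) (fun r hr => (h1 r ⟨hr.1, hr.2.le⟩).trans (by gcongr; exact hr.2.le)) s
      ⟨hs, le_rfl⟩
  · simpa [sub_right_comm] using h2
  · refine HasDerivAt.hasDerivWithinAt ?_
    have h3 := (hasDerivAt_line (x := x) (i := i) (h.differentiableAt (hm _))).fun_sub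
      ((hasDerivAt_id r).smul_const (dx i u (t, x)))
    simpa using h3

/-- Only pointwise convergence of `u` is assumed. The derivative differs from the difference
quotient of step `s` by at most `C s`, uniformly in `t`, and for fixed `s` the quotient converges as
`t → 0`; choosing `s` small first gives the claim. -/
lemma IsSmoothUpTo.tendsto_dx {T : ℝ} {u : ST → R3} {u₀ : R3 → R3} (hT : 0 < T)
    (h : IsSmoothUpTo T u u₀) (hu₀ : ContDiff ℝ ∞ u₀) (i : Fin 3) (x : R3) :
    Tendsto (fun t : ℝ => dx i u (t, x)) (𝓝[>] 0) (𝓝 (pd i u₀ x)) := by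
  obtain ⟨C, hC0, hC⟩ := exists_taylor_bound h.bddSmooth (half_lt_self hT) i
  rw [Metric.tendsto_nhds]
  intro ε hε
  have hd : HasDerivAt (fun r : ℝ => u₀ (x + r • e i)) (pd i u₀ x) 0 := by
    have h1 : HasDerivAt (fun r : ℝ => x + r • e i) (e i) 0 := by
      simpa using ((hasDerivAt_id (0 : ℝ)).smul_const (e i)).const_add x
    have h2 : HasFDerivAt u₀ (fderiv ℝ u₀ x) (x + (0 : ℝ) • e i) := by
      simpa using (hu₀.differentiable (by simp) x).hasFDerivAt
    exact h2.comp_hasDerivAt 0 h1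
  have h3 : ∀ᶠ s in 𝓝[>] (0 : ℝ), ‖s⁻¹ • (u₀ (x + s • e i) - u₀ x) - pd i u₀ x‖ < ε / 3 := by
    have := (hasDerivAt_iff_tendsto_slope_zero.1 hd).mono_left
      (nhdsWithin_mono (0 : ℝ) (fun s hs => (ne_of_gt hs : s ≠ 0) : Ioi (0 : ℝ) ⊆ {0}ᶜ))
    simp only [zero_add, zero_smul, add_zero] at this
    have := (Metric.tendsto_nhds.1 this) (ε / 3) (by positivity)
    simpa [dist_eq_norm] using this
  have h4 : ∀ᶠ s in 𝓝[>] (0 : ℝ), C * s < ε / 3 := by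
    have : Tendsto (fun s : ℝ => C * s) (𝓝[>] 0) (𝓝 (C * 0)) :=
      (continuous_const.mul continuous_id).continuousAt.mono_left nhdsWithin_le_nhds
    exact this.eventually_lt_const (by simpa using by positivity)
  obtain ⟨s, ⟨hs3, hs4⟩, hs0 : 0 < s⟩ := ((h3.and h4).and self_mem_nhdsWithin).exists
  have h5 : Tendsto (fun t : ℝ => s⁻¹ • (u (t, x + s • e i) - u (t, x))) (𝓝[>] 0)
      (𝓝 (s⁻¹ • (u₀ (x + s • e i) - u₀ x))) :=
    ((h.initial _).sub (h.initial _)).const_smul _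
  filter_upwards [Metric.tendsto_nhds.1 h5 (ε / 3) (by positivity),
    Ioo_mem_nhdsGT (half_pos hT)] with t ht1 ht2
  have h6 : ‖dx i u (t, x) - s⁻¹ • (u (t, x + s • e i) - u (t, x))‖ ≤ C * s := by
    have h7 := hC t x ht2.1 ht2.2 s hs0.le
    have h8 : dx i u (t, x) - s⁻¹ • (u (t, x + s • e i) - u (t, x))
        = -(s⁻¹ • (u (t, x + s • e i) - u (t, x) - s • dx i u (t, x))) := by
      rw [smul_sub s⁻¹ (_ - _) (s • _), smul_smul, inv_mul_cancel₀ hs0.ne', one_smul]; abel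
    rw [h8, norm_neg, norm_smul, Real.norm_of_nonneg (by positivity)]
    calc s⁻¹ * _ ≤ s⁻¹ * (C * s * s) := by gcongr
      _ = C * s := by field_simp
  rw [dist_eq_norm] at ht1 ⊢
  calc ‖dx i u (t, x) - pd i u₀ x‖
      = ‖(dx i u (t, x) - s⁻¹ • (u (t, x + s • e i) - u (t, x)))
        + (s⁻¹ • (u (t, x + s • e i) - u (t, x)) - s⁻¹ • (u₀ (x + s • e i) - u₀ x))
        + (s⁻¹ • (u₀ (x + s • e i) - u₀ x) - pd i u₀ x)‖ := by congr 1; abel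
    _ ≤ _ := norm_add₃_le
    _ < ε := by linarith

section SlabIntegrals

variable {S T lam : ℝ} {ζ : ℝ → ℝ} {χ : R3 → ℝ}

lemma integrableOn_slab_mul {f : ST → ℝ} (hχ : Integrable χ) (hf : ContinuousOn f (slab S))
    {C : ℝ} (hC : ∀ p ∈ slab S, |f p| ≤ C) : IntegrableOn (fun p => χ p.2 * f p) (slab S) := by
  have h1 : Integrable (fun p : ST => (1 : ℝ) * χ p.2) (volume.restrict (slab S)) := by
    rw [volume_restrict_slab]
    exact (integrable_const (1 : ℝ)).mul_prod hχ
  simp only [one_mul] at h1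
  refine h1.mul_bdd (c := C) (hf.aestronglyMeasurable (isOpen_slab S).measurableSet) ?_
  filter_upwards [ae_restrict_mem (isOpen_slab S).measurableSet] with p hp using hC p hp

lemma BddSmooth.integrableOn_slab {f : ST → ℝ} (hf : BddSmooth T f) (hST : S < T)
    (hχ : Integrable χ) {η : ℝ → ℝ} (hη : Continuous η) :
    IntegrableOn (fun p => χ p.2 * (η p.1 * f p)) (slab S) := by
  obtain ⟨C, hC0, hC⟩ := hf.exists_bound hST
  obtain ⟨D, hD⟩ := (isCompact_Icc (a := 0) (b := S)).exists_bound_of_continuousOn hη.continuousOn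
  refine integrableOn_slab_mul hχ ((hη.comp continuous_fst).continuousOn.mul
    (hf.continuousOn.mono (slab_mono hST.le))) (C := D * C) fun p hp => ?_
  have h1 := hD p.1 ⟨(mem_slab.1 hp).1.le, (mem_slab.1 hp).2.le⟩
  rw [abs_mul]
  exact mul_le_mul h1 (hC p hp) (abs_nonneg _) ((norm_nonneg _).trans h1)

/-- Integration by parts in space. -/
lemma integral_slab_dx {f : ST → ℝ} (hf : BddSmooth T f) (hST : S < T) (i : Fin 3)
    (hχ : ContDiff ℝ ∞ χ) (hχi : Integrable χ) (hdχ : Integrable (sd i χ))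
    {η : ℝ → ℝ} (hη : Continuous η) :
    ∫ p in slab S, η p.1 * (χ p.2 * dx i f p + sd i χ p.2 * f p) = 0 := by
  have hI : IntegrableOn (fun p : ST => η p.1 * (χ p.2 * dx i f p + sd i χ p.2 * f p)) (slab S) := by
    refine (((hf.dx i).integrableOn_slab hST hχi hη).add
      (hf.integrableOn_slab hST hdχ hη)).congr (ae_of_all _ fun p => ?_)
    simp only [Pi.add_apply]; ring
  rw [IntegrableOn, volume_restrict_slab] at hI
  rw [volume_restrict_slab, integral_prod _ hI]
  refine setIntegral_eq_zero_of_forall_eq_zero fun t ht => ?_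
  dsimp only
  rw [integral_const_mul]
  have hm : ∀ y : R3, (t, y) ∈ slab S := fun y => mem_slab.2 ht
  have hd : ∀ y : R3, DifferentiableAt ℝ f (t, y) := fun y =>
    hf.differentiableAt (slab_mono hST.le (hm y))
  obtain ⟨C, hC0, hC⟩ := hf.exists_bound hST
  obtain ⟨D, hD0, hD⟩ := (hf.dx i).exists_bound hST
  have hc : ∀ {g : ST → ℝ}, BddSmooth T g → AEStronglyMeasurable (fun y : R3 => g (t, y)) :=
    fun {g} hg => by
      refine Continuous.aestronglyMeasurable (continuous_iff_continuousAt.2 fun y => ?_)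
      exact ((hg.differentiableAt (slab_mono hST.le (hm y))).continuousAt).comp
        (by fun_prop : ContinuousAt (fun y : R3 => (t, y)) y)
  have i1 : Integrable (fun y => sd i χ y * f (t, y)) :=
    hdχ.mul_bdd (hc hf) (ae_of_all _ fun y => hC _ (hm y))
  have i2 : Integrable (fun y => χ y * dx i f (t, y)) :=
    hχi.mul_bdd (hc (hf.dx i)) (ae_of_all _ fun y => hD _ (hm y))
  have i3 : Integrable (fun y => χ y * f (t, y)) :=
    hχi.mul_bdd (hc hf) (ae_of_all _ fun y => hC _ (hm y))
  have key := integral_mul_fderiv_eq_neg_fderiv_mul_of_integrable (μ := volume) (f := χ)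
    (g := fun y => f (t, y)) (v := e i) i1 (by simpa only [dx_eq_fderiv_space (hd _)] using i2) i3
    (fun y _ => hχ.differentiable (by simp) y)
    (fun y _ => (hasFDerivAt_space (hd y)).differentiableAt)
  simp only [← dx_eq_fderiv_space (hd _)] at key
  rw [integral_add i2 i1, key]
  simp [sd]

/-- Integration by parts in time. -/
lemma integral_slab_dt {f : ST → ℝ} (hf : BddSmooth T f) (hS : 0 < S) (hST : S < T)
    {f₀ : R3 → ℝ} (h0 : ∀ x, Tendsto (fun t : ℝ => f (t, x)) (𝓝[>] 0) (𝓝 (f₀ x)))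
    (hχ : Integrable χ) (hζ : IsTimeWeight S lam ζ) :
    ∫ p in slab S, χ p.2 * (- deriv ζ p.1 * f p - ζ p.1 * dt f p)
      = ζ 0 * ∫ x, χ x * f₀ x := by
  have hI : IntegrableOn (fun p : ST => χ p.2 * (- deriv ζ p.1 * f p - ζ p.1 * dt f p))
      (slab S) := by
    refine ((hf.integrableOn_slab hST hχ hζ.continuous_deriv.neg).sub
      (hf.dt.integrableOn_slab hST hχ hζ.smooth.continuous)).congr (ae_of_all _ fun p => ?_)
    simp only [Pi.sub_apply, Pi.neg_apply]; ring
  rw [IntegrableOn, volume_restrict_slab] at hI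
  rw [volume_restrict_slab, integral_prod_symm _ hI, ← integral_const_mul]
  congr 1
  ext x
  dsimp only
  rw [integral_const_mul, ← integral_Ioc_eq_integral_Ioo, ← intervalIntegral.integral_of_le hS.le]
  obtain ⟨C, hC0, hC⟩ := hf.exists_bound hST
  obtain ⟨D, hD0, hD⟩ := hf.dt.exists_bound hST
  obtain ⟨B, hB0, hB⟩ := hζ.exists_bound
  have hderiv : ∀ t ∈ Ioo 0 S, HasDerivAt (fun s => - (ζ s * f (s, x)))
      (- deriv ζ t * f (t, x) - ζ t * dt f (t, x)) t := by
    intro t ht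
    have := ((hζ.hasDerivAt t).fun_mul (hasDerivAt_time (hf.differentiableAt
      (slab_mono hST.le (mem_slab.2 ht : (t, x) ∈ slab S))))).fun_neg
    exact this.congr_deriv (by ring)
  have hlim0 : Tendsto (fun s => - (ζ s * f (s, x))) (𝓝[>] 0) (𝓝 (-(ζ 0 * f₀ x))) :=
    (((hζ.smooth.continuous.tendsto 0).mono_left nhdsWithin_le_nhds).mul (h0 x)).neg
  -- At the endpoint `S` boundedness of `f` suffices, since `ζ` vanishes there.
  have hlimS : Tendsto (fun s => - (ζ s * f (s, x))) (𝓝[<] S) (𝓝 0) := by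
    have h1 : Tendsto ζ (𝓝[<] S) (𝓝 0) := by
      have := (hζ.smooth.continuous.tendsto S).mono_left (nhdsWithin_le_nhds (s := Iio S))
      rwa [hζ.zero S le_rfl] at this
    have h2 : Tendsto (fun s => ζ s * f (s, x)) (𝓝[<] S) (𝓝 0) := by
      refine h1.zero_mul_isBoundedUnder_le ⟨C, ?_⟩
      rw [eventually_map]
      filter_upwards [Ioo_mem_nhdsLT hS] with s hs
      exact hC (s, x) (mem_slab.2 hs)
    simpa using h2.neg
  rw [intervalIntegral.integral_eq_sub_of_hasDerivAt_of_tendsto hS hderiv ?_ hlim0 hlimS]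
  · ring
  · rw [intervalIntegrable_iff_integrableOn_Ioo_of_le hS.le]
    have hcf : ∀ {g : ST → ℝ}, BddSmooth T g → ContinuousOn (fun s => g (s, x)) (Ioo 0 S) :=
      fun {g} hg s hs => (hasDerivAt_time (hg.differentiableAt (slab_mono hST.le
        (mem_slab.2 hs : (s, x) ∈ slab S)))).continuousAt.continuousWithinAt
    refine Integrable.of_bound ?_ (B * C + B * D) ?_
    · refine ContinuousOn.aestronglyMeasurable ?_ measurableSet_Ioo
      exact (hζ.continuous_deriv.neg.continuousOn.mul (hcf hf)).sub
        (hζ.smooth.continuous.continuousOn.mul (hcf hf.dt))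
    · filter_upwards [ae_restrict_mem measurableSet_Ioo] with s hs
      have hp : (s, x) ∈ slab S := mem_slab.2 hs
      have hb := hB s hs.1.le hs.2.le
      refine (norm_sub_le _ _).trans ?_
      rw [norm_mul, norm_mul, norm_neg]
      exact add_le_add (mul_le_mul hb.2 (hC _ hp) (norm_nonneg _) hB0)
        (mul_le_mul hb.1 (hD _ hp) (norm_nonneg _) hB0)

end SlabIntegrals

/-! ### Energy balance and energy inequality of the smooth solution. -/

/-- The Laplacian in the space variables. -/
def lap (u : ST → R3) (p : ST) : R3 := ∑ i, dx i (dx i u) p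

/-- The energy density of the initial value. -/
def energy₀ (m₀ E₀ H₀ : R3 → R3) (x : R3) : ℝ :=
  ‖E₀ x‖ ^ 2 + ‖H₀ x‖ ^ 2 + ∑ i, ‖pd i m₀ x‖ ^ 2

/-- The energy density. -/
def energyDensity (E H : ST → R3) (g : Fin 3 → ST → R3) (p : ST) : ℝ :=
  ‖E p‖ ^ 2 + ‖H p‖ ^ 2 + ∑ i, ‖g i p‖ ^ 2

lemma energyDensity_nonneg (E H : ST → R3) (g : Fin 3 → ST → R3) (p : ST) :
    0 ≤ energyDensity E H g p := by unfold energyDensity; positivity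

lemma IsSmoothData.norm_eq_one {m₀ E₀ H₀ : R3 → R3} (h : IsSmoothData m₀ E₀ H₀) (x : R3) :
    ‖m₀ x‖ = 1 := by
  have : (fun x => ‖m₀ x‖) = fun _ => (1 : ℝ) :=
    Continuous.ae_eq_iff_eq (μ := volume) h.smooth_m.continuous.norm continuous_const |>.1 h.norm_m
  exact congrFun this x

lemma IsSmoothData.integrable_energy₀ {m₀ E₀ H₀ : R3 → R3} (h : IsSmoothData m₀ E₀ H₀) :
    Integrable (energy₀ m₀ E₀ H₀) :=
  ((memLp_two_iff_integrable_sq_norm h.memLp_E.1).1 h.memLp_E |>.add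
    ((memLp_two_iff_integrable_sq_norm h.memLp_H.1).1 h.memLp_H)).add
    (integrable_finsetSum _ fun i _ =>
      (memLp_two_iff_integrable_sq_norm (h.grad_m i).1).1 (h.grad_m i))

namespace IsSmoothSolution

variable {T : ℝ} {m₀ E₀ H₀ : R3 → R3} {m E H : ST → R3}

lemma bm (h : IsSmoothSolution T m₀ E₀ H₀ m E H) : BddSmooth T m := h.smooth_m.bddSmooth

lemma bE (h : IsSmoothSolution T m₀ E₀ H₀ m E H) : BddSmooth T E := h.smooth_E.bddSmooth

lemma bH (h : IsSmoothSolution T m₀ E₀ H₀ m E H) : BddSmooth T H := h.smooth_H.bddSmooth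

lemma gilbert_field (h : IsSmoothSolution T m₀ E₀ H₀ m E H) {p : ST} (hp : p ∈ slab T) :
    dt m p + cross (m p) (dt m p) = (2 : ℝ) • cross (m p) (lap m p + H p) := by
  rw [h.gilbert p hp, ← smul_add]
  congr 1
  have : ∀ i, dx i (fun q => cross (m q) (dx i m q)) p = crossL (m p) (dx i (dx i m) p) := by
    intro i
    rw [dx_cross i (h.bm.differentiableAt hp) ((h.bm.dx i).differentiableAt hp), cross_self',
      zero_add, crossL_apply]
  rw [Finset.sum_congr rfl fun i _ => this i, ← map_sum, ← crossL_apply, ← map_add,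
    ← crossL_apply]
  rfl

lemma inner_m_dt (h : IsSmoothSolution T m₀ E₀ H₀ m E H) {p : ST} (hp : p ∈ slab T) :
    inner ℝ (m p) (dt m p) = 0 := by
  have := congrArg (inner ℝ (m p)) (h.gilbert_field hp)
  rwa [inner_add_right, inner_cross_self, real_inner_smul_right, inner_cross_self, mul_zero,
    add_zero] at this

/-- The time derivative of `|m|²` is `2 m · ∂ₜ m = 0`, so `|m|²` is constant on each line `x =
const`, and its limit at `t = 0` is `|m₀|² = 1`. -/
lemma norm_m_eq_one (h : IsSmoothSolution T m₀ E₀ H₀ m E H) (hd : IsSmoothData m₀ E₀ H₀)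
    {p : ST} (hp : p ∈ slab T) : ‖m p‖ = 1 := by
  obtain ⟨t, x⟩ := p
  have hm : ∀ s ∈ Ioo 0 T, (s, x) ∈ slab T := fun s hs => mem_slab.2 hs
  have hder : ∀ s ∈ Ioo 0 T, HasDerivAt (fun r => inner ℝ (m (r, x)) (m (r, x))) 0 s := by
    intro s hs
    have h1 := hasDerivAt_time (h.bm.differentiableAt (hm s hs))
    have h2 := h1.inner ℝ h1
    rw [real_inner_comm (m (s, x)), h.inner_m_dt (hm s hs)] at h2
    simpa using h2
  have hconst : ∀ s ∈ Ioo 0 T, inner ℝ (m (s, x)) (m (s, x)) = inner ℝ (m (t, x)) (m (t, x)) := by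
    intro s hs
    exact isOpen_Ioo.is_const_of_deriv_eq_zero isPreconnected_Ioo
      (fun r hr => (hder r hr).differentiableAt.differentiableWithinAt)
      (fun r hr => (hder r hr).deriv) hs (mem_slab.1 hp)
  have hT : 0 < T := (mem_slab.1 hp).1.trans (mem_slab.1 hp).2
  have hl1 := (h.smooth_m.initial x).inner (𝕜 := ℝ) (h.smooth_m.initial x)
  have hl2 : Tendsto (fun s : ℝ => inner ℝ (m (s, x)) (m (s, x))) (𝓝[>] 0)
      (𝓝 (inner ℝ (m (t, x)) (m (t, x)))) := by
    refine tendsto_const_nhds.congr' ?_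
    filter_upwards [Ioo_mem_nhdsGT hT] with s hs using (hconst s hs).symm
  have := tendsto_nhds_unique hl1 hl2
  rw [real_inner_self_eq_norm_sq, real_inner_self_eq_norm_sq, hd.norm_eq_one x] at this
  have h3 : ‖m (t, x)‖ ^ 2 = 1 := by linarith
  exact (pow_eq_one_iff_of_nonneg (norm_nonneg _) two_ne_zero).1 h3

/-- The `i`-th component of the energy flux. -/
def flux (m E H : ST → R3) (i : Fin 3) (p : ST) : ℝ :=
  cross (H p) (E p) i + inner ℝ (dx i m p) (dt m p)

lemma bddSmooth_flux (h : IsSmoothSolution T m₀ E₀ H₀ m E H) (i : Fin 3) :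
    BddSmooth T (flux m E H i) :=
  ((h.bH.cross h.bE).clm (EuclideanSpace.proj i : R3 →L[ℝ] ℝ)).add ((h.bm.dx i).inner h.bm.dt)

lemma bddSmooth_normSq {u : ST → R3} (hu : BddSmooth T u) : BddSmooth T (fun p => ‖u p‖ ^ 2) := by
  simpa only [real_inner_self_eq_norm_sq] using hu.inner hu

lemma bddSmooth_energyDensity (h : IsSmoothSolution T m₀ E₀ H₀ m E H) :
    BddSmooth T (energyDensity E H (fun i => dx i m)) := by
  have := ((bddSmooth_normSq h.bE).add (bddSmooth_normSq h.bH)).add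
    (((bddSmooth_normSq (h.bm.dx 0)).add (bddSmooth_normSq (h.bm.dx 1))).add
      (bddSmooth_normSq (h.bm.dx 2)))
  unfold energyDensity
  simpa only [Fin.sum_univ_three] using this

lemma dt_energyDensity (h : IsSmoothSolution T m₀ E₀ H₀ m E H) {p : ST} (hp : p ∈ slab T) :
    dt (energyDensity E H (fun i => dx i m)) p = 2 * inner ℝ (E p) (dt E p)
      + 2 * inner ℝ (H p) (dt H p) + ∑ i, 2 * inner ℝ (dx i m p) (dt (dx i m) p) := by
  have h1 := ((h.bE.differentiableAt hp).hasFDerivAt.norm_sq.fun_add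
    (h.bH.differentiableAt hp).hasFDerivAt.norm_sq).fun_add
    (HasFDerivAt.fun_sum (u := Finset.univ) fun i _ =>
      ((h.bm.dx i).differentiableAt hp).hasFDerivAt.norm_sq)
  change HasFDerivAt (energyDensity E H (fun i => dx i m)) _ p at h1
  rw [dt, h1.fderiv]
  simp [dt]

/-- The local energy balance. -/
lemma energy_balance (h : IsSmoothSolution T m₀ E₀ H₀ m E H) {p : ST} (hp : p ∈ slab T) :
    dt (energyDensity E H (fun i => dx i m)) p + ‖dt m p‖ ^ 2
      = 2 * ∑ i, dx i (flux m E H i) p := by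
  -- This is where dissipation arises: Faraday's law contributes `-2 H · ∂ₜ m`, and removing the
  -- divergence of the exchange flux contributes `-2 Δm · ∂ₜ m`; their sum is `-|∂ₜ m|²`. The curls
  -- combine into the divergence of `H ∧ E`.
  have hv := inner_field_of_gilbert (h.gilbert_field hp)
  have hfl : ∀ i, dx i (flux m E H i) p = (cross (dx i H p) (E p) + cross (H p) (dx i E p)) i
      + (inner ℝ (dx i (dx i m) p) (dt m p) + inner ℝ (dx i m p) (dt (dx i m) p)) := by
    intro i
    have hc : DifferentiableAt ℝ (fun q => cross (H q) (E q)) p :=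
      (h.bH.cross h.bE).differentiableAt hp
    have hi : DifferentiableAt ℝ (fun q => inner ℝ (dx i m q) (dt m q)) p :=
      ((h.bm.dx i).inner h.bm.dt).differentiableAt hp
    have h1 := (((EuclideanSpace.proj i : R3 →L[ℝ] ℝ).hasFDerivAt.comp p hc.hasFDerivAt).add
      hi.hasFDerivAt).fderiv
    have h2 : dx i (flux m E H i) p = dx i (fun q => cross (H q) (E q)) p i
        + dx i (fun q => inner ℝ (dx i m q) (dt m q)) p := by
      change fderiv ℝ (flux m E H i) p = _ at h1
      simp [dx, h1]
    rw [h2, dx_cross i (h.bH.differentiableAt hp) (h.bE.differentiableAt hp),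
      dx_inner i ((h.bm.dx i).differentiableAt hp) (h.bm.dt.differentiableAt hp),
      dt_dx_comm i (h.bm.contDiffAt hp)]
  have hE : dt E p = curl H p := sub_eq_zero.1 (h.ampere p hp)
  have hH : dt H p = - dt m p - curl E p := eq_sub_of_add_eq (h.faraday p hp)
  rw [h.dt_energyDensity hp, Finset.sum_congr rfl fun i _ => hfl i, ← hv, hE, hH]
  simp only [lap, inner_add_right, inner_sum, Finset.sum_add_distrib, ← Finset.mul_sum, mul_add,
    real_inner_comm (dt m p)]
  simp only [Fin.sum_univ_three, inner_eq, curl]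
  simp
  ring

end IsSmoothSolution

/-- A smooth integrable weight on `ℝ³`, converging to `1` as `κ → 0`. -/
def polyWeight (κ : ℝ) (x : R3) : ℝ := ((1 + κ ^ 2 * ‖x‖ ^ 2) ^ 2)⁻¹

namespace polyWeight

variable {κ : ℝ}

lemma base_pos (κ : ℝ) (x : R3) : 0 < 1 + κ ^ 2 * ‖x‖ ^ 2 := by positivity

lemma pos (κ : ℝ) (x : R3) : 0 < polyWeight κ x := by
  have := base_pos κ x
  unfold polyWeight; positivity

lemma le_one (κ : ℝ) (x : R3) : polyWeight κ x ≤ 1 := by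
  unfold polyWeight
  apply inv_le_one_of_one_le₀
  apply one_le_pow₀
  have : 0 ≤ κ ^ 2 * ‖x‖ ^ 2 := by positivity
  linarith

lemma smooth (κ : ℝ) : ContDiff ℝ ∞ (polyWeight κ) := by
  refine ContDiff.inv ?_ fun x => by have := base_pos κ x; positivity
  exact (contDiff_const.add (contDiff_const.mul (contDiff_norm_sq ℝ))).pow 2

lemma sd_eq (κ : ℝ) (i : Fin 3) (x : R3) :
    sd i (polyWeight κ) x
      = - (4 * κ ^ 2 * x i) * (1 + κ ^ 2 * ‖x‖ ^ 2)⁻¹ * polyWeight κ x := by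
  have hb := base_pos κ x
  have h1 : HasFDerivAt (fun y : R3 => ‖y‖ ^ 2) (2 • innerSL ℝ x) x :=
    (hasStrictFDerivAt_norm_sq x).hasFDerivAt
  have h2 := (hasDerivAt_inv (show (1 + κ ^ 2 * ‖x‖ ^ 2) ^ 2 ≠ 0 by positivity)).comp_hasFDerivAt x
    (((h1.const_mul (κ ^ 2)).const_add 1).pow 2)
  have h3 : HasFDerivAt (polyWeight κ) _ x := h2
  rw [sd, h3.fderiv]
  have hx : inner ℝ x (e i) = x i := by simp [e, EuclideanSpace.inner_single_right]
  simp [polyWeight, hx]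
  field_simp
  ring

/-- From `2 κ |x| ≤ 1 + κ² |x|²`. The gradient is small relative to the weight itself, so flux terms
can be absorbed by the energy carrying the same weight before any integrability is known. -/
lemma abs_sd_le (hκ : 0 ≤ κ) (i : Fin 3) (x : R3) :
    |sd i (polyWeight κ) x| ≤ 2 * κ * polyWeight κ x := by
  have hb := base_pos κ x
  have hp := pos κ x
  rw [sd_eq, abs_mul, abs_of_pos hp]
  gcongr
  rw [abs_mul, abs_neg, abs_of_pos (inv_pos.2 hb), ← div_eq_mul_inv, div_le_iff₀ hb]
  have hx : |x i| ≤ ‖x‖ := PiLp.norm_apply_le x i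
  rw [abs_mul, abs_of_nonneg (by positivity)]
  nlinarith [mul_nonneg hκ (sq_nonneg (1 - κ * ‖x‖)), mul_le_mul_of_nonneg_left hx
    (show 0 ≤ 4 * κ ^ 2 by positivity)]

/-- The decay is `|x|⁻⁴`, integrable in dimension three. -/
lemma integrable (hκ : κ ≠ 0) : Integrable (polyWeight κ) := by
  have h1 : Integrable (fun x : R3 => (1 + ‖x‖ ^ 2) ^ (-(4 : ℝ) / 2)) :=
    integrable_rpow_neg_one_add_norm_sq (by simp; norm_num)
  refine (h1.comp_smul hκ).congr (ae_of_all _ fun x => ?_)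
  have hb := base_pos κ x
  simp only [polyWeight, norm_smul, mul_pow, Real.norm_eq_abs, sq_abs]
  rw [show -(4 : ℝ) / 2 = -2 by norm_num, Real.rpow_neg hb.le]
  norm_num

lemma integrable_sd (hκ : 0 < κ) (i : Fin 3) : Integrable (sd i (polyWeight κ)) := by
  refine ((integrable hκ.ne').const_mul (2 * κ)).mono' ?_
    (ae_of_all _ fun x => abs_sd_le hκ.le i x)
  exact (((smooth κ).continuous_fderiv (by simp)).clm_apply continuous_const).aestronglyMeasurable

lemma tendsto_one {κ : ℕ → ℝ} (h : Tendsto κ atTop (𝓝 0)) (x : R3) :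
    Tendsto (fun n => polyWeight (κ n) x) atTop (𝓝 1) := by
  have hc : Continuous fun k : ℝ => polyWeight k x := by
    unfold polyWeight
    refine Continuous.inv₀ (by fun_prop) fun k => by have := base_pos k x; positivity
  have := (hc.tendsto 0).comp h
  simpa [polyWeight, Function.comp_def] using this

end polyWeight

namespace IsSmoothSolution

variable {T S lam : ℝ} {ζ : ℝ → ℝ} {m₀ E₀ H₀ : R3 → R3} {m E H : ST → R3}

/-- Weighted sum of the energy and of the dissipation. -/
def weightedEnergy (ζ : ℝ → ℝ) (E H : ST → R3) (g : Fin 3 → ST → R3) (v : ST → R3) (p : ST) : ℝ :=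
  - deriv ζ p.1 * energyDensity E H g p + ζ p.1 * ‖v p‖ ^ 2

lemma weightedEnergy_nonneg (hζ : IsTimeWeight S lam ζ) (hl : 0 ≤ lam) (E H : ST → R3)
    (g : Fin 3 → ST → R3) (v : ST → R3) {p : ST} (hp : p ∈ slab S) :
    0 ≤ weightedEnergy ζ E H g v p := by
  have h1 := hζ.neg_deriv_nonneg hl (mem_slab.1 hp).1 (mem_slab.1 hp).2
  have h2 := hζ.nonneg p.1
  have h3 := energyDensity_nonneg E H g p
  unfold weightedEnergy
  positivity

/-- Pointwise control of the flux by energy plus dissipation, obtained from `2ab ≤ a² + b²`. -/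
lemma abs_flux_le (m E H : ST → R3) (i : Fin 3) (p : ST) :
    2 * |flux m E H i p| ≤ energyDensity E H (fun i => dx i m) p + ‖dt m p‖ ^ 2 := by
  have h1 : |cross (H p) (E p) i| ≤ ‖H p‖ * ‖E p‖ :=
    (PiLp.norm_apply_le (cross (H p) (E p)) i).trans (norm_cross_le _ _)
  have h2 : |inner ℝ (dx i m p) (dt m p)| ≤ ‖dx i m p‖ * ‖dt m p‖ := abs_real_inner_le_norm _ _
  have h3 : ‖dx i m p‖ ^ 2 ≤ ∑ j, ‖dx j m p‖ ^ 2 :=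
    Finset.single_le_sum (f := fun j => ‖dx j m p‖ ^ 2) (fun j _ => by positivity)
      (Finset.mem_univ i)
  have h4 := abs_add_le (cross (H p) (E p) i) (inner ℝ (dx i m p) (dt m p))
  unfold flux energyDensity
  nlinarith [sq_nonneg (‖H p‖ - ‖E p‖), sq_nonneg (‖dx i m p‖ - ‖dt m p‖)]

lemma tendsto_energy (h : IsSmoothSolution T m₀ E₀ H₀ m E H) (hd : IsSmoothData m₀ E₀ H₀)
    (hT : 0 < T) (x : R3) :
    Tendsto (fun t : ℝ => energyDensity E H (fun i => dx i m) (t, x)) (𝓝[>] 0)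
      (𝓝 (energy₀ m₀ E₀ H₀ x)) :=
  (((h.smooth_E.initial x).norm.pow 2).add ((h.smooth_H.initial x).norm.pow 2)).add
    (tendsto_finsetSum _ fun i _ => (h.smooth_m.tendsto_dx hT hd.smooth_m i x).norm.pow 2)

/-- The energy balance is multiplied by `ζ χ` and integrated by parts. The weight `χ` makes all
integrals finite for bounded fields, and the error is the flux against `∇χ`, at most a fraction `6κ`
of the left side. -/
lemma weighted_energy_le (h : IsSmoothSolution T m₀ E₀ H₀ m E H) (hd : IsSmoothData m₀ E₀ H₀)
    (hS : 0 < S) (hST : S < T) (hζ : IsTimeWeight S lam ζ) (hl : 1 ≤ lam) {κ : ℝ} (hκ : 0 < κ) :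
    IntegrableOn (fun p => polyWeight κ p.2
        * weightedEnergy ζ E H (fun i => dx i m) (dt m) p) (slab S) ∧
    (1 - 6 * κ) * (∫ p in slab S, polyWeight κ p.2
        * weightedEnergy ζ E H (fun i => dx i m) (dt m) p)
      ≤ ζ 0 * ∫ x, energy₀ m₀ E₀ H₀ x := by
  set χ := polyWeight κ with hχ
  set W := weightedEnergy ζ E H (fun i => dx i m) (dt m) with hW
  set ed := energyDensity E H (fun i => dx i m) with hed
  have hb := h.bddSmooth_energyDensity
  have hχi : Integrable χ := polyWeight.integrable hκ.ne'
  have hχd := polyWeight.integrable_sd hκ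
  have hbv : BddSmooth T (fun p => ‖dt m p‖ ^ 2) := bddSmooth_normSq h.bm.dt
  have hIW : IntegrableOn (fun p => χ p.2 * W p) (slab S) := by
    refine ((hb.integrableOn_slab hST hχi hζ.continuous_deriv.neg).add
      (hbv.integrableOn_slab hST hχi hζ.smooth.continuous)).congr (ae_of_all _ fun p => ?_)
    simp only [Pi.add_apply, Pi.neg_apply, hW, weightedEnergy]; ring
  refine ⟨hIW, ?_⟩
  have hT := hS.trans hST
  have e1 := integral_slab_dt hb hS hST (h.tendsto_energy hd hT) hχi hζ
  have e2 := fun i => integral_slab_dx (h.bddSmooth_flux i) hST i (polyWeight.smooth κ) hχi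
    (hχd i) hζ.smooth.continuous
  have hI1 : IntegrableOn (fun p : ST => χ p.2 * (- deriv ζ p.1 * ed p - ζ p.1 * dt ed p))
      (slab S) := by
    refine ((hb.integrableOn_slab hST hχi hζ.continuous_deriv.neg).sub
      (hb.dt.integrableOn_slab hST hχi hζ.smooth.continuous)).congr (ae_of_all _ fun p => ?_)
    simp only [Pi.sub_apply, Pi.neg_apply]; ring
  have hI2 : ∀ i, IntegrableOn (fun p : ST => ζ p.1 * (χ p.2 * dx i (flux m E H i) p
      + sd i χ p.2 * flux m E H i p)) (slab S) := by
    intro i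
    refine ((((h.bddSmooth_flux i).dx i).integrableOn_slab hST hχi hζ.smooth.continuous).add
      ((h.bddSmooth_flux i).integrableOn_slab hST (hχd i) hζ.smooth.continuous)).congr
      (ae_of_all _ fun p => ?_)
    simp only [Pi.add_apply]; ring
  have e3 : ∫ p in slab S, (χ p.2 * (- deriv ζ p.1 * ed p - ζ p.1 * dt ed p)
      + 2 * ∑ i, ζ p.1 * (χ p.2 * dx i (flux m E H i) p + sd i χ p.2 * flux m E H i p))
      = ζ 0 * ∫ x, χ x * energy₀ m₀ E₀ H₀ x := by
    rw [integral_add hI1 ((integrable_finsetSum _ fun i _ => hI2 i).const_mul 2),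
      integral_const_mul, integral_finsetSum _ fun i _ => hI2 i, e1,
      Finset.sum_eq_zero fun i _ => e2 i, mul_zero, add_zero]
  have hle : ∫ p in slab S, (1 - 6 * κ) * (χ p.2 * W p) ≤
      ∫ p in slab S, (χ p.2 * (- deriv ζ p.1 * ed p - ζ p.1 * dt ed p)
      + 2 * ∑ i, ζ p.1 * (χ p.2 * dx i (flux m E H i) p + sd i χ p.2 * flux m E H i p)) := by
    refine setIntegral_mono_on (hIW.const_mul _) (hI1.add ((integrable_finsetSum _
      fun i _ => hI2 i).const_mul 2)) (isOpen_slab S).measurableSet fun p hp => ?_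
    have hbal := h.energy_balance (slab_mono hST.le hp)
    have hz := hζ.nonneg p.1
    -- Since `lam ≥ 1`, one has `ζ ≤ -ζ'`, so the energy part of `W` also dominates `ζ` times the
    -- energy.
    have hw : ζ p.1 * (ed p + ‖dt m p‖ ^ 2) ≤ W p := by
      have h1 := hζ.decay p.1 (mem_slab.1 hp).1 (mem_slab.1 hp).2
      have h2 : ζ p.1 ≤ - deriv ζ p.1 := by nlinarith
      have h3 := mul_le_mul_of_nonneg_right h2 (energyDensity_nonneg E H (fun i => dx i m) p)
      simp only [hW, weightedEnergy, mul_add]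
      linarith
    have hfl : ∀ i, - (2 * κ * (χ p.2 * W p)) ≤ 2 * (ζ p.1 * (sd i χ p.2 * flux m E H i p)) := by
      intro i
      have h1 := polyWeight.abs_sd_le hκ.le i p.2
      have h2 := abs_flux_le m E H i p
      have hχp := (polyWeight.pos κ p.2).le
      have h3 : |2 * (ζ p.1 * (sd i χ p.2 * flux m E H i p))| ≤ 2 * κ * (χ p.2 * W p) := by
        calc |2 * (ζ p.1 * (sd i χ p.2 * flux m E H i p))|
            = |sd i χ p.2| * (ζ p.1 * (2 * |flux m E H i p|)) := by
              rw [abs_mul, abs_mul, abs_mul, abs_of_nonneg hz, abs_two]; ring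
          _ ≤ (2 * κ * χ p.2) * (ζ p.1 * (ed p + ‖dt m p‖ ^ 2)) := by gcongr
          _ ≤ (2 * κ * χ p.2) * W p := by gcongr
          _ = _ := by ring
      exact neg_le_of_abs_le h3
    -- Each of the three directions costs `2κ`.
    have hs : - (6 * κ * (χ p.2 * W p)) ≤ 2 * ∑ i, ζ p.1 * (sd i χ p.2 * flux m E H i p) := by
      rw [Fin.sum_univ_three]
      linarith [hfl 0, hfl 1, hfl 2]
    have hexp : χ p.2 * (- deriv ζ p.1 * ed p - ζ p.1 * dt ed p)
        + 2 * ∑ i, ζ p.1 * (χ p.2 * dx i (flux m E H i) p + sd i χ p.2 * flux m E H i p)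
        = χ p.2 * W p + 2 * ∑ i, ζ p.1 * (sd i χ p.2 * flux m E H i p) := by
      rw [Fin.sum_univ_three] at hbal ⊢
      rw [Fin.sum_univ_three]
      simp only [hW, weightedEnergy]
      linear_combination (-(χ p.2 * ζ p.1)) * hbal
    rw [hexp]
    linarith
  rw [integral_const_mul] at hle
  rw [e3] at hle
  refine hle.trans ?_
  refine mul_le_mul_of_nonneg_left ?_ (hζ.nonneg 0)
  have hn : ∀ x, 0 ≤ energy₀ m₀ E₀ H₀ x := fun x => by unfold energy₀; positivity
  refine integral_mono_of_nonneg (ae_of_all _ fun x => mul_nonneg (polyWeight.pos κ x).le (hn x))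
    hd.integrable_energy₀ (ae_of_all _ fun x => ?_)
  exact mul_le_of_le_one_left (hn x) (polyWeight.le_one κ x)

/-- The energy inequality for smooth solutions. -/
theorem energy_le (h : IsSmoothSolution T m₀ E₀ H₀ m E H) (hd : IsSmoothData m₀ E₀ H₀)
    (hS : 0 < S) (hST : S < T) (hζ : IsTimeWeight S lam ζ) (hl : 1 ≤ lam) :
    IntegrableOn (weightedEnergy ζ E H (fun i => dx i m) (dt m)) (slab S) ∧
    ∫ p in slab S, weightedEnergy ζ E H (fun i => dx i m) (dt m) p
      ≤ ζ 0 * ∫ x, energy₀ m₀ E₀ H₀ x := by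
  set W := weightedEnergy ζ E H (fun i => dx i m) (dt m) with hW
  set A := ζ 0 * ∫ x, energy₀ m₀ E₀ H₀ x with hA
  have hm := (isOpen_slab S).measurableSet
  have hWc : ContinuousOn W (slab S) := by
    have h1 := h.bddSmooth_energyDensity.continuousOn.mono (slab_mono hST.le)
    have h2 := h.bm.dt.continuousOn.mono (slab_mono hST.le)
    exact ((hζ.continuous_deriv.neg.comp continuous_fst).continuousOn.mul h1).add
      ((hζ.smooth.continuous.comp continuous_fst).continuousOn.mul (h2.norm.pow 2))
  have hWm : AEStronglyMeasurable W (volume.restrict (slab S)) := hWc.aestronglyMeasurable hm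
  have hW0 : 0 ≤ᵐ[volume.restrict (slab S)] W := by
    filter_upwards [ae_restrict_mem hm] with p hp
    exact weightedEnergy_nonneg hζ (by linarith) _ _ _ _ hp
  let κ : ℕ → ℝ := fun n => 1 / ((n : ℝ) + 1)
  have hκ : ∀ n, 0 < κ n := fun n => by positivity
  have hκ0 : Tendsto κ atTop (𝓝 0) := tendsto_one_div_add_atTop_nhds_zero_nat
  -- Fatou's lemma as `κ → 0`. Working with lower integrals yields the finiteness of the limiting
  -- energy along with its bound.
  have hF : ∫⁻ p in slab S, ENNReal.ofReal (W p) ≤ ENNReal.ofReal A := by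
    have h1 : ∫⁻ p in slab S, ENNReal.ofReal (W p)
        = ∫⁻ p in slab S, liminf (fun n => ENNReal.ofReal (polyWeight (κ n) p.2 * W p)) atTop := by
      refine lintegral_congr fun p => ?_
      refine (Tendsto.liminf_eq ?_).symm
      refine (ENNReal.continuous_ofReal.tendsto _).comp ?_
      simpa using (polyWeight.tendsto_one hκ0 p.2).mul_const (W p)
    rw [h1]
    refine (lintegral_liminf_le' fun n => ?_).trans ?_
    · exact (((polyWeight.smooth (κ n)).continuous.comp
        continuous_snd).aestronglyMeasurable.mul hWm).aemeasurable.ennreal_ofReal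
    · have h2 : Tendsto (fun n => ENNReal.ofReal (A / (1 - 6 * κ n))) atTop
          (𝓝 (ENNReal.ofReal A)) := by
        refine (ENNReal.continuous_ofReal.tendsto _).comp ?_
        have h3 : Tendsto (fun n => 1 - 6 * κ n) atTop (𝓝 (1 - 6 * 0)) :=
          tendsto_const_nhds.sub (hκ0.const_mul 6)
        have h4 : Tendsto (fun n => A / (1 - 6 * κ n)) atTop (𝓝 (A / (1 - 6 * 0))) :=
          tendsto_const_nhds.div h3 (by norm_num)
        simpa using h4
      rw [← h2.liminf_eq]
      refine liminf_le_liminf ?_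
      filter_upwards [hκ0.eventually_lt_const (show (0 : ℝ) < 1 / 6 by norm_num)] with n hn
      obtain ⟨hi, hle⟩ := h.weighted_energy_le hd hS hST hζ hl (hκ n)
      rw [← ofReal_integral_eq_lintegral_ofReal hi]
      · apply ENNReal.ofReal_le_ofReal
        rw [le_div_iff₀ (by linarith), mul_comm]
        exact hle
      · filter_upwards [hW0] with p hp
        exact mul_nonneg (polyWeight.pos _ _).le hp
  have hint : IntegrableOn W (slab S) := by
    refine ⟨hWm, ?_⟩
    rw [hasFiniteIntegral_iff_ofReal hW0]
    exact hF.trans_lt ENNReal.ofReal_lt_top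
  refine ⟨hint, ?_⟩
  have hA0 : 0 ≤ A := mul_nonneg (hζ.nonneg 0)
    (integral_nonneg fun x => by unfold energy₀; positivity)
  rw [← ofReal_integral_eq_lintegral_ofReal hint hW0] at hF
  exact (ENNReal.ofReal_le_ofReal_iff hA0).1 hF

end IsSmoothSolution

lemma sq_norm_le_of_energyDensity {E H : ST → R3} {g : Fin 3 → ST → R3} {p : ST} :
    ‖E p‖ ^ 2 ≤ energyDensity E H g p ∧ ‖H p‖ ^ 2 ≤ energyDensity E H g p ∧
      ∀ i, ‖g i p‖ ^ 2 ≤ energyDensity E H g p := by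
  have h3 : ∀ i, ‖g i p‖ ^ 2 ≤ ∑ j, ‖g j p‖ ^ 2 := fun i =>
    Finset.single_le_sum (f := fun j => ‖g j p‖ ^ 2) (fun j _ => by positivity)
      (Finset.mem_univ i)
  have h4 : 0 ≤ ∑ j, ‖g j p‖ ^ 2 := Finset.sum_nonneg fun j _ => by positivity
  unfold energyDensity
  refine ⟨?_, ?_, fun i => ?_⟩
  · nlinarith [sq_nonneg ‖H p‖]
  · nlinarith [sq_nonneg ‖E p‖]
  · nlinarith [sq_nonneg ‖H p‖, sq_nonneg ‖E p‖, h3 i]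

namespace IsSmoothSolution

variable {T S : ℝ} {m₀ E₀ H₀ : R3 → R3} {m E H : ST → R3}

/-- A weight that vanishes at a later time `S' < T` is bounded below on `[0, S]`, and so is `-ζ' ≥
ζ` there. The weighted energy thus dominates the plain squares up to a constant. -/
lemma memLp_slab (h : IsSmoothSolution T m₀ E₀ H₀ m E H) (hd : IsSmoothData m₀ E₀ H₀)
    (hS : 0 < S) (hST : S < T) :
    MemLp E 2 (volume.restrict (slab S)) ∧ MemLp H 2 (volume.restrict (slab S)) ∧
      (∀ i, MemLp (dx i m) 2 (volume.restrict (slab S))) ∧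
      MemLp (dt m) 2 (volume.restrict (slab S)) := by
  obtain ⟨S', hSS', hST'⟩ := exists_between hST
  obtain ⟨ζ, hζ⟩ := exists_isTimeWeight (hS.trans hSS') one_pos
  obtain ⟨t₀, ht₀, hmin⟩ := (isCompact_Icc (a := 0) (b := S)).exists_isMinOn
    ⟨0, left_mem_Icc.2 hS.le⟩ hζ.smooth.continuous.continuousOn
  have hc : 0 < ζ t₀ := hζ.pos t₀ (ht₀.2.trans_lt hSS')
  have hI := (h.energy_le hd (hS.trans hSS') hST' hζ le_rfl).1.mono_set (slab_mono hSS'.le)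
  have hm := (isOpen_slab S).measurableSet
  have key : ∀ {u : ST → R3}, BddSmooth T u → (∀ p, ‖u p‖ ^ 2
      ≤ energyDensity E H (fun i => dx i m) p + ‖dt m p‖ ^ 2) →
      MemLp u 2 (volume.restrict (slab S)) := by
    intro u hu hle
    have hum : AEStronglyMeasurable u (volume.restrict (slab S)) :=
      (hu.continuousOn.mono (slab_mono hST.le)).aestronglyMeasurable hm
    rw [memLp_two_iff_integrable_sq_norm hum]
    refine (hI.const_mul (ζ t₀)⁻¹).mono' (hum.norm.pow 2) ?_
    filter_upwards [ae_restrict_mem hm] with p hp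
    rw [Real.norm_of_nonneg (by positivity), inv_mul_eq_div, le_div_iff₀ hc]
    have hp1 := (mem_slab.1 hp).1
    have hp2 := (mem_slab.1 hp).2
    have h1 : ζ t₀ ≤ ζ p.1 := hmin ⟨hp1.le, hp2.le⟩
    have h2 := hζ.decay p.1 hp1 (hp2.trans hSS')
    have he := energyDensity_nonneg E H (fun i => dx i m) p
    have h3 : ζ t₀ * energyDensity E H (fun i => dx i m) p
        ≤ - deriv ζ p.1 * energyDensity E H (fun i => dx i m) p :=
      mul_le_mul_of_nonneg_right (by linarith) he
    have h4 : ζ t₀ * ‖dt m p‖ ^ 2 ≤ ζ p.1 * ‖dt m p‖ ^ 2 :=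
      mul_le_mul_of_nonneg_right h1 (by positivity)
    have h5 := mul_le_mul_of_nonneg_left (hle p) hc.le
    unfold weightedEnergy
    nlinarith
  have hle := fun p => sq_norm_le_of_energyDensity (E := E) (H := H) (g := fun i => dx i m) (p := p)
  have h0 : ∀ p, 0 ≤ ‖dt m p‖ ^ 2 := fun p => by positivity
  refine ⟨key h.bE fun p => ?_, key h.bH fun p => ?_, fun i => key (h.bm.dx i) fun p => ?_,
    key h.bm.dt fun p => ?_⟩
  · linarith [(hle p).1, h0 p]
  · linarith [(hle p).2.1, h0 p]
  · linarith [(hle p).2.2 i, h0 p]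
  · linarith [energyDensity_nonneg E H (fun i => dx i m) p]

end IsSmoothSolution

/-! ### Weighted energy inequality of the weak solution. -/

namespace IsTimeWeight

variable {S lam : ℝ} {ζ : ℝ → ℝ}

lemma lintegral_neg_deriv (hζ : IsTimeWeight S lam ζ) (hl : 0 ≤ lam) {s : ℝ} (hs : 0 ≤ s)
    (hsS : s ≤ S) : ∫⁻ t in Ioo s S, ENNReal.ofReal (- deriv ζ t) = ENNReal.ofReal (ζ s) := by
  have hint : IntegrableOn (fun t => - deriv ζ t) (Ioo s S) :=
    (hζ.continuous_deriv.neg.continuousOn.integrableOn_compact (isCompact_Icc (a := s)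
      (b := S))).mono_set Ioo_subset_Icc_self
  rw [← ofReal_integral_eq_lintegral_ofReal hint, ← integral_Ioc_eq_integral_Ioo,
    ← intervalIntegral.integral_of_le hsS, hζ.integral_neg_deriv]
  filter_upwards [ae_restrict_mem measurableSet_Ioo] with t ht
  exact hζ.neg_deriv_nonneg hl (hs.trans_lt ht.1) ht.2

/-- Tonelli on the triangle `s < t < S`, with `∫ₛ^S -ζ' = ζ(s)`. -/
lemma lintegral_layer (hζ : IsTimeWeight S lam ζ) (hl : 0 ≤ lam) {g : ℝ → ℝ≥0∞}
    (hg : AEMeasurable g (volume.restrict (Ioo 0 S))) :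
    ∫⁻ t in Ioo 0 S, ENNReal.ofReal (- deriv ζ t) * ∫⁻ s in Ioo 0 t, g s
      = ∫⁻ s in Ioo 0 S, ENNReal.ofReal (ζ s) * g s := by
  have hmd : Measurable fun t => ENNReal.ofReal (- deriv ζ t) :=
    hζ.continuous_deriv.neg.measurable.ennreal_ofReal
  have h1 : ∀ t ∈ Ioo 0 S, ENNReal.ofReal (- deriv ζ t) * ∫⁻ s in Ioo 0 t, g s
      = ∫⁻ s in Ioo 0 S, (Iio t).indicator (fun s => ENNReal.ofReal (- deriv ζ t) * g s) s := by
    intro t ht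
    rw [lintegral_indicator measurableSet_Iio, Measure.restrict_restrict measurableSet_Iio,
      show Iio t ∩ Ioo 0 S = Ioo 0 t by
        ext s; simp only [mem_inter_iff, mem_Iio, mem_Ioo]
        exact ⟨fun h => ⟨h.2.1, h.1⟩, fun h => ⟨h.2, h.1, h.2.trans ht.2⟩⟩,
      lintegral_const_mul'' _ (hg.mono_measure
        (Measure.restrict_mono (Ioo_subset_Ioo_right ht.2.le) le_rfl))]
  rw [setLIntegral_congr_fun measurableSet_Ioo h1, lintegral_lintegral_swap]
  · refine setLIntegral_congr_fun measurableSet_Ioo fun s hs => ?_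
    have h2 : ∀ t, (Iio t).indicator (fun s => ENNReal.ofReal (- deriv ζ t) * g s) s
        = (Ioi s).indicator (fun t => ENNReal.ofReal (- deriv ζ t) * g s) t := by
      intro t
      by_cases hst : s < t <;> simp [hst]
    simp_rw [h2]
    rw [lintegral_indicator measurableSet_Ioi, Measure.restrict_restrict measurableSet_Ioi,
      show Ioi s ∩ Ioo 0 S = Ioo s S by
        ext t; simp only [mem_inter_iff, mem_Ioi, mem_Ioo]
        exact ⟨fun h => ⟨h.1, h.2.2⟩, fun h => ⟨h.1, hs.1.trans h.1, h.2⟩⟩,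
      lintegral_mul_const _ hmd, hζ.lintegral_neg_deriv hl hs.1.le hs.2.le]
  · have h3 : (Function.uncurry fun t s => (Iio t).indicator
        (fun s => ENNReal.ofReal (- deriv ζ t) * g s) s)
        = {q : ℝ × ℝ | q.2 < q.1}.indicator
          (fun q => ENNReal.ofReal (- deriv ζ q.1) * g q.2) := by
      ext ⟨t, s⟩
      by_cases hst : s < t <;> simp [hst]
    rw [h3]
    refine AEMeasurable.indicator ?_ (measurableSet_lt measurable_snd measurable_fst)
    exact (hmd.comp measurable_fst).aemeasurable.mul hg.comp_snd

end IsTimeWeight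

lemma ofReal_norm_sq (a : R3) : ENNReal.ofReal (‖a‖ ^ 2) = ‖a‖ₑ ^ 2 := by
  rw [ENNReal.ofReal_pow (norm_nonneg _), ofReal_norm]

lemma ofReal_energy (a b : R3) (c : Fin 3 → R3) :
    ENNReal.ofReal (‖a‖ ^ 2 + ‖b‖ ^ 2 + ∑ i, ‖c i‖ ^ 2)
      = ‖a‖ₑ ^ 2 + ‖b‖ₑ ^ 2 + ∑ i, ‖c i‖ₑ ^ 2 := by
  rw [ENNReal.ofReal_add (by positivity) (Finset.sum_nonneg fun i _ => by positivity),
    ENNReal.ofReal_add (by positivity) (by positivity),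
    ENNReal.ofReal_sum_of_nonneg fun i _ => by positivity]
  simp only [ofReal_norm_sq]

namespace IsWeakSolutionWith

open IsSmoothSolution

variable {S lam : ℝ} {ζ : ℝ → ℝ} {m₀ E₀ H₀ : R3 → R3} {m E H mt : ST → R3}
  {G : Fin 3 → ST → R3}

/-- The energy inequality at time `t`, valid for almost every `t`, is multiplied by `-ζ'(t) ≥ 0` and
integrated over `(0, S)`; no value of the energy at a given time is needed. -/
lemma energy_le (W : IsWeakSolutionWith m₀ E₀ H₀ m E H mt G) (hd : IsSmoothData m₀ E₀ H₀)
    (hS : 0 < S) (hζ : IsTimeWeight S lam ζ) (hl : 0 ≤ lam) :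
    IntegrableOn (weightedEnergy ζ E H G mt) (slab S) ∧
    ∫ p in slab S, weightedEnergy ζ E H G mt p ≤ ζ 0 * ∫ x, energy₀ m₀ E₀ H₀ x := by
  have hms := (isOpen_slab S).measurableSet
  have mE := (W.class_E.memLp S).1
  have mH := (W.class_H.memLp S).1
  have mG := fun i => ((W.grad_m i).memLp S).1
  have mv := (W.memLp_mt S hS).1
  have med : AEStronglyMeasurable (energyDensity E H G) (volume.restrict (slab S)) :=
    ((mE.norm.pow 2).add (mH.norm.pow 2)).add
      (Finset.aestronglyMeasurable_fun_sum _ fun i _ => (mG i).norm.pow 2)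
  have mW : AEStronglyMeasurable (weightedEnergy ζ E H G mt) (volume.restrict (slab S)) :=
    ((hζ.continuous_deriv.neg.comp continuous_fst).aestronglyMeasurable.mul med).add
      ((hζ.smooth.continuous.comp continuous_fst).aestronglyMeasurable.mul (mv.norm.pow 2))
  have hW0 : 0 ≤ᵐ[volume.restrict (slab S)] weightedEnergy ζ E H G mt := by
    filter_upwards [ae_restrict_mem hms] with p hp
    exact weightedEnergy_nonneg hζ hl _ _ _ _ hp
  have hA : ∫⁻ x : R3, (‖E₀ x‖ₑ ^ 2 + ‖H₀ x‖ₑ ^ 2 + ∑ i, ‖pd i m₀ x‖ₑ ^ 2)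
      = ENNReal.ofReal (∫ x, energy₀ m₀ E₀ H₀ x) := by
    rw [ofReal_integral_eq_lintegral_ofReal hd.integrable_energy₀
      (ae_of_all _ fun x => by unfold energy₀; positivity)]
    exact lintegral_congr fun x => (ofReal_energy _ _ _).symm
  have hmd : Measurable fun t => ENNReal.ofReal (- deriv ζ t) :=
    hζ.continuous_deriv.neg.measurable.ennreal_ofReal
  have mz : Measurable fun t => ENNReal.ofReal (ζ t) :=
    hζ.smooth.continuous.measurable.ennreal_ofReal
  have me : AEMeasurable (fun p => ENNReal.ofReal (energyDensity E H G p))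
    (volume.restrict (slab S)) := med.aemeasurable.ennreal_ofReal
  have mv2 : AEMeasurable (fun p => ‖mt p‖ₑ ^ 2) (volume.restrict (slab S)) :=
    mv.enorm.pow_const 2
  have n1 : AEMeasurable (fun p : ST => ENNReal.ofReal (- deriv ζ p.1)
      * ENNReal.ofReal (energyDensity E H G p)) (volume.restrict (slab S)) :=
    (hmd.comp measurable_fst).aemeasurable.mul me
  have n2 : AEMeasurable (fun p : ST => ENNReal.ofReal (ζ p.1) * ‖mt p‖ₑ ^ 2)
      (volume.restrict (slab S)) := (mz.comp measurable_fst).aemeasurable.mul mv2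
  have hF : ∫⁻ p in slab S, ENNReal.ofReal (weightedEnergy ζ E H G mt p)
      ≤ ENNReal.ofReal (ζ 0 * ∫ x, energy₀ m₀ E₀ H₀ x) := by
    have h1 : ∫⁻ p in slab S, ENNReal.ofReal (weightedEnergy ζ E H G mt p)
        = (∫⁻ p in slab S, ENNReal.ofReal (- deriv ζ p.1) * ENNReal.ofReal (energyDensity E H G p))
          + ∫⁻ p in slab S, ENNReal.ofReal (ζ p.1) * ‖mt p‖ₑ ^ 2 := by
      rw [← lintegral_add_left' n1]
      refine setLIntegral_congr_fun hms fun p hp => ?_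
      have hn := hζ.neg_deriv_nonneg hl (mem_slab.1 hp).1 (mem_slab.1 hp).2
      have he := energyDensity_nonneg E H G p
      have hz := hζ.nonneg p.1
      rw [weightedEnergy, ENNReal.ofReal_add (by positivity) (by positivity),
        ENNReal.ofReal_mul hn, ENNReal.ofReal_mul hz, ofReal_norm_sq]
    rw [h1, lintegral_slab S n1, lintegral_slab S n2]
    have me' := me
    have mv2' := mv2
    rw [volume_restrict_slab] at me' mv2'
    -- The weight `ζ` on the dissipation is the average of the dissipation up to time `t` against
    -- `-ζ'`.
    have h2 : ∫⁻ t in Ioo 0 S, ∫⁻ x : R3, ENNReal.ofReal (ζ t) * ‖mt (t, x)‖ₑ ^ 2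
        = ∫⁻ t in Ioo 0 S, ENNReal.ofReal (- deriv ζ t) *
          ∫⁻ s in Ioo 0 t, ∫⁻ x : R3, ‖mt (s, x)‖ₑ ^ 2 := by
      rw [hζ.lintegral_layer hl mv2'.lintegral_prod_right']
      refine lintegral_congr fun t => lintegral_const_mul' _ _ ENNReal.ofReal_ne_top
    have h3 : ∫⁻ t in Ioo 0 S, ∫⁻ x : R3, ENNReal.ofReal (- deriv ζ t)
          * ENNReal.ofReal (energyDensity E H G (t, x))
        = ∫⁻ t in Ioo 0 S, ENNReal.ofReal (- deriv ζ t) *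
          ∫⁻ x : R3, (‖E (t, x)‖ₑ ^ 2 + ‖H (t, x)‖ₑ ^ 2 + ∑ i, ‖G i (t, x)‖ₑ ^ 2) := by
      refine lintegral_congr fun t => ?_
      rw [lintegral_const_mul' _ _ ENNReal.ofReal_ne_top]
      congr 1
      exact lintegral_congr fun x => ofReal_energy _ _ _
    have m3 : AEMeasurable (fun t => ENNReal.ofReal (- deriv ζ t) *
        ∫⁻ x : R3, (‖E (t, x)‖ₑ ^ 2 + ‖H (t, x)‖ₑ ^ 2 + ∑ i, ‖G i (t, x)‖ₑ ^ 2))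
        (volume.restrict (Ioo 0 S)) := by
      refine hmd.aemeasurable.mul (me'.lintegral_prod_right'.congr (ae_of_all _ fun t => ?_))
      exact lintegral_congr fun x => ofReal_energy _ _ _
    dsimp only
    rw [h2, h3, ← lintegral_add_left' m3]
    calc _ ≤ ∫⁻ t in Ioo 0 S, ENNReal.ofReal (- deriv ζ t)
            * ENNReal.ofReal (∫ x, energy₀ m₀ E₀ H₀ x) := by
          refine lintegral_mono_ae ?_
          filter_upwards [ae_restrict_of_ae_restrict_of_subset
            (Ioo_subset_Ioi_self : Ioo 0 S ⊆ Ioi 0) W.energy] with t ht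
          rw [← mul_add, ← hA]
          gcongr
      _ = _ := by
          rw [lintegral_mul_const _ hmd, hζ.lintegral_neg_deriv hl le_rfl hS.le,
            ENNReal.ofReal_mul (hζ.nonneg 0)]
  have hint : IntegrableOn (weightedEnergy ζ E H G mt) (slab S) := by
    refine ⟨mW, ?_⟩
    rw [hasFiniteIntegral_iff_ofReal hW0]
    exact hF.trans_lt ENNReal.ofReal_lt_top
  refine ⟨hint, ?_⟩
  rw [← ofReal_integral_eq_lintegral_ofReal hint hW0] at hF
  exact (ENNReal.ofReal_le_ofReal_iff (mul_nonneg (hζ.nonneg 0)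
    (integral_nonneg fun x => by unfold energy₀; positivity))).1 hF

end IsWeakSolutionWith

/-! ### Absolute continuity in time of the weak magnetization, and its orthogonality to its time
derivative. -/

lemma ae_slab_swap {S : ℝ} {P : ST → Prop} (h : ∀ᵐ p ∂(volume.restrict (slab S)), P p) :
    ∀ᵐ x : R3, ∀ᵐ t ∂(volume.restrict (Ioo 0 S)), P (t, x) := by
  rw [volume_restrict_slab] at h
  have h1 := (Measure.measurePreserving_swap (μ := (volume : Measure R3))
    (ν := (volume : Measure ℝ).restrict (Ioo 0 S))).quasiMeasurePreserving.ae h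
  exact Measure.ae_ae_of_ae_prod h1

/-- The part of the slab above a ball. -/
def cyl (S R : ℝ) : Set ST := Ioo 0 S ×ˢ Metric.ball (0 : R3) R

lemma isOpen_cyl (S R : ℝ) : IsOpen (cyl S R) := isOpen_Ioo.prod Metric.isOpen_ball

lemma cyl_subset_slab (S R : ℝ) : cyl S R ⊆ slab S := prod_mono_right (subset_univ _)

lemma volume_restrict_cyl (S R : ℝ) : (volume : Measure ST).restrict (cyl S R)
    = ((volume : Measure ℝ).restrict (Ioo 0 S)).prod
      ((volume : Measure R3).restrict (Metric.ball 0 R)) := by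
  rw [cyl, Measure.volume_eq_prod, ← Measure.prod_restrict]

lemma volume_cyl_lt_top (S R : ℝ) : (volume : Measure ST) (cyl S R) < ⊤ := by
  rw [cyl, Measure.volume_eq_prod, Measure.prod_prod, Real.volume_Ioo]
  exact ENNReal.mul_lt_top ENNReal.ofReal_lt_top measure_ball_lt_top

/-- The primitive in time. -/
def primitive (a : ST → ℝ) (p : ST) : ℝ := ∫ s in Ioo 0 p.1, a (s, p.2)

lemma ae_integrableOn_slice {F : Type} [NormedAddCommGroup F] {S : ℝ} {a : ST → F} (ha : ∀ R, IntegrableOn a (cyl S R)) :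
    ∀ᵐ x : R3, IntegrableOn (fun t => a (t, x)) (Ioo 0 S) := by
  have h1 : ∀ n : ℕ, ∀ᵐ x : R3, x ∈ Metric.ball (0 : R3) n →
      IntegrableOn (fun t => a (t, x)) (Ioo 0 S) := by
    intro n
    have h := ha n
    rw [IntegrableOn, volume_restrict_cyl] at h
    exact (ae_restrict_iff' measurableSet_ball).1 h.prod_left_ae
  filter_upwards [ae_all_iff.2 h1] with x hx
  obtain ⟨n, hn⟩ := exists_nat_gt ‖x‖
  exact hx n (by simpa using hn)

lemma stronglyMeasurable_primitive {a : ST → ℝ} (ha : StronglyMeasurable a) :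
    StronglyMeasurable (primitive a) := by
  have h1 : primitive a = fun p : ST => ∫ s, {q : ST × ℝ | 0 < q.2 ∧ q.2 < q.1.1}.indicator
      (fun q => a (q.2, q.1.2)) (p, s) := by
    ext p
    rw [primitive, ← integral_indicator measurableSet_Ioo]
    rfl
  rw [h1]
  refine StronglyMeasurable.integral_prod_right' ?_
  refine StronglyMeasurable.indicator (ha.comp_measurable (by fun_prop)) ?_
  exact (measurableSet_lt measurable_const measurable_snd).inter
    (measurableSet_lt measurable_snd (measurable_fst.comp measurable_fst))

lemma abs_primitive_le {S : ℝ} {a : ST → ℝ} {p : ST} (hp : p.1 ≤ S)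
    (ha : IntegrableOn (fun t => a (t, p.2)) (Ioo 0 S)) :
    |primitive a p| ≤ ∫ s in Ioo 0 S, ‖a (s, p.2)‖ :=
  (norm_integral_le_integral_norm _).trans
    (setIntegral_mono_set ha.norm (ae_of_all _ fun _ => norm_nonneg _)
      (Ioo_subset_Ioo_right hp).eventuallyLE)

lemma integrableOn_primitive {S : ℝ} {a : ST → ℝ} (ham : StronglyMeasurable a)
    (ha : ∀ R, IntegrableOn a (cyl S R)) (R : ℝ) : IntegrableOn (primitive a) (cyl S R) := by
  have h := ha R
  have hi := ha R
  rw [IntegrableOn, volume_restrict_cyl] at hi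
  have h2 : Integrable (fun p : ST => (1 : ℝ) * ∫ s in Ioo 0 S, ‖a (s, p.2)‖)
      (volume.restrict (cyl S R)) := by
    rw [volume_restrict_cyl]
    exact (integrable_const (1 : ℝ)).mul_prod hi.integral_norm_prod_right
  refine h2.mono' (stronglyMeasurable_primitive ham).aestronglyMeasurable ?_
  have hae : ∀ᵐ p ∂(volume.restrict (cyl S R)), IntegrableOn (fun t => a (t, p.2)) (Ioo 0 S) := by
    rw [volume_restrict_cyl]
    exact Measure.quasiMeasurePreserving_snd.ae (ae_restrict_of_ae (ae_integrableOn_slice ha))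
  filter_upwards [hae, ae_restrict_mem (isOpen_cyl S R).measurableSet] with p hp hm
  rw [one_mul]
  exact abs_primitive_le hm.1.2.le hp

/-- Fubini on the triangle `t < s`: the tail integral and the primitive are adjoint to each other.
-/
lemma integral_tail_mul {S : ℝ} {f g : ℝ → ℝ} (hf : IntegrableOn f (Ioo 0 S))
    (hg : Continuous g) (hgS : ∀ s, S ≤ s → g s = 0) :
    ∫ t in Ioo 0 S, (∫ s in Ioi t, g s) * f t = ∫ s in Ioo 0 S, g s * ∫ t in Ioo 0 s, f t := by
  have hgi : IntegrableOn g (Ioo 0 S) :=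
    (hg.continuousOn.integrableOn_compact (isCompact_Icc (a := 0) (b := S))).mono_set
      Ioo_subset_Icc_self
  have hI : Integrable (Function.uncurry fun t s => (Ioi t).indicator g s * f t)
      ((volume.restrict (Ioo 0 S)).prod (volume.restrict (Ioo 0 S))) := by
    have h1 : (Function.uncurry fun t s => (Ioi t).indicator g s * f t)
        = {q : ℝ × ℝ | q.1 < q.2}.indicator (fun q => f q.1 * g q.2) := by
      ext ⟨t, s⟩
      by_cases hst : t < s <;> simp [hst, mul_comm]
    rw [h1]
    exact (hf.mul_prod hgi).indicator (measurableSet_lt measurable_fst measurable_snd)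
  have h1 : ∀ t ∈ Ioo 0 S, (∫ s in Ioi t, g s) * f t
      = ∫ s in Ioo 0 S, (Ioi t).indicator g s * f t := by
    intro t ht
    rw [integral_mul_const, setIntegral_indicator measurableSet_Ioi]
    congr 1
    refine setIntegral_eq_of_subset_of_forall_sdiff_eq_zero measurableSet_Ioi
      (fun s hs => hs.2) fun s hs => hgS s ?_
    by_contra! hlt
    exact hs.2 ⟨⟨ht.1.trans hs.1, hlt⟩, hs.1⟩
  rw [setIntegral_congr_fun measurableSet_Ioo h1, integral_integral_swap hI]
  refine setIntegral_congr_fun measurableSet_Ioo fun s hs => ?_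
  have h2 : ∀ t, (Ioi t).indicator g s * f t = g s * (Iio s).indicator f t := by
    intro t
    by_cases hst : t < s <;> simp [hst]
  simp_rw [h2]
  rw [integral_const_mul, setIntegral_indicator measurableSet_Iio]
  congr 2
  have : Ioo 0 S ∩ Iio s = Ioo 0 s := by
    ext t; simp only [mem_inter_iff, mem_Iio, mem_Ioo]
    exact ⟨fun h => ⟨h.1.1, h.2⟩, fun h => ⟨⟨h.1, h.2.trans hs.2⟩, h.2⟩⟩
  rw [this]

/-- The integral over later times. -/
def tail (g : ST → ℝ) (p : ST) : ℝ := ∫ s in Ioi p.1, g (s, p.2)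

section Tail

variable {g : ST → ℝ}

lemma hasCompactSupport_time_slice (hc : HasCompactSupport g) (x : R3) :
    HasCompactSupport fun t : ℝ => g (t, x) :=
  HasCompactSupport.of_support_subset_isCompact (hc.isCompact.image continuous_fst)
    fun t ht => ⟨(t, x), subset_tsupport _ ht, rfl⟩

/-- The tail is the convolution in time of `g` with the indicator of `(-∞, 0]`, with `x` as a
parameter. -/
lemma contDiff_tail (hg : ContDiff ℝ ∞ g) (hc : HasCompactSupport g) : ContDiff ℝ ∞ (tail g) := by
  have h1 : LocallyIntegrable ((Iic (0 : ℝ)).indicator fun _ => (1 : ℝ)) volume :=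
    (locallyIntegrable_const (1 : ℝ)).indicator measurableSet_Iic
  have h2 := contDiffOn_convolution_right_with_param (μ := volume) (n := ⊤)
    (ContinuousLinearMap.lsmul ℝ ℝ) (g := fun (x : R3) (t : ℝ) => g (t, x)) (s := univ)
    (k := Prod.fst '' tsupport g) isOpen_univ (hc.isCompact.image continuous_fst)
    (fun x t _ ht => by
      by_contra h0
      exact ht ⟨(t, x), subset_tsupport _ h0, rfl⟩) h1
    ((hg.comp (contDiff_snd.prodMk contDiff_fst)).contDiffOn)
  rw [univ_prod_univ, contDiffOn_univ] at h2
  have h3 : tail g = fun p : ST => (fun q : R3 × ℝ => (convolution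
      ((Iic (0 : ℝ)).indicator fun _ => (1 : ℝ)) (fun t : ℝ => g (t, q.1))
      (ContinuousLinearMap.lsmul ℝ ℝ) volume) q.2) (p.2, p.1) := by
    ext ⟨t, x⟩
    simp only [tail, convolution_eq_swap]
    rw [← integral_Ici_eq_integral_Ioi, ← integral_indicator measurableSet_Ici]
    congr 1
    ext s
    by_cases hs : t ≤ s <;> simp [hs]
  rw [h3]
  exact h2.comp (contDiff_snd.prodMk contDiff_fst)

lemma hasDerivAt_tail (hg : Continuous g) (hc : HasCompactSupport g) (t : ℝ) (x : R3) :
    HasDerivAt (fun s => tail g (s, x)) (- g (t, x)) t := by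
  have hcont : Continuous fun s : ℝ => g (s, x) := hg.comp (by fun_prop)
  have hi : Integrable fun s : ℝ => g (s, x) :=
    hcont.integrable_of_hasCompactSupport (hasCompactSupport_time_slice hc x)
  have h1 : (fun s => tail g (s, x)) = fun s => (∫ r in s..0, g (r, x)) + tail g (0, x) := by
    ext s
    exact (intervalIntegral.integral_interval_add_Ioi hi.integrableOn hi.integrableOn).symm
  rw [h1]
  exact (intervalIntegral.integral_hasDerivAt_left (hcont.intervalIntegrable _ _)
    (hcont.stronglyMeasurableAtFilter _ _) hcont.continuousAt).add_const _

lemma dt_tail (hg : ContDiff ℝ ∞ g) (hc : HasCompactSupport g) (p : ST) : dt (tail g) p = - g p :=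
  (hasDerivAt_time ((contDiff_tail hg hc).differentiable (by simp) p)).unique
    (hasDerivAt_tail hg.continuous hc p.1 p.2)

variable {S : ℝ}

lemma eq_zero_of_tsupport_subset_slab (hs : tsupport g ⊆ slab S) {p : ST} (hp : p ∉ slab S) :
    g p = 0 := by
  by_contra h0
  exact hp (hs (subset_tsupport _ h0))

lemma tail_eq_zero (hs : tsupport g ⊆ slab S) {p : ST} (hp : S ≤ p.1) : tail g p = 0 :=
  setIntegral_eq_zero_of_forall_eq_zero fun s hs' =>
    eq_zero_of_tsupport_subset_slab hs fun h => by
      have := (mem_slab.1 h).2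
      have h2 : p.1 < s := hs'
      linarith

/-- A test function whose time derivative is `-g` in the future. -/
def tailTest (g : ST → ℝ) (c : R3) (p : ST) : R3 := (Real.smoothTransition (p.1 + 2) * tail g p) • c

lemma tailTest_eq (c : R3) {p : ST} (hp : -1 ≤ p.1) : tailTest g c p = tail g p • c := by
  rw [tailTest, Real.smoothTransition.one_of_one_le (by linarith), one_mul]

/-- The tail need not vanish for negative times, so it is cut off between `t = -2` and `t = -1`;
nothing changes on `t ≥ 0`, including the initial slice. -/
lemma isTest_tailTest (hg : ContDiff ℝ ∞ g) (hc : HasCompactSupport g)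
    (hs : tsupport g ⊆ slab S) (c : R3) : IsTest (tailTest g c) := by
  refine ⟨?_, ?_⟩
  · exact ((Real.smoothTransition.contDiff.comp (by fun_prop : ContDiff ℝ ∞
      fun p : ST => p.1 + 2)).mul (contDiff_tail hg hc)).smul contDiff_const
  · refine HasCompactSupport.of_support_subset_isCompact ((isCompact_Icc (a := -2) (b := S)).prod
      (hc.isCompact.image continuous_snd)) fun p hp => ?_
    have h1 : Real.smoothTransition (p.1 + 2) ≠ 0 := fun h => hp (by simp [tailTest, h])
    have h2 : tail g p ≠ 0 := fun h => hp (by simp [tailTest, h])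
    refine ⟨⟨?_, ?_⟩, ?_⟩
    · by_contra! hlt
      exact h1 (Real.smoothTransition.zero_of_nonpos (by linarith))
    · by_contra! hlt
      exact h2 (tail_eq_zero hs hlt.le)
    · by_contra hx
      refine h2 (setIntegral_eq_zero_of_forall_eq_zero fun s _ => ?_)
      by_contra h0
      exact hx ⟨(s, p.2), subset_tsupport _ h0, rfl⟩

lemma dt_tailTest (hg : ContDiff ℝ ∞ g) (hc : HasCompactSupport g) (c : R3) {p : ST}
    (hp : p ∈ future) : dt (tailTest g c) p = -(g p • c) := by
  have h1 : tailTest g c =ᶠ[𝓝 p] fun q => tail g q • c := by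
    filter_upwards [isOpen_future.mem_nhds hp] with q hq
    exact tailTest_eq c (by linarith [mem_future.1 hq])
  have h2 : HasFDerivAt (fun q => tail g q • c) ((fderiv ℝ (tail g) p).smulRight c) p :=
    (((contDiff_tail hg hc).differentiable (by simp) p).hasFDerivAt).smul_const c
  have h3 := dt_tail hg hc p
  rw [dt] at h3
  rw [dt, h1.fderiv_eq, h2.fderiv, ContinuousLinearMap.smulRight_apply, h3, neg_smul]

end Tail

lemma integrableOn_mul_of_support {S R : ℝ} {b f : ST → ℝ} (hb : Continuous b)
    (hR : ∀ p : ST, R ≤ ‖p.2‖ → b p = 0) (hf : IntegrableOn f (cyl S R)) :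
    IntegrableOn (fun p => b p * f p) (slab S) := by
  obtain ⟨C, hC⟩ := ((isCompact_Icc (a := 0) (b := S)).prod
    (isCompact_closedBall (0 : R3) R)).exists_bound_of_continuousOn hb.continuousOn
  have h1 : IntegrableOn (fun p => b p * f p) (cyl S R) := by
    refine hf.bdd_mul (c := C) hb.aestronglyMeasurable ?_
    filter_upwards [ae_restrict_mem (isOpen_cyl S R).measurableSet] with p hp
    exact hC p ⟨Ioo_subset_Icc_self hp.1, Metric.ball_subset_closedBall hp.2⟩
  refine h1.of_forall_sdiff_eq_zero (isOpen_slab S).measurableSet fun p hp => ?_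
  rw [hR p, zero_mul]
  by_contra! hlt
  exact hp.2 ⟨hp.1.1, by simpa using hlt⟩

lemma integrableOn_cyl_snd {u₀ : R3 → ℝ} (h : Continuous u₀) (S R : ℝ) :
    IntegrableOn (fun p : ST => u₀ p.2) (cyl S R) := by
  have h1 : IntegrableOn u₀ (Metric.ball 0 R) :=
    (h.continuousOn.integrableOn_compact (isCompact_closedBall (0 : R3) R)).mono_set
      Metric.ball_subset_closedBall
  have h2 : Integrable (fun p : ST => (1 : ℝ) * u₀ p.2) (volume.restrict (cyl S R)) := by
    rw [volume_restrict_cyl]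
    exact (integrable_const (1 : ℝ)).mul_prod h1
  simpa [IntegrableOn] using h2

/-- By the fundamental lemma of the calculus of variations it suffices to integrate against each `g`
supported in the slab. Fubini moves the primitive of `a` to the tail of `g`, and the integral of `g`
over all times is the tail at `t = 0`; the hypothesis `H` is then the required identity. -/
lemma eq_add_primitive {S : ℝ} {u a : ST → ℝ} {u₀ : R3 → ℝ}
    (hu : ∀ R, IntegrableOn u (cyl S R)) (ham : StronglyMeasurable a)
    (ha : ∀ R, IntegrableOn a (cyl S R)) (hu₀ : Continuous u₀)
    (H : ∀ g : ST → ℝ, ContDiff ℝ ∞ g → HasCompactSupport g → tsupport g ⊆ slab S →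
      ∫ p in slab S, g p * u p
        = (∫ x, tail g (0, x) * u₀ x) + ∫ p in slab S, tail g p * a p) :
    ∀ᵐ p ∂(volume.restrict (slab S)), u p = u₀ p.2 + primitive a p := by
  have hint : ∀ R, IntegrableOn (fun p => u p - u₀ p.2 - primitive a p) (cyl S R) := fun R =>
    ((hu R).sub (integrableOn_cyl_snd hu₀ S R)).sub (integrableOn_primitive ham ha R)
  have hloc : LocallyIntegrableOn (fun p => u p - u₀ p.2 - primitive a p) (slab S) := by
    intro p hp
    refine ⟨cyl S (‖p.2‖ + 1), mem_nhdsWithin_of_mem_nhds ((isOpen_cyl _ _).mem_nhds ?_), hint _⟩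
    exact ⟨hp.1, by simp⟩
  have key := (isOpen_slab S).ae_eq_zero_of_integral_contDiff_smul_eq_zero hloc ?_
  · rw [ae_restrict_iff' (isOpen_slab S).measurableSet]
    filter_upwards [key] with p hp hm
    linarith [hp hm]
  intro g hg hc hs
  obtain ⟨R, hR⟩ : ∃ R : ℝ, ∀ p : ST, R ≤ ‖p.2‖ → g p = 0 := by
    obtain ⟨R, hR⟩ := hc.isCompact.isBounded.subset_ball (0 : ST)
    refine ⟨R, fun p hp => ?_⟩
    by_contra h0
    have h1 := hR (subset_tsupport _ h0)
    rw [mem_ball_zero_iff] at h1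
    linarith [norm_snd_le p]
  have hRt : ∀ p : ST, R ≤ ‖p.2‖ → tail g p = 0 := fun p hp =>
    setIntegral_eq_zero_of_forall_eq_zero fun s _ => hR _ hp
  have i1 := integrableOn_mul_of_support hg.continuous hR (hu R)
  have i2 := integrableOn_mul_of_support hg.continuous hR (integrableOn_cyl_snd hu₀ S R)
  have i3 := integrableOn_mul_of_support hg.continuous hR (integrableOn_primitive ham ha R)
  have i4 := integrableOn_mul_of_support (contDiff_tail hg hc).continuous hRt (ha R)
  have e0 : ∫ p, g p • (u p - u₀ p.2 - primitive a p)
      = ∫ p in slab S, (g p * u p - g p * u₀ p.2 - g p * primitive a p) := by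
    rw [← setIntegral_eq_integral_of_forall_compl_eq_zero (s := slab S)]
    · refine integral_congr_ae (ae_of_all _ fun p => ?_)
      simp only [smul_eq_mul]; ring
    · intro p hp
      rw [eq_zero_of_tsupport_subset_slab hs hp, zero_smul]
  have e2 : ∫ p in slab S, g p * u₀ p.2 = ∫ x, tail g (0, x) * u₀ x := by
    rw [IntegrableOn, volume_restrict_slab] at i2
    rw [volume_restrict_slab, integral_prod_symm _ i2]
    refine integral_congr_ae (ae_of_all _ fun x => ?_)
    dsimp only
    rw [integral_mul_const]
    congr 1
    symm
    refine setIntegral_eq_of_subset_of_forall_sdiff_eq_zero measurableSet_Ioi (fun s hs => hs.1)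
      fun s hs' => eq_zero_of_tsupport_subset_slab hs fun h => hs'.2 (mem_slab.1 h)
  have e3 : ∫ p in slab S, g p * primitive a p = ∫ p in slab S, tail g p * a p := by
    rw [IntegrableOn, volume_restrict_slab] at i3 i4
    rw [volume_restrict_slab, integral_prod_symm _ i3, integral_prod_symm _ i4]
    refine integral_congr_ae ?_
    filter_upwards [ae_integrableOn_slice ha] with x hx
    refine (integral_tail_mul hx (g := fun s => g (s, x)) (hg.continuous.comp (by fun_prop))
      fun s hs' => ?_).symm
    exact eq_zero_of_tsupport_subset_slab hs fun h => by
      have := (mem_slab.1 h).2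
      dsimp only at this
      linarith
  have i12 : IntegrableOn (fun p => g p * u p - g p * u₀ p.2) (slab S) := i1.sub i2
  rw [e0, integral_sub i12 i3, integral_sub i1 i2, e2, e3, H g hg hc hs]
  ring

lemma integrableOn_cyl_of_memLp {S : ℝ} {f : ST → R3} (hf : MemLp f 2 (volume.restrict (slab S)))
    (R : ℝ) : IntegrableOn f (cyl S R) := by
  have : IsFiniteMeasure (volume.restrict (cyl S R)) :=
    ⟨by rw [Measure.restrict_apply_univ]; exact volume_cyl_lt_top S R⟩
  exact (hf.mono_measure (Measure.restrict_mono (cyl_subset_slab S R) le_rfl)).integrable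
    (by norm_num)

namespace IsWeakSolutionWith

variable {S : ℝ} {m₀ E₀ H₀ : R3 → R3} {m E H mt : ST → R3} {G : Fin 3 → ST → R3}

/-- The weak time derivative formula is tested with the tail of `g`, whose time derivative is `-g`.
The strongly measurable representative `v` of `mt` makes the primitive measurable. -/
lemma component_eq_primitive (W : IsWeakSolutionWith m₀ E₀ H₀ m E H mt G) (hm₀ : Continuous m₀)
    (hS : 0 < S) (c : R3) {v : ST → R3} (hv : StronglyMeasurable v)
    (hvm : mt =ᵐ[volume.restrict (slab S)] v) :
    ∀ᵐ p ∂(volume.restrict (slab S)),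
      inner ℝ (m p) c = inner ℝ (m₀ p.2) c + primitive (fun q => inner ℝ (v q) c) p := by
  have hv2 : MemLp v 2 (volume.restrict (slab S)) := (memLp_congr_ae hvm).1 (W.memLp_mt S hS)
  refine eq_add_primitive (u := fun p => inner ℝ (m p) c) (u₀ := fun x => inner ℝ (m₀ x) c)
    (fun R => ?_) (hv.inner stronglyMeasurable_const)
    (fun R => (integrableOn_cyl_of_memLp hv2 R).inner_const c) (hm₀.inner continuous_const)
    fun g hg hc hs => ?_
  · have : IsFiniteMeasure (volume.restrict (cyl S R)) :=
      ⟨by rw [Measure.restrict_apply_univ]; exact volume_cyl_lt_top S R⟩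
    refine Integrable.inner_const ?_ c
    refine Integrable.of_bound ((W.meas_m_slab S).mono_measure
      (Measure.restrict_mono (cyl_subset_slab S R) le_rfl)) 1 ?_
    filter_upwards [ae_restrict_of_ae_restrict_of_subset (cyl_subset_slab S R)
      (W.norm_m_slab S)] with p hp
    exact hp.le
  · have h1 := W.weak_dt _ (isTest_tailTest hg hc hs c)
    have hfut := isOpen_future.measurableSet
    rw [setIntegral_congr_fun hfut (g := fun p => - (g p * inner ℝ (m p) c))
        (fun p hp => by
          simp only [dt_tailTest hg hc c hp, inner_neg_right, real_inner_smul_right]),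
      setIntegral_congr_fun hfut (g := fun p => tail g p * inner ℝ (mt p) c)
        (f := fun p => inner ℝ (mt p) (tailTest g c p))
        (fun p hp => by
          simp only [tailTest_eq c (by linarith [mem_future.1 hp] : -1 ≤ p.1),
            real_inner_smul_right]),
      integral_neg, setIntegral_future_eq_slab (S := S), setIntegral_future_eq_slab (S := S)] at h1
    · have h2 : ∫ x, inner ℝ (m₀ x) (tailTest g c (0, x))
          = ∫ x, tail g (0, x) * inner ℝ (m₀ x) c := by
        refine integral_congr_ae (ae_of_all _ fun x => ?_)
        simp only [tailTest_eq c (by norm_num : (-1 : ℝ) ≤ ((0, x) : ST).1), real_inner_smul_right]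
      have h3 : ∫ p in slab S, tail g p * inner ℝ (v p) c
          = ∫ p in slab S, tail g p * inner ℝ (mt p) c := by
        refine integral_congr_ae ?_
        filter_upwards [hvm] with p hp
        rw [hp]
      rw [h2] at h1
      rw [h3]
      linarith
    · intro p hp
      rw [tail_eq_zero hs hp.le, zero_mul]
    · intro p hp
      rw [eq_zero_of_tsupport_subset_slab hs (fun h => by linarith [(mem_slab.1 h).2]), zero_mul]

/-- On almost every line `x = const`, the magnetization is the primitive of `∂ₜ m`. -/
lemma ae_eq_integral (W : IsWeakSolutionWith m₀ E₀ H₀ m E H mt G) (hm₀ : Continuous m₀)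
    (hS : 0 < S) :
    ∀ᵐ x : R3, IntegrableOn (fun t => mt (t, x)) (Ioo 0 S) ∧
      ∀ᵐ t ∂(volume.restrict (Ioo 0 S)), m (t, x) = m₀ x + ∫ s in Ioo 0 t, mt (s, x) := by
  obtain ⟨v, hv, hvm⟩ := (W.memLp_mt S hS).1
  have h1 : ∀ i : Fin 3, ∀ᵐ x : R3, ∀ᵐ t ∂(volume.restrict (Ioo 0 S)),
      inner ℝ (m (t, x)) (e i) = inner ℝ (m₀ x) (e i)
        + primitive (fun q => inner ℝ (v q) (e i)) (t, x) := fun i =>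
    ae_slab_swap (W.component_eq_primitive hm₀ hS (e i) hv hvm)
  have h2 := ae_integrableOn_slice (integrableOn_cyl_of_memLp (W.memLp_mt S hS))
  filter_upwards [ae_all_iff.2 h1, h2, ae_slab_swap hvm] with x hx1 hx2 hx3
  refine ⟨hx2, ?_⟩
  filter_upwards [ae_all_iff.2 hx1, ae_restrict_mem measurableSet_Ioo] with t ht hts
  have hsub : Ioo 0 t ⊆ Ioo 0 S := Ioo_subset_Ioo_right hts.2.le
  have hproj : ∀ i, inner ℝ (∫ s in Ioo 0 t, mt (s, x)) (e i)
      = primitive (fun q => inner ℝ (v q) (e i)) (t, x) := by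
    intro i
    rw [real_inner_comm, ← integral_inner (hx2.mono_set hsub), primitive]
    refine integral_congr_ae ?_
    filter_upwards [ae_restrict_of_ae_restrict_of_subset hsub hx3] with s hs
    rw [hs, real_inner_comm]
  have hcoord : ∀ (a : R3) i, inner ℝ a (e i) = a i := fun a i => by
    simp [e, EuclideanSpace.inner_single_right]
  ext i
  rw [← hcoord, ← hcoord, inner_add_left, hproj, ht i]

/-- `m · ∂ₜ m = 0`. -/
lemma inner_m_mt (W : IsWeakSolutionWith m₀ E₀ H₀ m E H mt G) (hm₀ : Continuous m₀)
    (hS : 0 < S) : ∀ᵐ p ∂(volume.restrict (slab S)), inner ℝ (m p) (mt p) = 0 := by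
  have hmeas : AEMeasurable (fun p => ‖inner ℝ (m p) (mt p)‖ₑ)
      (((volume : Measure ℝ).restrict (Ioo 0 S)).prod (volume : Measure R3)) := by
    rw [← volume_restrict_slab]
    exact ((W.meas_m_slab S).inner (W.memLp_mt S hS).1).enorm
  have hz : ∫⁻ p in slab S, ‖inner ℝ (m p) (mt p)‖ₑ = 0 := by
    rw [volume_restrict_slab, lintegral_prod_symm _ hmeas]
    refine (lintegral_congr_ae (g := fun _ => 0) ?_).trans lintegral_zero
    filter_upwards [W.ae_eq_integral hm₀ hS, ae_slab_swap (W.norm_m_slab S)] with x ⟨hx1, hx2⟩ hx3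
    refine (lintegral_congr_ae (g := fun _ => 0) ?_).trans lintegral_zero
    have hII : IntervalIntegrable (fun t => mt (t, x)) volume 0 S := by
      rwa [intervalIntegrable_iff_integrableOn_Ioo_of_le hS.le]
    set φ : ℝ → R3 := fun t => m₀ x + ∫ s in (0 : ℝ)..t, mt (s, x) with hφ
    have hφm : ∀ᵐ t ∂(volume.restrict (Ioo 0 S)), m (t, x) = φ t := by
      filter_upwards [hx2, ae_restrict_mem measurableSet_Ioo] with t ht hts
      rw [ht, hφ]
      simp only
      rw [intervalIntegral.integral_of_le hts.1.le, integral_Ioc_eq_integral_Ioo]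
    have hcont : ContinuousOn φ (Icc 0 S) := by
      refine continuousOn_const.add ?_
      have := intervalIntegral.continuousOn_primitive_interval' hII left_mem_uIcc
      rwa [uIcc_of_le hS.le] at this
    -- The continuous representative `φ` has unit norm almost everywhere, hence everywhere.
    have hone : EqOn (fun t => inner ℝ (φ t) (φ t)) (fun _ => (1 : ℝ)) (Ioo 0 S) := by
      have hc := hcont.mono Ioo_subset_Icc_self
      refine Measure.eqOn_open_of_ae_eq (μ := volume) ?_ isOpen_Ioo (hc.inner hc) continuousOn_const
      filter_upwards [hφm, hx3] with t ht1 ht2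
      rw [← ht1, real_inner_self_eq_norm_sq, ht2, one_pow]
    -- By Lebesgue's differentiation theorem `φ` has derivative `mt` at almost every time;
    -- differentiating the constant `|φ|² = 1` gives orthogonality.
    filter_upwards [hφm, ae_restrict_of_ae hII.ae_hasDerivAt_integral,
      ae_restrict_mem measurableSet_Ioo] with t ht1 ht2 hts
    have hd : HasDerivAt φ (mt (t, x)) t :=
      (ht2 (by rw [uIcc_of_le hS.le]; exact Ioo_subset_Icc_self hts) 0 left_mem_uIcc).const_add _
    have hd2 := hd.inner ℝ hd
    have hd3 : HasDerivAt (fun t => inner ℝ (φ t) (φ t)) 0 t := by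
      refine (hasDerivAt_const t (1 : ℝ)).congr_of_eventuallyEq ?_
      filter_upwards [isOpen_Ioo.mem_nhds hts] with s hs using hone hs
    have := hd2.unique hd3
    rw [real_inner_comm (φ t)] at this
    rw [ht1, show inner ℝ (φ t) (mt (t, x)) = 0 by linarith, enorm_zero]
  rw [lintegral_eq_zero_iff' (by rw [volume_restrict_slab]; exact hmeas)] at hz
  filter_upwards [hz] with p hp
  simpa using hp

end IsWeakSolutionWith

/-! ### The difference of the magnetizations controlled by the difference of their time derivatives.
-/

lemma sq_lintegral_le {t : ℝ} {f : ℝ → ℝ≥0∞} (hf : AEMeasurable f (volume.restrict (Ioo 0 t))) :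
    (∫⁻ s in Ioo 0 t, f s) ^ 2 ≤ ENNReal.ofReal t * ∫⁻ s in Ioo 0 t, f s ^ 2 := by
  have h := ENNReal.lintegral_mul_le_Lp_mul_Lq (volume.restrict (Ioo 0 t))
    Real.HolderConjugate.two_two hf (aemeasurable_const (b := (1 : ℝ≥0∞)))
  simp only [Pi.mul_apply, mul_one, ENNReal.rpow_ofNat, one_pow, lintegral_const,
    Measure.restrict_apply_univ, Real.volume_Ioo, sub_zero, one_mul] at h
  have h2 := pow_le_pow_left' h 2
  rw [mul_pow, ← ENNReal.rpow_natCast, ← ENNReal.rpow_natCast, ← ENNReal.rpow_mul,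
    ← ENNReal.rpow_natCast, ← ENNReal.rpow_mul] at h2
  norm_num at h2
  rw [mul_comm]
  exact_mod_cast h2

section Difference

variable {S T lam : ℝ} {ζ : ℝ → ℝ} {m₀ E₀ H₀ : R3 → R3} {m₁ E₁ H₁ m₂ E₂ H₂ mt : ST → R3}
  {G : Fin 3 → ST → R3}

lemma sub_eq_integral (h : IsSmoothSolution T m₀ E₀ H₀ m₁ E₁ H₁) {t : ℝ} (ht : 0 < t)
    (htT : t < T) (x : R3) : m₁ (t, x) = m₀ x + ∫ s in Ioo 0 t, dt m₁ (s, x) := by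
  have hm : ∀ s ∈ Ioc 0 t, (s, x) ∈ slab T := fun s hs =>
    mem_slab.2 ⟨hs.1, hs.2.trans_lt htT⟩
  have hder : ∀ s ∈ Ioc 0 t, HasDerivAt (fun s => m₁ (s, x)) (dt m₁ (s, x)) s := fun s hs =>
    hasDerivAt_time (h.bm.differentiableAt (hm s hs))
  obtain ⟨C, _, hC⟩ := h.bm.dt.exists_bound htT
  rw [← integral_Ioc_eq_integral_Ioo, ← intervalIntegral.integral_of_le ht.le,
    intervalIntegral.integral_eq_sub_of_hasDerivAt_of_tendsto ht
      (fun s hs => hder s (Ioo_subset_Ioc_self hs)) ?_ (h.smooth_m.initial x)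
      ((hder t ⟨ht, le_rfl⟩).continuousAt.tendsto.mono_left nhdsWithin_le_nhds)]
  · abel
  · rw [intervalIntegrable_iff_integrableOn_Ioo_of_le ht.le]
    refine Integrable.of_bound (ContinuousOn.aestronglyMeasurable (fun s hs => ?_)
      measurableSet_Ioo) C ?_
    · exact (hasDerivAt_time (h.bm.dt.differentiableAt
        (hm s (Ioo_subset_Ioc_self hs)))).continuousAt.continuousWithinAt
    · filter_upwards [ae_restrict_mem measurableSet_Ioo] with s hs
      exact hC _ (mem_slab.2 hs)

/-- Both magnetizations start from `m₀`, so their difference is the time integral of the difference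
of the derivatives; Cauchy–Schwarz in time concludes. -/
lemma ae_enorm_sub_sq_le (h : IsSmoothSolution T m₀ E₀ H₀ m₁ E₁ H₁)
    (W : IsWeakSolutionWith m₀ E₀ H₀ m₂ E₂ H₂ mt G) (hm₀ : Continuous m₀)
    (hS : 0 < S) (hST : S < T) :
    ∀ᵐ x : R3, AEMeasurable (fun t => ‖dt m₁ (t, x) - mt (t, x)‖ₑ ^ 2)
        (volume.restrict (Ioo 0 S)) ∧
      ∀ᵐ t ∂(volume.restrict (Ioo 0 S)), ‖m₁ (t, x) - m₂ (t, x)‖ₑ ^ 2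
        ≤ ENNReal.ofReal S * ∫⁻ s in Ioo 0 t, ‖dt m₁ (s, x) - mt (s, x)‖ₑ ^ 2 := by
  obtain ⟨C, _, hC⟩ := h.bm.dt.exists_bound hST
  filter_upwards [W.ae_eq_integral hm₀ hS] with x ⟨hx1, hx2⟩
  have h1 : IntegrableOn (fun t => dt m₁ (t, x)) (Ioo 0 S) := by
    refine Integrable.of_bound (ContinuousOn.aestronglyMeasurable (fun s hs => ?_)
      measurableSet_Ioo) C ?_
    · exact (hasDerivAt_time (h.bm.dt.differentiableAt (slab_mono hST.le
        (mem_slab.2 hs : (s, x) ∈ slab S)))).continuousAt.continuousWithinAt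
    · filter_upwards [ae_restrict_mem measurableSet_Ioo] with s hs
      exact hC _ (mem_slab.2 hs)
  have hm : AEMeasurable (fun t => ‖dt m₁ (t, x) - mt (t, x)‖ₑ) (volume.restrict (Ioo 0 S)) :=
    (h1.sub hx1).aestronglyMeasurable.enorm
  refine ⟨hm.pow_const 2, ?_⟩
  filter_upwards [hx2, ae_restrict_mem measurableSet_Ioo] with t ht hts
  have hsub : Ioo 0 t ⊆ Ioo 0 S := Ioo_subset_Ioo_right hts.2.le
  have heq : m₁ (t, x) - m₂ (t, x) = ∫ s in Ioo 0 t, (dt m₁ (s, x) - mt (s, x)) := by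
    rw [integral_sub (h1.mono_set hsub) (hx1.mono_set hsub),
      sub_eq_integral h hts.1 (hts.2.trans hST) x, ht]
    abel
  rw [heq]
  calc _ ≤ (∫⁻ s in Ioo 0 t, ‖dt m₁ (s, x) - mt (s, x)‖ₑ) ^ 2 := by
        gcongr; exact enorm_integral_le_lintegral_enorm _
    _ ≤ _ := sq_lintegral_le (hm.mono_measure (Measure.restrict_mono hsub le_rfl))
    _ ≤ _ := by gcongr; exact hts.2.le

lemma lintegral_slab_symm (S : ℝ) {f : ST → ℝ≥0∞}
    (hf : AEMeasurable f (volume.restrict (slab S))) :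
    ∫⁻ p in slab S, f p = ∫⁻ x : R3, ∫⁻ t in Ioo 0 S, f (t, x) := by
  rw [volume_restrict_slab] at hf ⊢
  exact lintegral_prod_symm _ hf

/-- The pointwise bound by `S ∫₀ᵗ |∂ₜ(m₁ - m₂)|²` is multiplied by `ζ ≤ -ζ' / lam`, and
`lintegral_layer` turns the result back into an integral with weight `ζ`. The factor `1 / lam` is
what later makes this term absorbable. -/
lemma memLp_sub (h : IsSmoothSolution T m₀ E₀ H₀ m₁ E₁ H₁)
    (W : IsWeakSolutionWith m₀ E₀ H₀ m₂ E₂ H₂ mt G) (hd : IsSmoothData m₀ E₀ H₀)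
    (hS : 0 < S) (hST : S < T) (hζ : IsTimeWeight S lam ζ) (hl : 0 < lam) :
    MemLp (fun p => m₁ p - m₂ p) 2 (volume.restrict (slab S)) ∧
    ∫ p in slab S, ζ p.1 * ‖m₁ p - m₂ p‖ ^ 2
      ≤ S / lam * ∫ p in slab S, ζ p.1 * ‖dt m₁ p - mt p‖ ^ 2 := by
  have hms := (isOpen_slab S).measurableSet
  have hm1 : AEStronglyMeasurable m₁ (volume.restrict (slab S)) :=
    (h.bm.continuousOn.mono (slab_mono hST.le)).aestronglyMeasurable hms
  have hmd : AEStronglyMeasurable (fun p => m₁ p - m₂ p) (volume.restrict (slab S)) :=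
    hm1.sub (W.meas_m_slab S)
  have hLv : MemLp (fun p => dt m₁ p - mt p) 2 (volume.restrict (slab S)) :=
    (h.memLp_slab hd hS hST).2.2.2.sub (W.memLp_mt S hS)
  have hae := ae_enorm_sub_sq_le h W hd.smooth_m.continuous hS hST
  have hfin : ∫⁻ p in slab S, ‖dt m₁ p - mt p‖ₑ ^ 2 < ⊤ := by
    have := hLv.2
    rw [eLpNorm_lt_top_iff_lintegral_rpow_enorm_lt_top (by norm_num) (by norm_num)] at this
    simpa only [ENNReal.toReal_ofNat, ENNReal.rpow_ofNat] using this
  have hLd : MemLp (fun p => m₁ p - m₂ p) 2 (volume.restrict (slab S)) := by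
    refine ⟨hmd, ?_⟩
    rw [eLpNorm_lt_top_iff_lintegral_rpow_enorm_lt_top (by norm_num) (by norm_num)]
    simp only [ENNReal.toReal_ofNat, ENNReal.rpow_ofNat]
    rw [lintegral_slab_symm S (hmd.enorm.pow_const 2)]
    calc ∫⁻ x : R3, ∫⁻ t in Ioo 0 S, ‖m₁ (t, x) - m₂ (t, x)‖ₑ ^ 2
        ≤ ∫⁻ x : R3, ENNReal.ofReal S * ENNReal.ofReal S *
          ∫⁻ s in Ioo 0 S, ‖dt m₁ (s, x) - mt (s, x)‖ₑ ^ 2 := by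
          refine lintegral_mono_ae ?_
          filter_upwards [hae] with x ⟨_, hx⟩
          calc _ ≤ ∫⁻ t in Ioo 0 S, ENNReal.ofReal S *
                ∫⁻ s in Ioo 0 S, ‖dt m₁ (s, x) - mt (s, x)‖ₑ ^ 2 := by
                refine lintegral_mono_ae ?_
                filter_upwards [hx, ae_restrict_mem measurableSet_Ioo] with t ht hts
                refine ht.trans ?_
                gcongr
                exact hts.2.le
            _ = _ := by
                rw [lintegral_const, Measure.restrict_apply_univ, Real.volume_Ioo, sub_zero]
                ring
      _ = ENNReal.ofReal S * ENNReal.ofReal S * ∫⁻ p in slab S, ‖dt m₁ p - mt p‖ₑ ^ 2 := by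
          rw [lintegral_const_mul' _ _ (by finiteness),
            lintegral_slab_symm S (hLv.1.enorm.pow_const 2)]
      _ < ⊤ := ENNReal.mul_lt_top (by finiteness) hfin
  refine ⟨hLd, ?_⟩
  have mz : Measurable fun t => ENNReal.ofReal (ζ t) :=
    hζ.smooth.continuous.measurable.ennreal_ofReal
  have n1 : AEMeasurable (fun p : ST => ENNReal.ofReal (ζ p.1) * ‖m₁ p - m₂ p‖ₑ ^ 2)
      (volume.restrict (slab S)) :=
    (mz.comp measurable_fst).aemeasurable.mul (hmd.enorm.pow_const 2)
  have n2 : AEMeasurable (fun p : ST => ENNReal.ofReal (ζ p.1) * ‖dt m₁ p - mt p‖ₑ ^ 2)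
      (volume.restrict (slab S)) :=
    (mz.comp measurable_fst).aemeasurable.mul (hLv.1.enorm.pow_const 2)
  have key : ∫⁻ p in slab S, ENNReal.ofReal (ζ p.1) * ‖m₁ p - m₂ p‖ₑ ^ 2
      ≤ ENNReal.ofReal (S / lam) *
        ∫⁻ p in slab S, ENNReal.ofReal (ζ p.1) * ‖dt m₁ p - mt p‖ₑ ^ 2 := by
    rw [lintegral_slab_symm S n1, lintegral_slab_symm S n2,
      ← lintegral_const_mul' _ _ ENNReal.ofReal_ne_top]
    refine lintegral_mono_ae ?_
    filter_upwards [hae] with x ⟨hxm, hx⟩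
    rw [← hζ.lintegral_layer hl.le hxm, ← lintegral_const_mul' _ _ ENNReal.ofReal_ne_top]
    refine lintegral_mono_ae ?_
    filter_upwards [hx, ae_restrict_mem measurableSet_Ioo] with t ht hts
    calc ENNReal.ofReal (ζ t) * ‖m₁ (t, x) - m₂ (t, x)‖ₑ ^ 2
        ≤ ENNReal.ofReal (ζ t) * (ENNReal.ofReal S *
          ∫⁻ s in Ioo 0 t, ‖dt m₁ (s, x) - mt (s, x)‖ₑ ^ 2) := by gcongr
      _ = ENNReal.ofReal (S * ζ t) * ∫⁻ s in Ioo 0 t, ‖dt m₁ (s, x) - mt (s, x)‖ₑ ^ 2 := by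
          rw [ENNReal.ofReal_mul hS.le]; ring
      _ ≤ ENNReal.ofReal (S / lam * (- deriv ζ t)) *
          ∫⁻ s in Ioo 0 t, ‖dt m₁ (s, x) - mt (s, x)‖ₑ ^ 2 := by
          refine mul_le_mul' (ENNReal.ofReal_le_ofReal ?_) le_rfl
          rw [div_mul_eq_mul_div, le_div_iff₀ hl]
          nlinarith [hζ.decay t hts.1 hts.2]
      _ = _ := by rw [ENNReal.ofReal_mul (by positivity), mul_assoc]
  obtain ⟨B, hB0, hB⟩ := hζ.exists_bound
  have hint : ∀ {f : ST → R3}, MemLp f 2 (volume.restrict (slab S)) →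
      IntegrableOn (fun p => ζ p.1 * ‖f p‖ ^ 2) (slab S) := by
    intro f hf
    refine ((memLp_two_iff_integrable_sq_norm hf.1).1 hf).bdd_mul (c := B)
      (hζ.smooth.continuous.comp continuous_fst).aestronglyMeasurable ?_
    filter_upwards [ae_restrict_mem hms] with p hp
    exact (hB p.1 (mem_slab.1 hp).1.le (mem_slab.1 hp).2.le).1
  have hconv : ∀ {f : ST → R3}, MemLp f 2 (volume.restrict (slab S)) →
      ∫⁻ p in slab S, ENNReal.ofReal (ζ p.1) * ‖f p‖ₑ ^ 2
        = ENNReal.ofReal (∫ p in slab S, ζ p.1 * ‖f p‖ ^ 2) := by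
    intro f hf
    rw [ofReal_integral_eq_lintegral_ofReal (hint hf)
      (ae_of_all _ fun p => mul_nonneg (hζ.nonneg _) (by positivity))]
    refine lintegral_congr fun p => ?_
    rw [ENNReal.ofReal_mul (hζ.nonneg _), ofReal_norm_sq]
  rw [hconv hLd, hconv hLv, ← ENNReal.ofReal_mul (by positivity)] at key
  refine (ENNReal.ofReal_le_ofReal_iff ?_).1 key
  exact mul_nonneg (by positivity) (integral_nonneg fun p =>
    mul_nonneg (hζ.nonneg _) (by positivity))

end Difference

/-! ### The cross identity, localized in space. -/

section Pairing

variable {ζ : ℝ → ℝ} {θ : R3 → ℝ} {V : ST → R3}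

lemma inner_cross_grad (a b : R3) (θ : R3 → ℝ) (x : R3) :
    inner ℝ a (cross (grad θ x) b) = ∑ i, sd i θ x * inner ℝ a (cross (e i) b) := by
  simp [inner_eq, Fin.sum_univ_three, grad, e]
  ring

/-- The three groups correspond to the derivative falling on `ζ`, on `V` and on `θ`: energy, source
terms and flux. -/
lemma pairing_loc (hζ : ContDiff ℝ ∞ ζ) (hθ : ContDiff ℝ ∞ θ) {p : ST}
    (hV : DifferentiableAt ℝ V p) (a b c : ST → R3) (g : Fin 3 → ST → R3) :
    pairing a b c g (loc ζ θ V) p = θ p.2 * (deriv ζ p.1 * inner ℝ (a p) (V p))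
      + θ p.2 * (ζ p.1 * (inner ℝ (a p) (dt V p) + inner ℝ (b p) (curl V p)
        + inner ℝ (c p) (V p) + ∑ i, inner ℝ (g i p) (dx i V p)))
      + ∑ i, sd i θ p.2 * (ζ p.1 * (inner ℝ (b p) (cross (e i) (V p)) + inner ℝ (g i p) (V p))) := by
  simp only [pairing, dt_loc hζ hθ hV, dx_loc hζ hθ hV, curl_loc hζ hθ hV, inner_add_right,
    real_inner_smul_right, inner_cross_grad, Fin.sum_univ_three]
  simp only [loc, real_inner_smul_right]
  ring

end Pairing

/-- The vector field `-m ∧ ∂ₜ m`. -/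
def spin (m : ST → R3) (p : ST) : R3 := - cross (m p) (dt m p)

/-- The remainder in the cross identity between two solutions. -/
def remainder (m₁ H₁ m₂ H₂ mt : ST → R3) (G : Fin 3 → ST → R3) (p : ST) : ℝ :=
  (1 / 2) * inner ℝ (mt p - dt m₁ p) (cross (m₁ p - m₂ p) (spin m₁ p))
    + inner ℝ (m₁ p) (lap m₁ p + H₁ p) * inner ℝ (m₁ p - m₂ p) (dt m₁ p - mt p)
    - inner ℝ (H₂ p - H₁ p) (cross (m₁ p - m₂ p) (spin m₁ p))
    + ∑ i, inner ℝ (G i p - dx i m₁ p) (cross (m₁ p - m₂ p) (dx i (spin m₁) p))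

/-- The bilinear energy density. -/
def crossEnergy (E₁ H₁ : ST → R3) (g : Fin 3 → ST → R3) (E₂ H₂ : ST → R3) (G : Fin 3 → ST → R3)
    (p : ST) : ℝ :=
  inner ℝ (E₁ p) (E₂ p) + inner ℝ (H₁ p) (H₂ p) + ∑ i, inner ℝ (g i p) (G i p)

/-- The `i`-th component of the flux in the cross identity. -/
def crossFlux (m₁ E₁ H₁ m₂ E₂ H₂ mt : ST → R3) (G : Fin 3 → ST → R3) (i : Fin 3) (p : ST) : ℝ :=
  inner ℝ (E₂ p) (cross (e i) (H₁ p)) - inner ℝ (H₂ p) (cross (e i) (E₁ p))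
    + inner ℝ (mt p) (dx i m₁ p) - inner ℝ (cross (m₂ p) (G i p)) (spin m₁ p)
    + inner ℝ (m₂ p) (cross (dx i m₁ p) (spin m₁ p))
    - inner ℝ (m₁ p) (cross (dx i m₁ p) (spin m₁ p))

namespace IsSmoothSolution

variable {S T lam : ℝ} {ζ : ℝ → ℝ} {θ : R3 → ℝ} {m₀ E₀ H₀ : R3 → R3} {m E H : ST → R3} {p : ST}

lemma bspin (h : IsSmoothSolution T m₀ E₀ H₀ m E H) : BddSmooth T (spin m) :=
  (h.bm.cross h.bm.dt).neg

lemma dt_eq_cross_spin (h : IsSmoothSolution T m₀ E₀ H₀ m E H) (hd : IsSmoothData m₀ E₀ H₀)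
    (hp : p ∈ slab T) : dt m p = cross (m p) (spin m p) := by
  rw [spin, cross_neg', cross_cross_of_unit (h.norm_m_eq_one hd hp) (h.inner_m_dt hp), neg_neg]

/-- Obtained by differentiating `∂ₜ m = m ∧ spin m` in space. This form exposes the cancellations of
`exchange_terms_gradient`. -/
lemma dt_dx_eq (h : IsSmoothSolution T m₀ E₀ H₀ m E H) (hd : IsSmoothData m₀ E₀ H₀)
    (hp : p ∈ slab T) (i : Fin 3) :
    dt (dx i m) p = cross (dx i m p) (spin m p) + cross (m p) (dx i (spin m) p) := by
  rw [dt_dx_comm i (h.bm.contDiffAt hp), ← dx_cross i (h.bm.differentiableAt hp)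
    (h.bspin.differentiableAt hp)]
  have : dt m =ᶠ[𝓝 p] fun q => cross (m q) (spin m q) := by
    filter_upwards [(isOpen_slab T).mem_nhds hp] with q hq using h.dt_eq_cross_spin hd hq
  simp only [dx, this.fderiv_eq]

lemma field_eq (h : IsSmoothSolution T m₀ E₀ H₀ m E H) (hd : IsSmoothData m₀ E₀ H₀)
    (hp : p ∈ slab T) :
    lap m p + H p = (1 / 2 : ℝ) • (dt m p + spin m p) + inner ℝ (m p) (lap m p + H p) • m p := by
  have := field_of_gilbert (h.norm_m_eq_one hd hp) (h.inner_m_dt hp) (h.gilbert_field hp)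
  rwa [sub_eq_add_neg] at this

variable {m₁ E₁ H₁ m₂ E₂ H₂ mt : ST → R3} {G : Fin 3 → ST → R3}

/-- The left side gathers the source terms of all the tested equations. After summing over
directions, the two exchange identities reduce it to the product of the time derivatives minus the
quadratic remainder. -/
lemma cross_terms (h : IsSmoothSolution T m₀ E₀ H₀ m₁ E₁ H₁) (hd : IsSmoothData m₀ E₀ H₀)
    (hp : p ∈ slab T) (hv : inner ℝ (m₂ p) (mt p) = 0) :
    inner ℝ (H₂ p) (dt m₁ p) + inner ℝ (H₁ p) (mt p)
      - (1 / 2) * inner ℝ (mt p + cross (m₂ p) (mt p)) (spin m₁ p)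
      + inner ℝ (cross (m₂ p) (H₂ p)) (spin m₁ p)
      + ∑ i, (inner ℝ (mt p) (dx i (dx i m₁) p) - inner ℝ (G i p) (dt (dx i m₁) p)
        - inner ℝ (cross (m₂ p) (G i p)) (dx i (spin m₁) p)
        + inner ℝ (m₂ p) (dx i (fun q => cross (dx i m₁ q) (spin m₁ q)) p)
        + inner ℝ (G i p) (cross (dx i m₁ p) (spin m₁ p))
        - dx i (fun q => inner ℝ (m₁ q) (cross (dx i m₁ q) (spin m₁ q))) p)
      = inner ℝ (dt m₁ p) (mt p) - remainder m₁ H₁ m₂ H₂ mt G p := by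
  have h1 : ∀ i, dx i (fun q => cross (dx i m₁ q) (spin m₁ q)) p
      = cross (dx i (dx i m₁) p) (spin m₁ p) + cross (dx i m₁ p) (dx i (spin m₁) p) := fun i =>
    dx_cross i ((h.bm.dx i).differentiableAt hp) (h.bspin.differentiableAt hp)
  have h2 : ∀ i, dx i (fun q => inner ℝ (m₁ q) (cross (dx i m₁ q) (spin m₁ q))) p
      = inner ℝ (m₁ p) (cross (dx i (dx i m₁) p) (spin m₁ p)
        + cross (dx i m₁ p) (dx i (spin m₁) p)) := fun i => by
    rw [dx_inner i (h.bm.differentiableAt hp) (((h.bm.dx i).cross h.bspin).differentiableAt hp),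
      inner_cross_self, zero_add, h1]
  have h3 := fun i => exchange_terms_gradient (m₁ p) (m₂ p) (dx i m₁ p) (G i p)
    (dx i (dx i m₁) p) (spin m₁ p) (dx i (spin m₁) p)
  have h4 := exchange_terms_field (H₂ := H₂ p) (h.dt_eq_cross_spin hd hp) (h.field_eq hd hp) hv
  have h5 : inner ℝ (m₁ p - m₂ p) (cross (lap m₁ p) (spin m₁ p))
      = ∑ i, inner ℝ (m₁ p - m₂ p) (cross (dx i (dx i m₁) p) (spin m₁ p)) := by
    simp only [lap, ← crossL_apply, map_sum, sum_apply, inner_sum]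
  have h6 : inner ℝ (mt p) (lap m₁ p) = ∑ i, inner ℝ (mt p) (dx i (dx i m₁) p) := by
    simp only [lap, inner_sum]
  simp only [h1, h2, h.dt_dx_eq hd hp, remainder]
  rw [h5, h6] at h4
  simp only [Fin.sum_univ_three] at h4 ⊢
  linear_combination h4 + h3 0 + h3 1 + h3 2

end IsSmoothSolution

lemma integral_combination {α : Type*} [MeasurableSpace α] {μ : Measure α} {A F K : α → ℝ}
    {D X Y : Fin 3 → α → ℝ} (hA : Integrable A μ) (hF : Integrable F μ) (hK : Integrable K μ)
    (hD : ∀ i, Integrable (D i) μ) (hX : ∀ i, Integrable (X i) μ) (hY : ∀ i, Integrable (Y i) μ) :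
    ∫ p, ((A p + F p) + ∑ i, (D i p + X i p - Y i p) - (1 / 2) * K p) ∂μ
      = ((∫ p, A p ∂μ) + ∫ p, F p ∂μ)
        + ∑ i, ((∫ p, D i p ∂μ) + (∫ p, X i p ∂μ) - ∫ p, Y i p ∂μ)
        - (1 / 2) * ∫ p, K p ∂μ := by
  have h1 : Integrable (fun p => A p + F p) μ := hA.add hF
  have h2 : ∀ i, Integrable (fun p => D i p + X i p) μ := fun i => (hD i).add (hX i)
  have h3 : ∀ i, Integrable (fun p => D i p + X i p - Y i p) μ := fun i => (h2 i).sub (hY i)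
  have h4 := integrable_finsetSum Finset.univ fun i _ => h3 i
  have h5 : Integrable (fun p => (A p + F p) + ∑ i, (D i p + X i p - Y i p)) μ := h1.add h4
  rw [integral_sub h5 (hK.const_mul _), integral_add h1 h4, integral_add hA hF,
    integral_finsetSum _ fun i _ => h3 i, integral_const_mul]
  simp only [integral_sub (h2 _) (hY _), integral_add (hD _) (hX _)]

namespace IsSmoothSolution

variable {S T lam : ℝ} {ζ : ℝ → ℝ} {θ : R3 → ℝ} {m₀ E₀ H₀ : R3 → R3}
variable {m₁ E₁ H₁ m₂ E₂ H₂ mt : ST → R3} {G : Fin 3 → ST → R3}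

/-- The density in the cross identity. -/
def crossDensity (ζ : ℝ → ℝ) (m₁ E₁ H₁ m₂ E₂ H₂ mt : ST → R3) (G : Fin 3 → ST → R3) (p : ST) : ℝ :=
  - deriv ζ p.1 * crossEnergy E₁ H₁ (fun i => dx i m₁) E₂ H₂ G p
    + ζ p.1 * (inner ℝ (dt m₁ p) (mt p) - remainder m₁ H₁ m₂ H₂ mt G p)

/-- The cross identity, localized in space. -/
lemma cross_loc (h : IsSmoothSolution T m₀ E₀ H₀ m₁ E₁ H₁)
    (W : IsWeakSolutionWith m₀ E₀ H₀ m₂ E₂ H₂ mt G) (hd : IsSmoothData m₀ E₀ H₀)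
    (hS : 0 < S) (hST : S < T) (hζ : IsTimeWeight S lam ζ)
    (hθ : ContDiff ℝ ∞ θ) (hcs : HasCompactSupport θ) :
    ∫ p in slab S, (θ p.2 * crossDensity ζ m₁ E₁ H₁ m₂ E₂ H₂ mt G p
      + ∑ i, sd i θ p.2 * (ζ p.1 * crossFlux m₁ E₁ H₁ m₂ E₂ H₂ mt G i p))
      = ζ 0 * ∫ x, θ x * energy₀ m₀ E₀ H₀ x := by
  have hT := hS.trans hST
  have hm₀ := hd.smooth_m.continuous
  have hE₀ := hd.smooth_E.continuous
  have hH₀ := hd.smooth_H.continuous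
  have hp₀ : ∀ i, Continuous (pd i m₀) := fun i =>
    (hd.smooth_m.continuous_fderiv (by simp)).clm_apply continuous_const
  have bX : ∀ i, BddSmooth T (fun q => cross (dx i m₁ q) (spin m₁ q)) := fun i =>
    (h.bm.dx i).cross h.bspin
  have bf : ∀ i, BddSmooth T (fun q => inner ℝ (m₁ q) (cross (dx i m₁ q) (spin m₁ q))) := fun i =>
    h.bm.inner (bX i)
  obtain ⟨iA, eA⟩ := W.ampere_loc hE₀ hST h.bE hζ hθ hcs h.smooth_E.initial
  obtain ⟨iF, eF⟩ := W.faraday_loc hm₀ hH₀ hST h.bH hζ hθ hcs h.smooth_H.initial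
  have hD := fun i => W.dt_dx_loc hd.smooth_m i hST (h.bm.dx i) hζ hθ hcs
    (h.smooth_m.tendsto_dx hT hd.smooth_m i)
  obtain ⟨iG, eG⟩ := W.gilbert_loc hST h.bspin hζ hθ hcs
  have hX := fun i => W.dx_loc' i hST (bX i) hζ hθ hcs
  have hθi : Integrable θ := hθ.continuous.integrable_of_hasCompactSupport hcs
  have hsd : ∀ i, Integrable (sd i θ) := fun i =>
    ((hθ.continuous_fderiv (by simp)).clm_apply continuous_const).integrable_of_hasCompactSupport
      ((hcs.fderiv ℝ).mono' fun x hx => subset_tsupport _ fun h0 => hx (by simp [h0]))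
  have eY := fun i => integral_slab_dx (bf i) hST i hθ hθi (hsd i) hζ.smooth.continuous
  have iY : ∀ i, IntegrableOn (fun p : ST => ζ p.1 *
      (θ p.2 * dx i (fun q => inner ℝ (m₁ q) (cross (dx i m₁ q) (spin m₁ q))) p
        + sd i θ p.2 * inner ℝ (m₁ p) (cross (dx i m₁ p) (spin m₁ p)))) (slab S) := fun i => by
    refine ((((bf i).dx i).integrableOn_slab hST hθi hζ.smooth.continuous).add
      ((bf i).integrableOn_slab hST (hsd i) hζ.smooth.continuous)).congr (ae_of_all _ fun p => ?_)
    simp only [Pi.add_apply]; ring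
  -- Gilbert enters with factor `-1/2`. The weak derivative formula tested with `∂ᵢ m₁ ∧ w` and the
  -- null divergence of `m₁ · (∂ᵢ m₁ ∧ w)` contribute zero, but they convert terms in `m₁ - m₂` and
  -- its gradient into products of differences.
  have hsum : ∫ p in slab S, (((pairing (fun p => - E₂ p) (fun p => - H₂ p) (fun _ => 0)
        (fun _ _ => 0) (loc ζ θ E₁) p + pairing (fun p => - H₂ p) E₂ mt (fun _ _ => 0)
        (loc ζ θ H₁) p)
      + ∑ i, (pairing (fun p => - G i p) (fun _ => 0) (fun _ => 0)
          (fun j p => if j = i then mt p else 0) (loc ζ θ (dx i m₁)) p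
        + pairing (fun _ => 0) (fun _ => 0) (G i) (fun j p => if j = i then m₂ p else 0)
          (loc ζ θ (fun q => cross (dx i m₁ q) (spin m₁ q))) p
        - ζ p.1 * (θ p.2 * dx i (fun q => inner ℝ (m₁ q) (cross (dx i m₁ q) (spin m₁ q))) p
          + sd i θ p.2 * inner ℝ (m₁ p) (cross (dx i m₁ p) (spin m₁ p)))))
      - (1 / 2) * pairing (fun _ => 0) (fun _ => 0)
          (fun p => mt p + cross (m₂ p) (mt p) - (2 : ℝ) • cross (m₂ p) (H₂ p))
          (fun i p => (2 : ℝ) • cross (m₂ p) (G i p)) (loc ζ θ (spin m₁)) p)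
      = ζ 0 * ∫ x, θ x * energy₀ m₀ E₀ H₀ x := by
    have hi : ∀ {u : R3 → R3}, Continuous u → Integrable fun x => θ x * inner ℝ (u x) (u x) :=
      fun hu => (hθ.continuous.mul (hu.inner hu)).integrable_of_hasCompactSupport hcs.mul_right
    have h0 : ∫ x, θ x * energy₀ m₀ E₀ H₀ x = ((∫ x, θ x * inner ℝ (E₀ x) (E₀ x))
        + ∫ x, θ x * inner ℝ (H₀ x) (H₀ x)) + ∑ i, ∫ x, θ x * inner ℝ (pd i m₀ x) (pd i m₀ x) := by
      have h1 : Integrable fun x => θ x * inner ℝ (E₀ x) (E₀ x) + θ x * inner ℝ (H₀ x) (H₀ x) :=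
        (hi hE₀).add (hi hH₀)
      rw [← integral_add (hi hE₀) (hi hH₀), ← integral_finsetSum _ fun i _ => hi (hp₀ i),
        ← integral_add h1 (integrable_finsetSum _ fun i _ => hi (hp₀ i))]
      refine integral_congr_ae (ae_of_all _ fun x => ?_)
      simp only [energy₀, real_inner_self_eq_norm_sq, Fin.sum_univ_three]
      ring
    rw [integral_combination iA iF iG (fun i => (hD i).1) (fun i => (hX i).1) iY, eA, eF, eG, h0]
    simp only [eY, (hD _).2, (hX _).2, add_zero, sub_zero, mul_zero, ← Finset.mul_sum]
    ring
  rw [← hsum]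
  refine integral_congr_ae ?_
  filter_upwards [W.inner_m_mt hm₀ hS, ae_restrict_mem (isOpen_slab S).measurableSet]
    with p hv hpS
  have hp := slab_mono hST.le hpS
  have key := h.cross_terms (m₂ := m₂) (H₂ := H₂) (G := G) hd hp hv
  have hE : curl H₁ p = dt E₁ p := (sub_eq_zero.1 (h.ampere p hp)).symm
  have hH : curl E₁ p = - dt m₁ p - dt H₁ p :=
    eq_sub_of_add_eq (by rw [add_comm]; exact h.faraday p hp)
  simp only [pairing_loc hζ.smooth hθ (h.bE.differentiableAt hp),
    pairing_loc hζ.smooth hθ (h.bH.differentiableAt hp),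
    pairing_loc hζ.smooth hθ (h.bspin.differentiableAt hp),
    fun i => pairing_loc hζ.smooth hθ ((h.bm.dx i).differentiableAt hp),
    fun i => pairing_loc hζ.smooth hθ ((bX i).differentiableAt hp), hE, hH]
  simp only [crossDensity, crossEnergy, crossFlux, Fin.sum_univ_three, inner_add_left,
    inner_sub_left, inner_neg_left, inner_sub_right, inner_neg_right, inner_zero_left,
    real_inner_smul_left, real_inner_comm (mt p) (H₁ p), real_inner_comm (E₂ p) (E₁ p), real_inner_comm (H₂ p) (H₁ p),
    real_inner_comm (G _ p) (dx _ m₁ p)] at key ⊢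
  simp
  linear_combination (-(θ p.2 * ζ p.1)) * key

end IsSmoothSolution

/-! ### Removal of the cutoff in space. -/

lemma exists_cutoff : ∃ (θ : ℕ → R3 → ℝ) (C : ℝ), 0 ≤ C ∧ (∀ n, ContDiff ℝ ∞ (θ n)) ∧
    (∀ n, HasCompactSupport (θ n)) ∧ (∀ n x, |θ n x| ≤ 1) ∧
    (∀ x, Tendsto (fun n => θ n x) atTop (𝓝 1)) ∧
    ∀ n i x, |sd i (θ n) x| ≤ C * (1 / ((n : ℝ) + 1)) := by
  let f : ContDiffBump (0 : R3) := ⟨1, 2, one_pos, one_lt_two⟩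
  have hf : ContDiff ℝ ∞ f := f.contDiff
  obtain ⟨C, hC⟩ := (hf.continuous_fderiv (by simp)).bounded_above_of_compact_support
    (f.hasCompactSupport.fderiv ℝ)
  let κ : ℕ → ℝ := fun n => 1 / ((n : ℝ) + 1)
  have hκ : ∀ n, 0 < κ n := fun n => by positivity
  refine ⟨fun n x => f (κ n • x), C, (norm_nonneg _).trans (hC 0), fun n => ?_, fun n => ?_,
    fun n x => ?_, fun x => ?_, fun n i x => ?_⟩
  · exact hf.comp (contDiff_const_smul (κ n))
  · exact f.hasCompactSupport.comp_homeomorph (Homeomorph.smulOfNeZero (κ n) (hκ n).ne')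
  · rw [abs_of_nonneg f.nonneg]; exact f.le_one
  · have h1 : Tendsto (fun n => κ n • x) atTop (𝓝 ((0 : ℝ) • x)) :=
      tendsto_one_div_add_atTop_nhds_zero_nat.smul_const x
    have h2 := (hf.continuous.tendsto _).comp h1
    rwa [zero_smul, f.one_of_mem_closedBall (by simp [f.rIn_pos.le])] at h2
  · have h1 : HasFDerivAt (fun y : R3 => f (κ n • y))
        ((fderiv ℝ f (κ n • x)).comp (κ n • ContinuousLinearMap.id ℝ R3)) x :=
      (hf.differentiable (by simp) _).hasFDerivAt.comp x
        ((ContinuousLinearMap.id ℝ R3).hasFDerivAt.const_smul (κ n))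
    rw [sd, h1.fderiv]
    have h2 := ((fderiv ℝ f (κ n • x)).le_opNorm (e i)).trans
      (mul_le_mul_of_nonneg_right (hC (κ n • x)) (norm_nonneg _))
    rw [norm_e, mul_one, Real.norm_eq_abs] at h2
    simp only [ContinuousLinearMap.comp_apply, smul_apply,
      ContinuousLinearMap.id_apply, map_smul, smul_eq_mul, abs_mul, abs_of_pos (hκ n)]
    rw [mul_comm]
    exact mul_le_mul_of_nonneg_right h2 (hκ n).le

/-- Dominated convergence along dilated cutoffs: they tend to `1` while their gradients are
`O(1/n)`, and the flux is integrable. -/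
lemma integral_eq_of_cutoff {S A : ℝ} {a : ST → ℝ} {c : Fin 3 → ST → ℝ} {b : R3 → ℝ}
    (ha : IntegrableOn a (slab S)) (hc : ∀ i, IntegrableOn (c i) (slab S)) (hb : Integrable b)
    (H : ∀ θ : R3 → ℝ, ContDiff ℝ ∞ θ → HasCompactSupport θ →
      ∫ p in slab S, (θ p.2 * a p + ∑ i, sd i θ p.2 * c i p) = A * ∫ x, θ x * b x) :
    ∫ p in slab S, a p = A * ∫ x, b x := by
  obtain ⟨θ, C, hC0, hs, hcs, h1, ht, hsd⟩ := exists_cutoff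
  have hκ : ∀ n : ℕ, 0 ≤ 1 / ((n : ℝ) + 1) ∧ 1 / ((n : ℝ) + 1) ≤ 1 := fun n =>
    ⟨by positivity, by rw [div_le_one (by positivity)]; linarith [n.cast_nonneg (α := ℝ)]⟩
  have hsd0 : ∀ i x, Tendsto (fun n => sd i (θ n) x) atTop (𝓝 0) := fun i x => by
    refine squeeze_zero_norm (fun n => hsd n i x) ?_
    simpa using tendsto_one_div_add_atTop_nhds_zero_nat.const_mul C
  have hsdc : ∀ n i, Continuous (sd i (θ n)) := fun n i =>
    ((hs n).continuous_fderiv (by simp)).clm_apply continuous_const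
  have hL : Tendsto (fun n => ∫ p in slab S, (θ n p.2 * a p + ∑ i, sd i (θ n) p.2 * c i p)) atTop
      (𝓝 (∫ p in slab S, a p)) := by
    refine tendsto_integral_of_dominated_convergence (fun p => |a p| + ∑ i, C * |c i p|)
      (fun n => ?_) ?_ (fun n => ae_of_all _ fun p => ?_) (ae_of_all _ fun p => ?_)
    · exact (((hs n).continuous.comp continuous_snd).aestronglyMeasurable.mul ha.1).add
        (Finset.aestronglyMeasurable_fun_sum _ fun i _ =>
          ((hsdc n i).comp continuous_snd).aestronglyMeasurable.mul (hc i).1)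
    · exact ha.abs.add (integrable_finsetSum _ fun i _ => (hc i).abs.const_mul C)
    · rw [Real.norm_eq_abs]
      refine (abs_add_le _ _).trans (add_le_add ?_ ((Finset.abs_sum_le_sum_abs _ _).trans
        (Finset.sum_le_sum fun i _ => ?_)))
      · rw [abs_mul]; exact mul_le_of_le_one_left (abs_nonneg _) (h1 n p.2)
      · rw [abs_mul]
        refine mul_le_mul_of_nonneg_right ((hsd n i p.2).trans ?_) (abs_nonneg _)
        exact mul_le_of_le_one_right hC0 (hκ n).2
    · have h2 := ((ht p.2).mul_const (a p)).add (tendsto_finsetSum Finset.univ fun i _ =>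
        (hsd0 i p.2).mul_const (c i p))
      simpa using h2
  have hR : Tendsto (fun n => A * ∫ x, θ n x * b x) atTop (𝓝 (A * ∫ x, b x)) := by
    refine Tendsto.const_mul A ?_
    refine tendsto_integral_of_dominated_convergence (fun x => |b x|)
      (fun n => (hs n).continuous.aestronglyMeasurable.mul hb.1) hb.abs
      (fun n => ae_of_all _ fun x => ?_) (ae_of_all _ fun x => ?_)
    · rw [Real.norm_eq_abs, abs_mul]; exact mul_le_of_le_one_left (abs_nonneg _) (h1 n x)
    · simpa using (ht x).mul_const (b x)
  exact tendsto_nhds_unique hL (hR.congr fun n => (H _ (hs n) (hcs n)).symm)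

section Products

variable {μ : Measure ST} {f g b : ST → R3} {C : ℝ}

lemma integrable_inner_of_memLp (hf : MemLp f 2 μ) (hg : MemLp g 2 μ) :
    Integrable (fun p => inner ℝ (f p) (g p)) μ :=
  (hf.norm.integrable_mul hg.norm).mono' (hf.1.inner hg.1)
    (ae_of_all _ fun _ => norm_inner_le_norm _ _)

lemma memLp_cross_left (hf : MemLp f 2 μ) (hb : AEStronglyMeasurable b μ)
    (hC : ∀ᵐ p ∂μ, ‖b p‖ ≤ C) : MemLp (fun p => cross (b p) (f p)) 2 μ := by
  refine hf.of_le_mul (c := C) (aestronglyMeasurable_cross hb hf.1) ?_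
  filter_upwards [hC] with p hp
  exact (norm_cross_le _ _).trans (mul_le_mul_of_nonneg_right hp (norm_nonneg _))

lemma memLp_cross_right (hf : MemLp f 2 μ) (hb : AEStronglyMeasurable b μ)
    (hC : ∀ᵐ p ∂μ, ‖b p‖ ≤ C) : MemLp (fun p => cross (f p) (b p)) 2 μ := by
  refine hf.of_le_mul (c := C) (aestronglyMeasurable_cross hf.1 hb) ?_
  filter_upwards [hC] with p hp
  rw [mul_comm]
  exact (norm_cross_le _ _).trans (mul_le_mul_of_nonneg_left hp (norm_nonneg _))

end Products

lemma inner_cross_eq (a b c : R3) : inner ℝ a (cross b c) = inner ℝ (cross a b) c := by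
  simp [inner_eq]; ring

lemma BddSmooth.meas_bound {F : Type} [NormedAddCommGroup F] [NormedSpace ℝ F]
    [SecondCountableTopology F] {S T : ℝ} {u : ST → F} (h : BddSmooth T u) (hST : S < T) :
    AEStronglyMeasurable u (volume.restrict (slab S)) ∧
      ∃ C, ∀ᵐ p ∂(volume.restrict (slab S)), ‖u p‖ ≤ C := by
  obtain ⟨C, _, hC⟩ := h.exists_bound hST
  refine ⟨(h.continuousOn.mono (slab_mono hST.le)).aestronglyMeasurable
    (isOpen_slab S).measurableSet, C, ?_⟩
  filter_upwards [ae_restrict_mem (isOpen_slab S).measurableSet] with p hp using hC p hp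

namespace IsSmoothSolution

variable {S T lam : ℝ} {ζ : ℝ → ℝ} {m₀ E₀ H₀ : R3 → R3}
variable {m₁ E₁ H₁ m₂ E₂ H₂ mt : ST → R3} {G : Fin 3 → ST → R3}

/-- The component of the effective field along the magnetization. -/
def longitudinal (m H : ST → R3) (p : ST) : ℝ := inner ℝ (m p) (lap m p + H p)

lemma blongitudinal (h : IsSmoothSolution T m₀ E₀ H₀ m₁ E₁ H₁) :
    BddSmooth T (longitudinal m₁ H₁) := by
  have : BddSmooth T (lap m₁) := by
    have := (((h.bm.dx 0).dx 0).add ((h.bm.dx 1).dx 1)).add ((h.bm.dx 2).dx 2)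
    unfold lap
    simpa only [Fin.sum_univ_three] using this
  exact h.bm.inner (this.add h.bH)

lemma integrable_remainder (h : IsSmoothSolution T m₀ E₀ H₀ m₁ E₁ H₁)
    (W : IsWeakSolutionWith m₀ E₀ H₀ m₂ E₂ H₂ mt G) (hd : IsSmoothData m₀ E₀ H₀)
    (hS : 0 < S) (hST : S < T)
    (hD : MemLp (fun p => m₁ p - m₂ p) 2 (volume.restrict (slab S))) :
    IntegrableOn (remainder m₁ H₁ m₂ H₂ mt G) (slab S) := by
  obtain ⟨-, lH, lg, lv⟩ := h.memLp_slab hd hS hST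
  obtain ⟨mw, Cw, hw⟩ := h.bspin.meas_bound hST
  obtain ⟨mc, Cc, hc⟩ := h.blongitudinal.meas_bound hST
  have lW := W.memLp_mt S hS
  have dw := memLp_cross_right hD mw hw
  refine (((((integrable_inner_of_memLp (lW.sub lv) dw).const_mul (1 / 2)).add
    ((integrable_inner_of_memLp hD (lv.sub lW)).bdd_mul mc hc)).sub
    (integrable_inner_of_memLp ((W.class_H.memLp S).sub lH) dw)).add
    (integrable_finsetSum Finset.univ fun i _ => ?_))
  obtain ⟨mi, Ci, hi⟩ := (h.bspin.dx i).meas_bound hST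
  exact integrable_inner_of_memLp (((W.grad_m i).memLp S).sub (lg i)) (memLp_cross_right hD mi hi)

/-- Moving the bounded magnetization inside the cross product with `∂ᵢ m₁` presents each term as a
product of two square integrable fields; the spin field is one of them. -/
lemma integrable_crossFlux (h : IsSmoothSolution T m₀ E₀ H₀ m₁ E₁ H₁)
    (W : IsWeakSolutionWith m₀ E₀ H₀ m₂ E₂ H₂ mt G) (hd : IsSmoothData m₀ E₀ H₀)
    (hS : 0 < S) (hST : S < T) (i : Fin 3) :
    IntegrableOn (crossFlux m₁ E₁ H₁ m₂ E₂ H₂ mt G i) (slab S) := by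
  obtain ⟨lE, lH, lg, lv⟩ := h.memLp_slab hd hS hST
  obtain ⟨mm, Cm, hm⟩ := h.bm.meas_bound hST
  have lw : MemLp (spin m₁) 2 (volume.restrict (slab S)) := (memLp_cross_left lv mm hm).neg
  have hcst : ∀ {f : ST → R3}, MemLp f 2 (volume.restrict (slab S)) →
      MemLp (fun p => cross (e i) (f p)) 2 (volume.restrict (slab S)) := fun hf =>
    memLp_cross_left hf aestronglyMeasurable_const (ae_of_all _ fun _ => le_rfl)
  unfold crossFlux
  simp only [inner_cross_eq (m₁ _), inner_cross_eq (m₂ _)]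
  exact (((((integrable_inner_of_memLp (W.class_E.memLp S) (hcst lH)).sub
    (integrable_inner_of_memLp (W.class_H.memLp S) (hcst lE))).add
    (integrable_inner_of_memLp (W.memLp_mt S hS) (lg i))).sub
    (integrable_inner_of_memLp (W.memLp_cross ((W.grad_m i).memLp S)) lw)).add
    (integrable_inner_of_memLp (W.memLp_cross (lg i)) lw)).sub
    (integrable_inner_of_memLp (memLp_cross_left (lg i) mm hm) lw)

lemma integrable_weight_mul (hζ : IsTimeWeight S lam ζ) {f : ST → ℝ}
    (hf : IntegrableOn f (slab S)) :
    IntegrableOn (fun p => ζ p.1 * f p) (slab S) ∧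
      IntegrableOn (fun p => - deriv ζ p.1 * f p) (slab S) := by
  obtain ⟨B, -, hB⟩ := hζ.exists_bound
  have hm := ae_restrict_mem (μ := volume) (isOpen_slab S).measurableSet
  refine ⟨hf.bdd_mul (c := B) (hζ.smooth.continuous.comp continuous_fst).aestronglyMeasurable ?_,
    hf.bdd_mul (c := B) (hζ.continuous_deriv.neg.comp continuous_fst).aestronglyMeasurable ?_⟩
  · filter_upwards [hm] with p hp
    exact (hB p.1 (mem_slab.1 hp).1.le (mem_slab.1 hp).2.le).1
  · filter_upwards [hm] with p hp
    rw [norm_neg]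
    exact (hB p.1 (mem_slab.1 hp).1.le (mem_slab.1 hp).2.le).2

/-- The cross identity between a smooth and a weak solution. -/
lemma cross_identity (h : IsSmoothSolution T m₀ E₀ H₀ m₁ E₁ H₁)
    (W : IsWeakSolutionWith m₀ E₀ H₀ m₂ E₂ H₂ mt G) (hd : IsSmoothData m₀ E₀ H₀)
    (hS : 0 < S) (hST : S < T) (hζ : IsTimeWeight S lam ζ)
    (hD : MemLp (fun p => m₁ p - m₂ p) 2 (volume.restrict (slab S))) :
    IntegrableOn (crossDensity ζ m₁ E₁ H₁ m₂ E₂ H₂ mt G) (slab S) ∧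
    ∫ p in slab S, crossDensity ζ m₁ E₁ H₁ m₂ E₂ H₂ mt G p
      = ζ 0 * ∫ x, energy₀ m₀ E₀ H₀ x := by
  obtain ⟨lE, lH, lg, lv⟩ := h.memLp_slab hd hS hST
  have hI : IntegrableOn (crossDensity ζ m₁ E₁ H₁ m₂ E₂ H₂ mt G) (slab S) := by
    refine (integrable_weight_mul hζ ?_).2.add (integrable_weight_mul hζ ?_).1
    · exact ((integrable_inner_of_memLp lE (W.class_E.memLp S)).add
        (integrable_inner_of_memLp lH (W.class_H.memLp S))).add
        (integrable_finsetSum Finset.univ fun i _ =>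
          integrable_inner_of_memLp (lg i) ((W.grad_m i).memLp S))
    · exact (integrable_inner_of_memLp lv (W.memLp_mt S hS)).sub
        (h.integrable_remainder W hd hS hST hD)
  exact ⟨hI, integral_eq_of_cutoff hI
    (fun i => (integrable_weight_mul hζ (h.integrable_crossFlux W hd hS hST i)).1)
    hd.integrable_energy₀ fun θ hθ hcs => h.cross_loc W hd hS hST hζ hθ hcs⟩

end IsSmoothSolution

/-! ### Relative energy estimate and conclusion. -/

lemma abs_inner_cross_le (a b c : R3) {K : ℝ} (hc : ‖c‖ ≤ K) :
    |inner ℝ a (cross b c)| ≤ K * (‖a‖ * ‖b‖) := by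
  refine (abs_real_inner_le_norm _ _).trans ?_
  calc ‖a‖ * ‖cross b c‖ ≤ ‖a‖ * (‖b‖ * ‖c‖) := by gcongr; exact norm_cross_le _ _
    _ ≤ ‖a‖ * (‖b‖ * K) := by gcongr
    _ = _ := by ring

namespace IsSmoothSolution

variable {S T lam : ℝ} {ζ : ℝ → ℝ} {m₀ E₀ H₀ : R3 → R3}
variable {m₁ E₁ H₁ m₂ E₂ H₂ mt : ST → R3} {G : Fin 3 → ST → R3}

lemma exists_coeff_bound (h : IsSmoothSolution T m₀ E₀ H₀ m₁ E₁ H₁) (hST : S < T) :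
    ∃ K, 0 ≤ K ∧ ∀ p ∈ slab S, ‖spin m₁ p‖ ≤ K ∧ |longitudinal m₁ H₁ p| ≤ K ∧
      ∀ i, ‖dx i (spin m₁) p‖ ≤ K := by
  obtain ⟨A, hA0, hA⟩ := h.bspin.exists_bound hST
  obtain ⟨B, hB0, hB⟩ := h.blongitudinal.exists_bound hST
  choose C hC0 hC using fun i => (h.bspin.dx i).exists_bound hST
  have hs := Finset.sum_nonneg fun i (_ : i ∈ Finset.univ) => hC0 i
  refine ⟨A + B + ∑ i, C i, by positivity, fun p hp => ⟨?_, ?_, fun i => ?_⟩⟩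
  · linarith [hA p hp]
  · have := hB p hp
    rw [Real.norm_eq_abs] at this
    linarith
  · have := Finset.single_le_sum (fun i _ => hC0 i) (Finset.mem_univ i)
    linarith [hC i p hp]

/-- With `d = |m₁ - m₂|`, Young's inequality is applied to `3K |v₁ - v₂| d` and to four terms of the
form `2K a d`, where `a` is `|H₁ - H₂|` or a difference of gradients. The cost is `(9/2 + 4) K² d²`,
rounded up to `9 K² d²`. -/
lemma neg_remainder_le {K : ℝ} {p : ST} (hw : ‖spin m₁ p‖ ≤ K)
    (hc : |longitudinal m₁ H₁ p| ≤ K) (hi : ∀ i, ‖dx i (spin m₁) p‖ ≤ K) :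
    - (2 * remainder m₁ H₁ m₂ H₂ mt G p) ≤ (1 / 2) * ‖dt m₁ p - mt p‖ ^ 2
      + 9 * K ^ 2 * ‖m₁ p - m₂ p‖ ^ 2
      + (‖H₁ p - H₂ p‖ ^ 2 + ∑ i, ‖dx i m₁ p - G i p‖ ^ 2) := by
  have h1 := neg_le_of_abs_le (abs_inner_cross_le (mt p - dt m₁ p) (m₁ p - m₂ p) _ hw)
  have h2 : |longitudinal m₁ H₁ p * inner ℝ (m₁ p - m₂ p) (dt m₁ p - mt p)|
      ≤ K * (‖dt m₁ p - mt p‖ * ‖m₁ p - m₂ p‖) := by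
    rw [abs_mul, mul_comm ‖dt m₁ p - mt p‖]
    exact mul_le_mul hc (abs_real_inner_le_norm _ _) (abs_nonneg _) ((abs_nonneg _).trans hc)
  have h3 := le_of_abs_le (abs_inner_cross_le (H₂ p - H₁ p) (m₁ p - m₂ p) _ hw)
  have h4 := fun i => neg_le_of_abs_le
    (abs_inner_cross_le (G i p - dx i m₁ p) (m₁ p - m₂ p) _ (hi i))
  have h2' := neg_le_of_abs_le h2
  rw [norm_sub_rev] at h1 h3
  simp only [norm_sub_rev (G _ p)] at h4
  unfold longitudinal at h2'
  unfold remainder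
  simp only [Fin.sum_univ_three]
  nlinarith [h4 0, h4 1, h4 2, sq_nonneg (‖dt m₁ p - mt p‖ - 3 * K * ‖m₁ p - m₂ p‖),
    sq_nonneg (‖H₁ p - H₂ p‖ - K * ‖m₁ p - m₂ p‖),
    sq_nonneg (‖dx 0 m₁ p - G 0 p‖ - K * ‖m₁ p - m₂ p‖),
    sq_nonneg (‖dx 1 m₁ p - G 1 p‖ - K * ‖m₁ p - m₂ p‖),
    sq_nonneg (‖dx 2 m₁ p - G 2 p‖ - K * ‖m₁ p - m₂ p‖), sq_nonneg (K * ‖m₁ p - m₂ p‖)]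

lemma relative_energy (p : ST) :
    weightedEnergy ζ E₁ H₁ (fun i => dx i m₁) (dt m₁) p + weightedEnergy ζ E₂ H₂ G mt p
      - 2 * crossDensity ζ m₁ E₁ H₁ m₂ E₂ H₂ mt G p
      = - deriv ζ p.1 * (‖E₁ p - E₂ p‖ ^ 2 + ‖H₁ p - H₂ p‖ ^ 2 + ∑ i, ‖dx i m₁ p - G i p‖ ^ 2)
        + ζ p.1 * (‖dt m₁ p - mt p‖ ^ 2 + 2 * remainder m₁ H₁ m₂ H₂ mt G p) := by
  simp only [weightedEnergy, energyDensity, crossDensity, crossEnergy, norm_sub_sq_real,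
    Fin.sum_univ_three]
  ring

lemma uniqueness_slab (h : IsSmoothSolution T m₀ E₀ H₀ m₁ E₁ H₁)
    (W : IsWeakSolutionWith m₀ E₀ H₀ m₂ E₂ H₂ mt G) (hd : IsSmoothData m₀ E₀ H₀)
    (hS : 0 < S) (hST : S < T) :
    ∀ᵐ p ∂(volume.restrict (slab S)), m₂ p = m₁ p ∧ E₂ p = E₁ p ∧ H₂ p = H₁ p := by
  obtain ⟨K, hK0, hK⟩ := h.exists_coeff_bound hST
  -- The summand `2` absorbs the field and gradient differences of the remainder with one copy of
  -- `ζ` to spare; `36 K² S` makes `9 K² S / lam ≤ 1/4`.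
  set lam : ℝ := 2 + 36 * K ^ 2 * S with hlam
  have hl2 : 2 ≤ lam := by have : 0 ≤ 36 * K ^ 2 * S := by positivity
                           linarith
  have hl : 0 < lam := by linarith
  obtain ⟨ζ, hζ⟩ := exists_isTimeWeight hS hl
  obtain ⟨hD, hdle⟩ := memLp_sub h W hd hS hST hζ hl
  obtain ⟨i1, e1⟩ := h.energy_le hd hS hST hζ (by linarith)
  obtain ⟨i2, e2⟩ := W.energy_le hd hS hζ hl.le
  obtain ⟨i3, e3⟩ := h.cross_identity W hd hS hST hζ hD
  obtain ⟨lE, lH, -, lv⟩ := h.memLp_slab hd hS hST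
  have hms := (isOpen_slab S).measurableSet
  have hsq : ∀ {f : ST → R3}, MemLp f 2 (volume.restrict (slab S)) →
      IntegrableOn (fun p => ζ p.1 * ‖f p‖ ^ 2) (slab S) := fun hf =>
    (integrable_weight_mul hζ ((memLp_two_iff_integrable_sq_norm hf.1).1 hf)).1
  have iE := hsq (lE.sub (W.class_E.memLp S))
  have iH := hsq (lH.sub (W.class_H.memLp S))
  have iv := hsq (lv.sub (W.memLp_mt S hS))
  have iD := hsq hD
  simp only [Pi.sub_apply] at iE iH iv
  have hn : ∀ f : ST → R3, 0 ≤ᵐ[volume.restrict (slab S)] fun p => ζ p.1 * ‖f p‖ ^ 2 := fun f =>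
    ae_of_all _ fun p => mul_nonneg (hζ.nonneg _) (by positivity)
  -- The relative energy has nonpositive integral because the initial energy enters once for each
  -- solution and minus twice for the cross term; its integrand is bounded below using `-ζ' ≥ 2ζ`
  -- and the remainder estimate.
  have hmain : ((∫ p in slab S, ζ p.1 * ‖E₁ p - E₂ p‖ ^ 2) + ∫ p in slab S, ζ p.1 * ‖H₁ p - H₂ p‖ ^ 2)
      + ((1 / 2) * ∫ p in slab S, ζ p.1 * ‖dt m₁ p - mt p‖ ^ 2)
      - 9 * K ^ 2 * ∫ p in slab S, ζ p.1 * ‖m₁ p - m₂ p‖ ^ 2 ≤ 0 := by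
    have j1 : Integrable (fun p => ζ p.1 * ‖E₁ p - E₂ p‖ ^ 2 + ζ p.1 * ‖H₁ p - H₂ p‖ ^ 2)
      (volume.restrict (slab S)) := iE.add iH
    have j2 : Integrable (fun p => ζ p.1 * ‖E₁ p - E₂ p‖ ^ 2 + ζ p.1 * ‖H₁ p - H₂ p‖ ^ 2
      + (1 / 2) * (ζ p.1 * ‖dt m₁ p - mt p‖ ^ 2)) (volume.restrict (slab S)) :=
      j1.add (iv.const_mul _)
    have j3 : Integrable (fun p => weightedEnergy ζ E₁ H₁ (fun i => dx i m₁) (dt m₁) p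
      + weightedEnergy ζ E₂ H₂ G mt p) (volume.restrict (slab S)) := i1.add i2
    rw [← integral_add iE iH, ← integral_const_mul, ← integral_add j1 (iv.const_mul _),
      ← integral_const_mul, ← integral_sub j2 (iD.const_mul _)]
    calc _ ≤ ∫ p in slab S, (weightedEnergy ζ E₁ H₁ (fun i => dx i m₁) (dt m₁) p
          + weightedEnergy ζ E₂ H₂ G mt p - 2 * crossDensity ζ m₁ E₁ H₁ m₂ E₂ H₂ mt G p) := by
          refine setIntegral_mono_on (j2.sub (iD.const_mul _)) (j3.sub (i3.const_mul 2)) hms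
            fun p hp => ?_
          obtain ⟨hw, hc, hi⟩ := hK p hp
          have hr := mul_le_mul_of_nonneg_left (neg_remainder_le (m₂ := m₂) (H₂ := H₂) (mt := mt)
            (G := G) hw hc hi) (hζ.nonneg p.1)
          have hz := hζ.nonneg p.1
          have hg : 0 ≤ ∑ i, ‖dx i m₁ p - G i p‖ ^ 2 := by positivity
          have hdec : 2 * ζ p.1 ≤ - deriv ζ p.1 :=
            (mul_le_mul_of_nonneg_right hl2 hz).trans
              (hζ.decay p.1 (mem_slab.1 hp).1 (mem_slab.1 hp).2)
          have he := mul_le_mul_of_nonneg_right hdec (show 0 ≤ ‖E₁ p - E₂ p‖ ^ 2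
            + ‖H₁ p - H₂ p‖ ^ 2 + ∑ i, ‖dx i m₁ p - G i p‖ ^ 2 by positivity)
          rw [relative_energy]
          nlinarith [mul_nonneg hz hg, mul_nonneg hz (sq_nonneg ‖E₁ p - E₂ p‖),
            mul_nonneg hz (sq_nonneg ‖H₁ p - H₂ p‖)]
      _ ≤ 0 := by
          rw [integral_sub j3 (i3.const_mul 2), integral_add i1 i2, integral_const_mul, e3]
          linarith
  have nE := integral_nonneg_of_ae (hn fun p => E₁ p - E₂ p)
  have nH := integral_nonneg_of_ae (hn fun p => H₁ p - H₂ p)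
  have nD := integral_nonneg_of_ae (hn fun p => m₁ p - m₂ p)
  have nv := integral_nonneg_of_ae (hn fun p => dt m₁ p - mt p)
  -- The negative term uses at most half of the available `1/2` of the dissipation, so every
  -- weighted integral vanishes.
  have hsmall : 9 * K ^ 2 * ∫ p in slab S, ζ p.1 * ‖m₁ p - m₂ p‖ ^ 2
      ≤ (1 / 4) * ∫ p in slab S, ζ p.1 * ‖dt m₁ p - mt p‖ ^ 2 := by
    refine (mul_le_mul_of_nonneg_left hdle (by positivity)).trans ?_
    rw [← mul_assoc]
    refine mul_le_mul_of_nonneg_right ?_ nv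
    rw [← mul_div_assoc, div_le_iff₀ hl]
    linarith
  have zv : ∫ p in slab S, ζ p.1 * ‖dt m₁ p - mt p‖ ^ 2 = 0 := by linarith
  have zE : ∫ p in slab S, ζ p.1 * ‖E₁ p - E₂ p‖ ^ 2 = 0 := by linarith
  have zH : ∫ p in slab S, ζ p.1 * ‖H₁ p - H₂ p‖ ^ 2 = 0 := by linarith
  have zD : ∫ p in slab S, ζ p.1 * ‖m₁ p - m₂ p‖ ^ 2 = 0 := by
    rw [zv, mul_zero] at hdle
    exact le_antisymm hdle nD
  filter_upwards [(integral_eq_zero_iff_of_nonneg_ae (hn _) iE).1 zE,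
    (integral_eq_zero_iff_of_nonneg_ae (hn _) iH).1 zH,
    (integral_eq_zero_iff_of_nonneg_ae (hn _) iD).1 zD, ae_restrict_mem hms] with p pE pH pD hp
  have hz := (hζ.pos p.1 (mem_slab.1 hp).2).ne'
  have hfin : ∀ {a b : R3}, ζ p.1 * ‖a - b‖ ^ 2 = 0 → b = a := fun hab => by
    have := (mul_eq_zero.1 hab).resolve_left hz
    exact (sub_eq_zero.1 (norm_eq_zero.1 (pow_eq_zero_iff two_ne_zero |>.1 this))).symm
  exact ⟨hfin pD, hfin pE, hfin pH⟩

end IsSmoothSolution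

/-- A property holding almost everywhere on `(0, S) × ℝ³` for all `S < T` holds almost everywhere
on `(0, T) × ℝ³`. -/
lemma ae_slab_of_lt {T : ℝ} (hT : 0 < T) {P : ST → Prop}
    (h : ∀ S, 0 < S → S < T → ∀ᵐ p ∂(volume.restrict (slab S)), P p) :
    ∀ᵐ p ∂(volume.restrict (slab T)), P p := by
  obtain ⟨u, -, hu, hlim⟩ := exists_seq_strictMono_tendsto' hT
  have hsub : slab T ⊆ ⋃ n, slab (u n) := fun p hp => by
    obtain ⟨n, hn⟩ := (hlim.eventually_const_lt (mem_slab.1 hp).2).exists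
    exact mem_iUnion.2 ⟨n, mem_slab.2 ⟨(mem_slab.1 hp).1, hn⟩⟩
  refine ae_restrict_of_ae_restrict_of_subset hsub ?_
  rw [ae_restrict_iUnion_iff]
  exact fun n => h _ (hu n).1 (hu n).2

end

end MLL

theorem theorem2p2 (m₀ E₀ H₀ : MLL.R3 → MLL.R3) (hdata : MLL.IsSmoothData m₀ E₀ H₀)
    (m₂ E₂ H₂ : MLL.ST → MLL.R3) (hweak : MLL.IsWeakSolution m₀ E₀ H₀ m₂ E₂ H₂)
    (T : ℝ) (hT : 0 < T)
    (m₁ E₁ H₁ : MLL.ST → MLL.R3) (hsmooth : MLL.IsSmoothSolution T m₀ E₀ H₀ m₁ E₁ H₁) :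
    ∀ᵐ p ∂(MeasureTheory.volume.restrict (MLL.slab T)),
      m₂ p = m₁ p ∧ E₂ p = E₁ p ∧ H₂ p = H₁ p := by
  obtain ⟨mt, G, W⟩ := hweak
  exact MLL.ae_slab_of_lt hT fun S hS hST => hsmooth.uniqueness_slab W hdata hS hST
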